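/- **Conventions.** A non-commutative probability space is a pair $(\mathcal A,\tau)$ of a complex associative unital algebra and a unital linear functional $\tau:\mathcal A\to\mathbb C$. Elements $X,Y\in\mathcal A$ are *freely independent* if $\tau$ vanishes on every non-empty alternating product of polynomials in $X$ and polynomials in $Y$ (beginning and ending with either variable) whose factors all have expectation $0$. A compactly supported probability measure $\mu$ on $\mathbb R$ is the *distribution* of $X$ if $\tau[X^n]=\int t^n\,\mu(dt)$ for all $n$. $X$ is *semicircular* if its distribution is the Wigner semicircle measure $\mu(dt)=\frac1{2\pi}\sqrt{4-t^2}\,dt$ on $[-2,2]$. For compactly supported probability measures $\mu,\nu$ on $\mathbb R$, $\mu\boxplus\nu$ is the distribution of $X+Y$, where $X,Y$ are freely independent bounded self-adjoint elements, with distributions $\mu,\nu$, of some $*$-probability space $(\mathcal A,\tau)$ with positive expectation ($\tau[A^*]=\overline{\tau[A]}$, $\tau[AA^*]\ge 0$). For a permutation $\sigma\in S(n)$, $\tau_\sigma[A_1,\dots,A_n]$ is the product over the cycles $(k\ \sigma(k)\ \sigma^2(k)\cdots)$ of $\sigma$, fixed points included, of $\tau[A_kA_{\sigma(k)}A_{\sigma^2(k)}\cdots]$.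 Let $\gamma=(1\ 2\ \cdots\ n)$, and let $NC_2(n)$ be the set of non-crossing pairings of $\{1,\dots,n\}$, viewed as fixed-point-free involutions; $\pi\gamma$ means first $\gamma$, then $\pi$. Let $\operatorname{tr}_N$ be the normalized trace and $\tau_N=\mathbb E\otimes\operatorname{tr}_N$ the expected normalized trace on $N\times N$ random matrices; deterministic matrices are regarded as constant random matrices. An $N\times N$ *GUE matrix* is $X_N=\frac12(Z_N+Z_N^*)$, where the entries of $Z_N$ are iid centred complex Gaussians whose real and imaginary parts are independent of variance $1/N$, so that $\mathbb E[X_N(ij)\overline{X_N(kl)}]=\delta_{ik}\delta_{jl}/N$. Sequences $X_N,Y_N$ are *asymptotically free* if $\tau_N$ of every non-empty alternating product of polynomials in $X_N$ and polynomials in $Y_N$ tends to $0$ whenever $\tau_N$ of each factor tends to $0$. **Theorem.** For each $N$ let $X_N$ be an $N\times N$ GUE matrix. (1) Let $(\mathcal A,\tau)$ be a non-commutative probability space, $Y\in\mathcal A$, and let $Y_N$ be deterministic $N\times N$ complex matrices with $\lim_{N\to\infty}\operatorname{tr}_N[Y_N^n]=\tau[Y^n]$ for all $n$. Then: (a) for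 all $n$ and all $q:\{1,\dots,n\}\to\{0,1,2,\dots\}$, $$\lim_{N\to\infty}\tau_N\big[X_NY_N^{q(1)}\cdots X_NY_N^{q(n)}\big]=\sum_{\pi\in NC_2(n)}\tau_{\pi\gamma}\big[Y^{q(1)},\dots,Y^{q(n)}\big];$$ (b) $X_N$ and $Y_N$ are asymptotically free with respect to $\tau_N$; (c) if $X\in\mathcal A$ is semicircular and freely independent of $Y$, then $\tau[XY^{q(1)}\cdots XY^{q(n)}]=\sum_{\pi\in NC_2(n)}\tau_{\pi\gamma}[Y^{q(1)},\dots,Y^{q(n)}]$ for all $n$ and $q$, and for all $n$ and all $p,q:\{1,\dots,n\}\to\{0,1,2,\dots\}$, $$\lim_{N\to\infty}\tau_N\big[X_N^{p(1)}Y_N^{q(1)}\cdots X_N^{p(n)}Y_N^{q(n)}\big]=\tau\big[X^{p(1)}Y^{q(1)}\cdots X^{p(n)}Y^{q(n)}\big].$$ (2) (GUE + deterministic.) Let $Y_N$ be deterministic Hermitian $N\times N$ matrices whose spectral measures $\frac1N\sum_k\delta_{\lambda_k(Y_N)}$ converge weakly to a compactly supported probability measure $\nu$ on $\mathbb R$.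 Then the free convolution $\sigma=\mu\boxplus\nu$ with the Wigner semicircle measure $\mu$ exists and is unique, and $\sigma$ is the limit distribution of $X_N+Y_N$: the mean spectral measures $\mathbb E\big[\frac1N\sum_k\delta_{\lambda_k(X_N+Y_N)}\big]$ converge weakly to $\sigma$. If moreover $\operatorname{tr}_N[Y_N^n]\to\int t^n\,\nu(dt)$ for all $n$, then also $\tau_N[(X_N+Y_N)^n]\to\int t^n\,\sigma(dt)$ for all $n$. -/

import Mathlib

open MeasureTheory ProbabilityTheory Filter Topology
open scoped NNReal ENNReal ComplexConjugate BoundedContinuousFunction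

noncomputable section

namespace FreeProb

/-! ### Non-commutative probability spaces, free independence, distributions -/

/-- The element of the algebra obtained by evaluating a polynomial `f` at `x` (colour `false`) or
at `y` (colour `true`). -/
def letter {A : Type*} [Ring A] [Algebra ℂ A] (x y : A) (p : Bool × Polynomial ℂ) : A :=
  Polynomial.aeval (if p.1 then y else x) p.2

/-- Free independence of `x` and `y` with respect to the expectation `τ`: `τ` vanishes on every
non-empty alternating product of polynomials in `x` and polynomials in `y` each of which has
expectation zero. -/
def FreelyIndependent {A : Type*} [Ring A] [Algebra ℂ A] (τ : A →ₗ[ℂ] ℂ) (x y : A) : Prop :=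
  ∀ w : List (Bool × Polynomial ℂ), w ≠ [] → w.IsChain (fun p p' => p.1 ≠ p'.1) →
    (∀ p ∈ w, τ (letter x y p) = 0) → τ (w.map (letter x y)).prod = 0

/-- Asymptotic freeness: free independence holds in the limit `N → ∞`. -/
def AsymptoticallyFree {A : ℕ → Type*} [∀ N, Ring (A N)] [∀ N, Algebra ℂ (A N)]
    (τ : ∀ N, A N → ℂ) (x y : ∀ N, A N) : Prop :=
  ∀ w : List (Bool × Polynomial ℂ), w ≠ [] → w.IsChain (fun p p' => p.1 ≠ p'.1) →
    (∀ p ∈ w, Tendsto (fun N => τ N (letter (x N) (y N) p)) atTop (𝓝 0)) →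
    Tendsto (fun N => τ N (w.map (letter (x N) (y N))).prod) atTop (𝓝 0)

/-- `μ` is a compactly supported probability measure on the line and it is the distribution of
the random variable `x`, that is, `τ[xⁿ] = ∫ tⁿ μ(dt)` for all `n`.  (The compact support of `μ`
makes `x` a bounded random variable, `sup_k |τ[x^{2k}]|^{1/(2k)} < ∞`.) -/
structure HasDistribution {A : Type*} [Ring A] [Algebra ℂ A] (τ : A →ₗ[ℂ] ℂ) (x : A)
    (μ : Measure ℝ) : Prop where
  isProbabilityMeasure : IsProbabilityMeasure μ
  compactSupport : ∃ K : Set ℝ, IsCompact K ∧ μ Kᶜ = 0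
  moments : ∀ n : ℕ, τ (x ^ n) = ((∫ t, t ^ n ∂μ : ℝ) : ℂ)

/-- The Wigner semicircle measure `(1 / 2π) √(4 - t²) dt` on `[-2, 2]` (`Real.sqrt` vanishes at
negative arguments). -/
def semicircle : Measure ℝ :=
  volume.withDensity fun t => ENNReal.ofReal (Real.sqrt (4 - t ^ 2) / (2 * Real.pi))

/-- `x` is a (standard) semicircular random variable. -/
def IsSemicircular {A : Type*} [Ring A] [Algebra ℂ A] (τ : A →ₗ[ℂ] ℂ) (x : A) : Prop :=
  HasDistribution τ x semicircle

/-- The expectation of a non-commutative `*`-probability space with non-negative expectation: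
unital, compatible with `*`, and positive. -/
structure IsStarExpectation {A : Type*} [Ring A] [StarRing A] [Algebra ℂ A] [StarModule ℂ A]
    (τ : A →ₗ[ℂ] ℂ) : Prop where
  unital : τ 1 = 1
  map_star : ∀ a, τ (star a) = conj (τ a)
  nonneg : ∀ a, ∃ r : ℝ, 0 ≤ r ∧ τ (a * star a) = (r : ℂ)

/-- `ρ = μ ⊞ ν`: the measure `ρ` is the distribution of `x + y`, where `x, y` are freely
independent (bounded) self-adjoint random variables with distributions `μ` and `ν` living in some
`*`-probability space with non-negative expectation. -/
def IsFreeConvolution (μ ν ρ : Measure ℝ) : Prop :=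
  ∃ (A : Type) (_ : Ring A) (_ : StarRing A) (_ : Algebra ℂ A) (_ : StarModule ℂ A)
    (τ : A →ₗ[ℂ] ℂ) (x y : A),
    IsStarExpectation τ ∧ IsSelfAdjoint x ∧ IsSelfAdjoint y ∧ FreelyIndependent τ x y ∧
      HasDistribution τ x μ ∧ HasDistribution τ y ν ∧ HasDistribution τ (x + y) ρ

/-! ### Non-crossing pairings and products of expectations over cycles -/

/-- `π` is a pairing of `n` points, viewed as a fixed point free involution, without crossings
`a < b < c < d`, `{a, c}, {b, d} ∈ π`. -/
def IsNonCrossingPairing {n : ℕ} (π : Equiv.Perm (Fin n)) : Prop :=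
  (∀ k, π (π k) = k) ∧ (∀ k, π k ≠ k) ∧
    ¬ ∃ a b c d : Fin n, a < b ∧ b < c ∧ c < d ∧ π a = c ∧ π b = d

open scoped Classical in
/-- The set `NC₂(n)` of non-crossing pairings of `n` points. -/
def nonCrossingPairings (n : ℕ) : Finset (Equiv.Perm (Fin n)) :=
  Finset.univ.filter IsNonCrossingPairing

/-- The product of the `a k` along the cycle `k, σ k, σ² k, …` of `σ` through `k`, in this
order. -/
def cycleProd {A : Type*} [Ring A] {n : ℕ} (σ : Equiv.Perm (Fin n)) (a : Fin n → A)
    (k : Fin n) : A :=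
  ((List.range (Function.minimalPeriod σ k)).map fun j => a ((σ ^ j) k)).prod

open scoped Classical in
/-- `τ_σ[a₁, …, aₙ]`: the product of `τ` over the cycles of `σ` (fixed points included), each cycle
being read from its least element. -/
def cycleExpectation {A : Type*} [Ring A] (τ : A → ℂ) {n : ℕ} (σ : Equiv.Perm (Fin n))
    (a : Fin n → A) : ℂ :=
  ∏ k ∈ Finset.univ.filter (fun k : Fin n => ∀ l, σ.SameCycle k l → k ≤ l), τ (cycleProd σ a k)

/-! ### Random matrices -/

/-- The normalized trace. -/
def normTrace {N : ℕ} (M : Matrix (Fin N) (Fin N) ℂ) : ℂ := M.trace / (N : ℂ)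

/-- `E ⊗ tr_N`, the expected normalized trace of a random matrix. -/
def expNormTrace {N : ℕ} {Ω : Type*} [MeasurableSpace Ω] (P : Measure Ω)
    (M : Ω → Matrix (Fin N) (Fin N) ℂ) : ℂ :=
  ∫ ω, normTrace (M ω) ∂P

/-- A deterministic matrix as a constant random matrix. -/
def constMatrix {N : ℕ} (Ω : Type*) (M : Matrix (Fin N) (Fin N) ℂ) :
    Ω → Matrix (Fin N) (Fin N) ℂ :=
  fun _ => M

/-- The centred complex Gaussian law whose real and imaginary parts are independent real
Gaussians of variance `v`. -/
def complexGaussian (v : ℝ≥0) : Measure ℂ :=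
  ((gaussianReal 0 v).prod (gaussianReal 0 v)).map fun p => (p.1 : ℂ) + (p.2 : ℂ) * Complex.I

/-- The joint law of the entries of an `N × N` Ginibre matrix `Z`: they are iid complex Gaussians
whose real and imaginary parts have variance `1 / N`. -/
def ginibreLaw (N : ℕ) : Measure (Fin N → Fin N → ℂ) :=
  Measure.pi fun _ => Measure.pi fun _ => complexGaussian (N : ℝ≥0)⁻¹

/-- The joint law of the entries of `X = (Z + Z*) / 2`, with `Z` a Ginibre matrix.  In this
normalization `E[X(ij) conj (X(kl))] = δ_ik δ_jl / N`. -/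
def gueLaw (N : ℕ) : Measure (Fin N → Fin N → ℂ) :=
  (ginibreLaw N).map fun Z i j => (Z i j + conj (Z j i)) / 2

/-- `X` is an `N × N` GUE random matrix on the probability space `(Ω, P)`. -/
structure IsGUE {N : ℕ} {Ω : Type*} [MeasurableSpace Ω] (P : Measure Ω)
    (X : Ω → Matrix (Fin N) (Fin N) ℂ) : Prop where
  isHermitian : ∀ ω, (X ω).IsHermitian
  hasLaw : HasLaw (fun ω i j => X ω i j) (gueLaw N) P

/-- The spectral measure `(1 / N) ∑ δ_{λ_k}` of an `N × N` Hermitian matrix. -/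
def spectralMeasure {N : ℕ} {M : Matrix (Fin N) (Fin N) ℂ} (hM : M.IsHermitian) : Measure ℝ :=
  (N : ℝ≥0∞)⁻¹ • ∑ k, Measure.dirac (hM.eigenvalues k)

end FreeProb

end

open FreeProb

/-!
The proof describes the large `N` limit of a GUE matrix `X` and deterministic matrices `Y` by a
linear functional `φ` on the free algebra `ℂ⟨X, Y⟩`, and derives every assertion from two
properties of `φ`: it is a trace, and it satisfies the *Schwinger-Dyson equation*
`φ(X f) = (φ ⊗ φ)(∂f)`, where `∂` is the free difference quotient, the derivation with `∂X = 1 ⊗ 1`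
and `∂Y = 0`.

*Construction of the functional.* Gaussian integration by parts (`IsGUE.integral_X_mul`), applied
to a product of normalized traces of words in `X` and `Y`, removes a letter `X`: either the trace
that contains it is split at another letter `X`, or it is merged with another trace, and the
merging terms carry a factor `1 / N ^ 2` (`IsGUE.exp_genericTrace_mul`). By induction on the number
of letters `X`, the expectation of a product of traces of words has a limit, which is the product
of the limits for the single words (`factorizes`), provided that the moments of `Y` converge. The
limits define `φ`, and in the limit only the splitting terms survive
(`isSchwingerDyson_limitFunctional`).

*Consequences of the Schwinger-Dyson equation.* It implies that `X` and `Y` are free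
(`IsSchwingerDyson.freelyIndependent`), by induction on the length of an alternating centred
product, and it reduces to the Catalan recursion for the moments of `X`
(`IsSchwingerDyson.map_X_pow`), which are therefore those of the semicircle law. Applied to
`X Y^{q(1)} ⋯ X Y^{q(n)}`, it is a recursion over the partner of the first letter `X`, and so are
the non-crossing pairings: a pairing falls apart into what is inside and what is outside of the arc
of the first point (`exists_sum_nonCrossing`). The cycles of `π γ` are the classes of gaps between
neighbouring points which are connected by `π` (`sameCycle_iff_gapLabel`); with this description
the two recursions agree (`IsSchwingerDyson.map_prod_eq_sum`). Since freeness and the marginal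
moments determine all joint moments (`FreelyIndependent.lift_eq`), the formulas for `φ` hold for
every pair of a semicircular variable and a variable free from it.

*The limit distribution of `X + Y`.* If the moments of `Y` converge to those of a measure on
`[-R, R]`, then the Schwinger-Dyson equation bounds the moments of `X + Y` under `φ` by
`(2 + R) ^ n` (`IsSchwingerDyson.norm_add_pow_le`), and the method of moments
(`exists_tendsto_of_tendsto_moments`) gives the weak limit `σ` of the mean spectral measures. The
free algebra, with the conjugate-linear star operation that fixes `X` and `Y`, is a `*`-probability
space under `φ` (`isStarExpectation_limitFunctional`), so that `σ` is a free convolution; it is the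
only one, as compactly supported measures are determined by their moments
(`isFreeConvolution_iff_eq`).

Under mere weak convergence of the spectral measures of `Y`, the moments of `Y` need not converge,
and `Y` is replaced by its truncation to `[-(R + 1), R + 1]` under the functional calculus, whose
moments do converge (`tendsto_normTrace_clamp_pow`). Two Hermitian matrices that coincide on a
subspace of codimension `r` have distribution functions of eigenvalues which differ by at most `r`
(`card_eigenvalues_le`); hence the truncation changes the distribution function of the mean
spectral measure of `X + Y` by at most the proportion of the eigenvalues of `Y` which are moved,
and this tends to zero (`tendsto_spectralMeasure_clamp_ne`). Weak convergence carries over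
(`tendsto_integral_of_abs_real_Iic_sub_le`). -/

open FreeProb

namespace FreeProb

open scoped TensorProduct

section Gaussian

/-! ### Gaussian integration by parts -/

lemma integrable_pow_gaussianReal (v : ℝ≥0) (n : ℕ) :
    Integrable (fun x : ℝ => x ^ n) (gaussianReal 0 v) := by
  have h := (memLp_id_gaussianReal (μ := 0) (v := v) (n : ℝ≥0)).integrable_norm_pow'
  refine Integrable.mono' h (by fun_prop) (ae_of_all _ fun x => ?_)
  simp

/-- Gaussian integration by parts for powers. For `n = 0` the power `n - 1` is truncated, but it is
multiplied by zero. -/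
lemma integral_gaussianReal_pow_succ {v : ℝ≥0} (hv : v ≠ 0) (n : ℕ) :
    ∫ x, x ^ (n + 1) ∂(gaussianReal 0 v) = v * (n * ∫ x, x ^ (n - 1) ∂(gaussianReal 0 v)) := by
  have hi : ∀ n : ℕ, Integrable (fun x => gaussianPDFReal 0 v x * x ^ n) := by
    intro n
    have h := integrable_pow_gaussianReal v n
    rw [gaussianReal_of_var_ne_zero _ hv,
      integrable_withDensity_iff_integrable_smul' (measurable_gaussianPDF 0 v)
        (ae_of_all _ fun _ => gaussianPDF_lt_top)] at h
    simpa [toReal_gaussianPDF] using h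
  have hd : ∀ x, HasDerivAt (fun x => gaussianPDFReal 0 v x)
      (-(x / v) * gaussianPDFReal 0 v x) x := by
    intro x
    unfold gaussianPDFReal
    have : HasDerivAt (fun x : ℝ => -(x - 0) ^ 2 / (2 * (v : ℝ))) (-(x / v)) x := by
      have h1 := (((hasDerivAt_id x).sub_const 0).pow 2).neg.div_const (2 * (v : ℝ))
      refine h1.congr_deriv ?_
      have : (v : ℝ) ≠ 0 := by exact_mod_cast hv
      simp
      field_simp
    have h2 := (this.exp).const_mul ((√(2 * Real.pi * v))⁻¹)
    refine h2.congr_deriv ?_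
    ring
  have hp := integral_mul_deriv_eq_deriv_mul_of_integrable
    (u := fun x : ℝ => x ^ n) (u' := fun x => n * x ^ (n - 1)) (v := fun x => gaussianPDFReal 0 v x)
    (v' := fun x => -(x / v) * gaussianPDFReal 0 v x)
    (fun x _ => hasDerivAt_pow n x) (fun x _ => hd x)
    (by
      refine ((hi (n + 1)).const_mul (-(v : ℝ)⁻¹)).congr (ae_of_all _ fun x => ?_)
      simp only [Pi.mul_apply]; ring)
    (by
      refine ((hi (n - 1)).const_mul (n : ℝ)).congr (ae_of_all _ fun x => ?_)
      simp only [Pi.mul_apply]; ring)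
    (by
      refine (hi n).congr (ae_of_all _ fun x => ?_)
      simp only [Pi.mul_apply]; ring)
  rw [integral_gaussianReal_eq_integral_smul hv, integral_gaussianReal_eq_integral_smul hv]
  have hv' : (v : ℝ) ≠ 0 := by exact_mod_cast hv
  have e1 : ∫ x, gaussianPDFReal 0 v x • x ^ (n + 1)
      = - v * ∫ x : ℝ, x ^ n * (-(x / v) * gaussianPDFReal 0 v x) := by
    rw [← integral_const_mul]
    congr 1; ext x; simp only [smul_eq_mul]; field_simp; ring
  rw [e1, hp, ← integral_const_mul, neg_mul_neg]
  congr 1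
  congr 1; ext x; simp only [smul_eq_mul]; ring

/-- The moments of the real Gaussian of variance `v`, as complex numbers. -/
noncomputable def gaussianMoment (v : ℝ≥0) (n : ℕ) : ℂ :=
  ((∫ x, x ^ n ∂(gaussianReal 0 v) : ℝ) : ℂ)

lemma gaussianMoment_succ {v : ℝ≥0} (hv : v ≠ 0) (n : ℕ) :
    gaussianMoment v (n + 1) = v * (n * gaussianMoment v (n - 1)) := by
  unfold gaussianMoment
  rw [integral_gaussianReal_pow_succ hv]
  push_cast
  rfl

instance (v : ℝ≥0) : IsProbabilityMeasure (complexGaussian v) :=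
  Measure.isProbabilityMeasure_map (by fun_prop)

instance (N : ℕ) : IsProbabilityMeasure (ginibreLaw N) := by
  unfold ginibreLaw; infer_instance

lemma integrable_complexGaussian_monomial (v : ℝ≥0) (a b : ℕ) :
    Integrable (fun z : ℂ => (z.re : ℂ) ^ a * (z.im : ℂ) ^ b) (complexGaussian v) := by
  unfold complexGaussian
  rw [integrable_map_measure (by fun_prop) (by fun_prop)]
  have := ((integrable_pow_gaussianReal v a).ofReal (𝕜 := ℂ)).mul_prod
    ((integrable_pow_gaussianReal v b).ofReal (𝕜 := ℂ))
  refine this.congr (ae_of_all _ fun p => ?_)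
  simp

lemma integral_complexGaussian_monomial (v : ℝ≥0) (a b : ℕ) :
    ∫ z : ℂ, (z.re : ℂ) ^ a * (z.im : ℂ) ^ b ∂(complexGaussian v) =
      gaussianMoment v a * gaussianMoment v b := by
  unfold complexGaussian
  rw [integral_map (by fun_prop) (by fun_prop)]
  have := integral_prod_mul (μ := gaussianReal 0 v) (ν := gaussianReal 0 v)
    (fun x : ℝ => (x : ℂ) ^ a) (fun x : ℝ => (x : ℂ) ^ b)
  simp only [← Complex.ofReal_pow, integral_complex_ofReal] at this
  unfold gaussianMoment
  rw [← this]
  simp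

/-- The real part (index `false`) and the imaginary part (index `true`) of the entries of a complex
matrix, as the values of the indeterminates of a polynomial ring. -/
def entryParts {N : ℕ} (Z : Fin N → Fin N → ℂ) (a : Fin N × Fin N × Bool) : ℂ :=
  if a.2.2 then ((Z a.1 a.2.1).im : ℂ) else ((Z a.1 a.2.1).re : ℂ)

lemma eval_entryParts_monomial {N : ℕ} (Z : Fin N → Fin N → ℂ) (s : Fin N × Fin N × Bool →₀ ℕ)
    (c : ℂ) : MvPolynomial.eval (entryParts Z) (MvPolynomial.monomial s c) =
      c * ∏ i, ∏ j, ((Z i j).re : ℂ) ^ s (i, j, false) * ((Z i j).im : ℂ) ^ s (i, j, true) := by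
  rw [MvPolynomial.eval_monomial, Finsupp.prod_fintype _ _ (by simp), Fintype.prod_prod_type]
  simp [Fintype.prod_prod_type, entryParts, mul_comm]

lemma integrable_ginibre_eval {N : ℕ} (p : MvPolynomial (Fin N × Fin N × Bool) ℂ) :
    Integrable (fun Z => MvPolynomial.eval (entryParts Z) p) (ginibreLaw N) := by
  induction p using MvPolynomial.induction_on' with
  | monomial s c =>
    simp only [eval_entryParts_monomial]
    refine Integrable.const_mul ?_ c
    unfold ginibreLaw
    refine Integrable.fintype_prod_dep (f := fun i (x : Fin N → ℂ) => ∏ j,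
      ((x j).re : ℂ) ^ s (i, j, false) * ((x j).im : ℂ) ^ s (i, j, true)) fun i => ?_
    exact Integrable.fintype_prod_dep (f := fun j (x : ℂ) =>
      ((x.re : ℂ) ^ s (i, j, false) * (x.im : ℂ) ^ s (i, j, true)))
      fun j => integrable_complexGaussian_monomial _ _ _
  | add p q hp hq =>
    simp only [map_add]
    exact hp.add hq

lemma integral_ginibre_monomial {N : ℕ} (s : Fin N × Fin N × Bool →₀ ℕ) (c : ℂ) :
    ∫ Z, MvPolynomial.eval (entryParts Z) (MvPolynomial.monomial s c) ∂(ginibreLaw N) =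
      c * ∏ a, gaussianMoment (N : ℝ≥0)⁻¹ (s a) := by
  simp only [eval_entryParts_monomial]
  rw [integral_const_mul]
  unfold ginibreLaw
  rw [integral_fintype_prod_eq_prod (fun i (x : Fin N → ℂ) => ∏ j,
      ((x j).re : ℂ) ^ s (i, j, false) * ((x j).im : ℂ) ^ s (i, j, true))]
  have : ∀ i, ∫ x : Fin N → ℂ, ∏ j, ((x j).re : ℂ) ^ s (i, j, false) *
      ((x j).im : ℂ) ^ s (i, j, true) ∂(Measure.pi fun _ => complexGaussian (N : ℝ≥0)⁻¹) =
      ∏ j, gaussianMoment (N : ℝ≥0)⁻¹ (s (i, j, false)) *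
        gaussianMoment (N : ℝ≥0)⁻¹ (s (i, j, true)) := by
    intro i
    rw [integral_fintype_prod_eq_prod (fun j (x : ℂ) =>
      ((x.re : ℂ) ^ s (i, j, false) * (x.im : ℂ) ^ s (i, j, true)))]
    simp only [integral_complexGaussian_monomial]
  simp only [this]
  rw [Fintype.prod_prod_type]
  simp [Fintype.prod_prod_type, mul_comm]

/-- The expectation of a polynomial in the real and imaginary parts of the entries of a Ginibre
matrix. -/
noncomputable def ginibreExp (N : ℕ) : MvPolynomial (Fin N × Fin N × Bool) ℂ →ₗ[ℂ] ℂ where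
  toFun p := ∫ Z, MvPolynomial.eval (entryParts Z) p ∂(ginibreLaw N)
  map_add' p q := by
    simp only [map_add]
    exact integral_add (integrable_ginibre_eval p) (integrable_ginibre_eval q)
  map_smul' c p := by
    simp only [MvPolynomial.smul_eval, RingHom.id_apply, smul_eq_mul]
    exact integral_const_mul _ _

/-- Integration by parts with respect to one real coordinate of a Ginibre matrix. -/
lemma integral_ginibre_X_mul {N : ℕ} (hN : N ≠ 0) (a : Fin N × Fin N × Bool)
    (p : MvPolynomial (Fin N × Fin N × Bool) ℂ) :
    ∫ Z, MvPolynomial.eval (entryParts Z) (MvPolynomial.X a * p) ∂(ginibreLaw N) =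
      (N : ℂ)⁻¹ *
        ∫ Z, MvPolynomial.eval (entryParts Z) (MvPolynomial.pderiv a p) ∂(ginibreLaw N) := by
  induction p using MvPolynomial.induction_on' with
  | monomial s c =>
    rw [MvPolynomial.X, MvPolynomial.monomial_mul, MvPolynomial.pderiv_monomial,
      integral_ginibre_monomial, integral_ginibre_monomial,
      ← Finset.mul_prod_erase _ _ (Finset.mem_univ a),
      ← Finset.mul_prod_erase _ _ (Finset.mem_univ a)]
    have e1 : ∏ b ∈ Finset.univ.erase a,
          gaussianMoment (N : ℝ≥0)⁻¹ ((Finsupp.single a 1 + s : _ →₀ ℕ) b) =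
        ∏ b ∈ Finset.univ.erase a, gaussianMoment (N : ℝ≥0)⁻¹ (s b) :=
      Finset.prod_congr rfl fun b hb => by
        rw [Finsupp.add_apply, Finsupp.single_eq_of_ne (Finset.ne_of_mem_erase hb), zero_add]
    have e2 : ∏ b ∈ Finset.univ.erase a,
          gaussianMoment (N : ℝ≥0)⁻¹ ((s - Finsupp.single a 1 : _ →₀ ℕ) b) =
        ∏ b ∈ Finset.univ.erase a, gaussianMoment (N : ℝ≥0)⁻¹ (s b) :=
      Finset.prod_congr rfl fun b hb => by
        rw [Finsupp.tsub_apply, Finsupp.single_eq_of_ne (Finset.ne_of_mem_erase hb), Nat.sub_zero]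
    have hv : ((N : ℝ≥0)⁻¹) ≠ 0 := by simpa using hN
    rw [e1, e2]
    simp only [Finsupp.add_apply, Finsupp.single_eq_same, Finsupp.tsub_apply]
    rw [add_comm 1, gaussianMoment_succ hv]
    push_cast
    ring
  | add p q hp hq =>
    rw [mul_add]
    simp only [map_add]
    rw [integral_add (integrable_ginibre_eval _) (integrable_ginibre_eval _),
      integral_add (integrable_ginibre_eval _) (integrable_ginibre_eval _), hp, hq]
    ring

/-! ### Integration by parts for the GUE -/

/-- The `(i, j)` entry of `(Z + Z*) / 2` as a linear form in the real and imaginary parts of the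
entries of `Z`. -/
noncomputable def gueForm {N : ℕ} (e : Fin N × Fin N) : MvPolynomial (Fin N × Fin N × Bool) ℂ :=
  MvPolynomial.C (1 / 2) * (MvPolynomial.X (e.1, e.2, false) +
    MvPolynomial.C Complex.I * MvPolynomial.X (e.1, e.2, true) +
    MvPolynomial.X (e.2, e.1, false) - MvPolynomial.C Complex.I * MvPolynomial.X (e.2, e.1, true))

lemma eval_gueForm {N : ℕ} (Z : Fin N → Fin N → ℂ) (e : Fin N × Fin N) :
    MvPolynomial.eval (entryParts Z) (gueForm e) = (Z e.1 e.2 + conj (Z e.2 e.1)) / 2 := by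
  apply Complex.ext <;> simp [gueForm, entryParts] <;> ring

/-- The directional derivative along the gradient of `gueForm e`, with complex coefficients. -/
noncomputable def gueDeriv {N : ℕ} (e : Fin N × Fin N)
    (p : MvPolynomial (Fin N × Fin N × Bool) ℂ) :
    MvPolynomial (Fin N × Fin N × Bool) ℂ :=
  MvPolynomial.C (1 / 2) * (MvPolynomial.pderiv (e.1, e.2, false) p +
    MvPolynomial.C Complex.I * MvPolynomial.pderiv (e.1, e.2, true) p +
    MvPolynomial.pderiv (e.2, e.1, false) p -
    MvPolynomial.C Complex.I * MvPolynomial.pderiv (e.2, e.1, true) p)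

/-- The gradients of the entries `(i, j)` and `(k, l)` pair to one if `(k, l) = (j, i)`, and to zero
otherwise: this is the covariance `E[X(ij) X(kl)] = δ_il δ_jk / N`, up to the factor `1 / N`. -/
lemma gueDeriv_gueForm {N : ℕ} (e e' : Fin N × Fin N) :
    gueDeriv e (gueForm e') = if e' = (e.2, e.1) then 1 else 0 := by
  have hI : (MvPolynomial.C Complex.I * MvPolynomial.C Complex.I :
      MvPolynomial (Fin N × Fin N × Bool) ℂ) = -1 := by
    rw [← MvPolynomial.C_mul, Complex.I_mul_I]; simp
  have hh : (MvPolynomial.C (1 / 2) * 2 : MvPolynomial (Fin N × Fin N × Bool) ℂ) = 1 := by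
    rw [show (2 : MvPolynomial (Fin N × Fin N × Bool) ℂ) = MvPolynomial.C 2 from
      (map_ofNat _ 2).symm,
      ← MvPolynomial.C_mul]; simp
  obtain ⟨i, j⟩ := e
  obtain ⟨k, l⟩ := e'
  unfold gueDeriv gueForm
  simp only [MvPolynomial.pderiv_C_mul, map_sub, map_add,
    MvPolynomial.pderiv_X, Pi.single_apply, Prod.mk.injEq, and_true, and_false, if_false,
    Bool.false_eq_true, Bool.true_eq_false, true_and, false_and, add_zero, zero_add, mul_zero,
    and_comm (a := l = i), and_comm (a := l = j), sub_zero]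
  generalize MvPolynomial.C (σ := Fin N × Fin N × Bool) Complex.I = c at *
  generalize MvPolynomial.C (σ := Fin N × Fin N × Bool) (1 / 2 : ℂ) = h at *
  generalize (if k = i ∧ l = j then (1 : MvPolynomial (Fin N × Fin N × Bool) ℂ) else 0) = x
  generalize (if k = j ∧ l = i then (1 : MvPolynomial (Fin N × Fin N × Bool) ℂ) else 0) = y
  linear_combination 2 * h ^ 2 * (x - y) * hI + (2 * h + 1) * y * hh

/-- The chain rule: on polynomials in the entries of `X`, the derivative along the gradient of the
entry `(i, j)` is the partial derivative with respect to the entry `(j, i)`. -/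
lemma gueDeriv_aeval {N : ℕ} (e : Fin N × Fin N) (p : MvPolynomial (Fin N × Fin N) ℂ) :
    gueDeriv e (MvPolynomial.aeval gueForm p) =
      MvPolynomial.aeval gueForm (MvPolynomial.pderiv (e.2, e.1) p) := by
  induction p using MvPolynomial.induction_on with
  | C c =>
    simp only [gueDeriv, MvPolynomial.algHom_C, MvPolynomial.algebraMap_eq, MvPolynomial.pderiv_C,
      map_zero, mul_zero, add_zero, sub_zero]
  | add p q hp hq =>
    rw [map_add, map_add, map_add, ← hp, ← hq]
    simp only [gueDeriv, map_add]
    ring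
  | mul_X p f hp =>
    have hf : gueDeriv e (gueForm f) =
        MvPolynomial.aeval gueForm (MvPolynomial.pderiv (e.2, e.1)
          (MvPolynomial.X f : MvPolynomial (Fin N × Fin N) ℂ)) := by
      rw [gueDeriv_gueForm, MvPolynomial.pderiv_X]
      by_cases h : f = (e.2, e.1)
      · simp [h]
      · simp [h]
    have hl : ∀ p q : MvPolynomial (Fin N × Fin N × Bool) ℂ,
        gueDeriv e (p * q) = p * gueDeriv e q + q * gueDeriv e p := by
      intro p q
      simp only [gueDeriv, Derivation.leibniz, smul_eq_mul]
      ring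
    rw [map_mul, MvPolynomial.aeval_X, hl, hp, hf, Derivation.leibniz]
    simp

variable {N : ℕ} {Ω : Type*} [MeasurableSpace Ω] {P : Measure Ω}
  {X : Ω → Matrix (Fin N) (Fin N) ℂ}

/-- Evaluation of a polynomial in the entries of a matrix. -/
noncomputable def evalEntries (M : Matrix (Fin N) (Fin N) ℂ) :
    MvPolynomial (Fin N × Fin N) ℂ →+* ℂ :=
  MvPolynomial.eval fun e => M e.1 e.2

lemma continuous_evalEntries (p : MvPolynomial (Fin N × Fin N) ℂ) :
    Continuous fun M : Fin N → Fin N → ℂ => evalEntries M p := by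
  unfold evalEntries
  exact (MvPolynomial.continuous_eval p).comp (by fun_prop)

lemma evalEntries_gue (Z : Fin N → Fin N → ℂ) (p : MvPolynomial (Fin N × Fin N) ℂ) :
    evalEntries (fun i j => (Z i j + conj (Z j i)) / 2) p =
      MvPolynomial.eval (entryParts Z) (MvPolynomial.aeval gueForm p) := by
  unfold evalEntries
  rw [← MvPolynomial.coe_aeval_eq_eval, ← MvPolynomial.coe_aeval_eq_eval]
  have : MvPolynomial.aeval (fun e : Fin N × Fin N => (Z e.1 e.2 + conj (Z e.2 e.1)) / 2) =
      (MvPolynomial.aeval (entryParts Z)).comp (MvPolynomial.aeval gueForm) := by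
    ext e
    simp only [MvPolynomial.aeval_X, AlgHom.comp_apply]
    exact (eval_gueForm Z e).symm
  exact DFunLike.congr_fun this p

lemma IsGUE.integrable_evalEntries (hX : IsGUE P X) (p : MvPolynomial (Fin N × Fin N) ℂ) :
    Integrable (fun ω => evalEntries (X ω) p) P := by
  have h := hX.hasLaw
  have hc := (continuous_evalEntries p).aestronglyMeasurable (μ := P.map fun ω i j => X ω i j)
  refine (integrable_map_measure hc h.aemeasurable).1 ?_
  have hc' := (continuous_evalEntries p).aestronglyMeasurable (μ := gueLaw N)
  rw [h.map_eq]
  unfold gueLaw at hc' ⊢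
  rw [integrable_map_measure hc' (by fun_prop)]
  simpa only [Function.comp_def, evalEntries_gue] using integrable_ginibre_eval _

lemma IsGUE.integral_evalEntries (hX : IsGUE P X) (p : MvPolynomial (Fin N × Fin N) ℂ) :
    ∫ ω, evalEntries (X ω) p ∂P =
      ∫ Z, MvPolynomial.eval (entryParts Z) (MvPolynomial.aeval gueForm p) ∂(ginibreLaw N) := by
  have h := hX.hasLaw
  have hc := (continuous_evalEntries p).aestronglyMeasurable (μ := P.map fun ω i j => X ω i j)
  have e := integral_map h.aemeasurable hc
  rw [← e, h.map_eq]
  unfold gueLaw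
  rw [integral_map (by fun_prop) (continuous_evalEntries p).aestronglyMeasurable]
  simp only [evalEntries_gue]

/-- Integration by parts for the GUE: under the expectation, multiplication by the entry
`X(ij)` is `1 / N` times the derivative with respect to the entry `X(ji)`. -/
lemma IsGUE.integral_X_mul (hN : N ≠ 0) (hX : IsGUE P X) (i j : Fin N)
    (p : MvPolynomial (Fin N × Fin N) ℂ) :
    ∫ ω, evalEntries (X ω) (MvPolynomial.X (i, j) * p) ∂P =
      (N : ℂ)⁻¹ * ∫ ω, evalEntries (X ω) (MvPolynomial.pderiv (j, i) p) ∂P := by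
  rw [hX.integral_evalEntries, hX.integral_evalEntries, map_mul, MvPolynomial.aeval_X]
  have hd := gueDeriv_aeval (i, j) p
  simp only at hd
  rw [← hd]
  set q := MvPolynomial.aeval gueForm p
  have key : ∀ a p, ginibreExp N (MvPolynomial.X a * p) =
      (N : ℂ)⁻¹ * ginibreExp N (MvPolynomial.pderiv a p) := integral_ginibre_X_mul hN
  have e1 : gueForm (i, j) * q = (1 / 2 : ℂ) • (MvPolynomial.X (i, j, false) * q +
      Complex.I • (MvPolynomial.X (i, j, true) * q) + MvPolynomial.X (j, i, false) * q -
      Complex.I • (MvPolynomial.X (j, i, true) * q)) := by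
    simp only [gueForm, MvPolynomial.smul_eq_C_mul]
    ring
  have e2 : gueDeriv (i, j) q = (1 / 2 : ℂ) • (MvPolynomial.pderiv (i, j, false) q +
      Complex.I • MvPolynomial.pderiv (i, j, true) q + MvPolynomial.pderiv (j, i, false) q -
      Complex.I • MvPolynomial.pderiv (j, i, true) q) := by
    simp only [gueDeriv, MvPolynomial.smul_eq_C_mul]
  change ginibreExp N (gueForm (i, j) * q) = (N : ℂ)⁻¹ * ginibreExp N (gueDeriv (i, j) q)
  rw [e1, e2]
  simp only [map_smul, map_add, map_sub, key, smul_eq_mul]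
  ring

end Gaussian

/-! ### The Schwinger-Dyson equation for traces of words -/

lemma list_sum_map_finset_sum {α ι M : Type*} [AddCommMonoid M] (l : List α) (s : Finset ι)
    (f : ι → α → M) : (l.map fun x => ∑ i ∈ s, f i x).sum = ∑ i ∈ s, (l.map (f i)).sum := by
  induction l with
  | nil => simp
  | cons a l ih => simp [ih, Finset.sum_add_distrib]

/-- All the ways of writing a word in the letters `false` (for `X`) and `true` (for `Y`) as
`u ++ false :: v`. -/
def splits : List Bool → List (List Bool × List Bool)
  | [] => []
  | true :: w => (splits w).map fun p => (true :: p.1, p.2)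
  | false :: w => ([], w) :: (splits w).map fun p => (false :: p.1, p.2)

lemma eq_append_of_mem_splits {w : List Bool} {p : List Bool × List Bool} (hp : p ∈ splits w) :
    w = p.1 ++ false :: p.2 := by
  induction w generalizing p with
  | nil => simp [splits] at hp
  | cons b w ih =>
    cases b
    · simp only [splits, List.mem_cons, List.mem_map] at hp
      rcases hp with rfl | ⟨r, hr, rfl⟩
      · rfl
      · simpa using ih hr
    · simp only [splits, List.mem_map] at hp
      obtain ⟨r, hr, rfl⟩ := hp
      simpa using ih hr

section Words

variable {N : ℕ} (Y : Matrix (Fin N) (Fin N) ℂ)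

/-- A word in the matrix of indeterminates (letter `false`) and the constant matrix `Y`
(letter `true`). Its entries are polynomials in the entries of `X`, to which integration by parts
applies. -/
noncomputable def genericWord (w : List Bool) :
    Matrix (Fin N) (Fin N) (MvPolynomial (Fin N × Fin N) ℂ) :=
  (w.map fun b => if b then Y.map MvPolynomial.C
    else Matrix.of fun i j => MvPolynomial.X (i, j)).prod

/-- The normalized trace of a word in the matrix of indeterminates and `Y`. -/
noncomputable def genericTrace (w : List Bool) : MvPolynomial (Fin N × Fin N) ℂ :=
  MvPolynomial.C (N : ℂ)⁻¹ * (genericWord Y w).trace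

lemma genericWord_append (u v : List Bool) :
    genericWord Y (u ++ v) = genericWord Y u * genericWord Y v := by
  simp [genericWord]

lemma genericWord_false_cons (w : List Bool) :
    genericWord Y (false :: w) =
      (Matrix.of fun i j => MvPolynomial.X (i, j)) * genericWord Y w := by
  simp [genericWord]

lemma genericWord_true_cons (w : List Bool) :
    genericWord Y (true :: w) = Y.map MvPolynomial.C * genericWord Y w := by
  simp [genericWord]

lemma genericTrace_append_comm (u v : List Bool) :
    genericTrace Y (u ++ v) = genericTrace Y (v ++ u) := by
  rw [genericTrace, genericTrace, genericWord_append, genericWord_append, Matrix.trace_mul_comm]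

lemma genericTrace_replicate_true (k : ℕ) :
    genericTrace Y (List.replicate k true) = MvPolynomial.C (normTrace (Y ^ k)) := by
  have h : (Y.map MvPolynomial.C : Matrix (Fin N) (Fin N) (MvPolynomial (Fin N × Fin N) ℂ)) ^ k =
      (Y ^ k).map MvPolynomial.C := by
    exact (map_pow (MvPolynomial.C (R := ℂ) (σ := Fin N × Fin N)).mapMatrix Y k).symm
  rw [genericTrace, genericWord, List.map_replicate, List.prod_replicate, if_pos rfl, h,
    normTrace, div_eq_inv_mul, map_mul]
  congr 1
  simp [Matrix.trace, map_sum]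

/-- The derivative of an entry of a word: one letter `X` is removed. -/
lemma pderiv_genericWord (w : List Bool) (i j k l : Fin N) :
    MvPolynomial.pderiv (j, i) (genericWord Y w k l) =
      ((splits w).map fun p => genericWord Y p.1 k j * genericWord Y p.2 i l).sum := by
  induction w generalizing k with
  | nil =>
    by_cases h : k = l <;> simp [genericWord, splits, h]
  | cons b w ih =>
    cases b
    · rw [genericWord_false_cons, Matrix.mul_apply, map_sum]
      simp only [Derivation.leibniz, ih, Matrix.of_apply, smul_eq_mul, MvPolynomial.pderiv_X,
        Finset.sum_add_distrib, splits, List.map_cons, List.map_map, List.sum_cons]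
      rw [add_comm]
      congr 1
      · simp only [Pi.single_apply, Prod.mk.injEq]
        rw [Finset.sum_eq_single i]
        · by_cases h : k = j <;> simp [h, genericWord]
        · intro m _ hm; simp [hm]
        · simp
      · simp only [Function.comp_def, genericWord_false_cons, Matrix.mul_apply, Matrix.of_apply,
          Finset.sum_mul, list_sum_map_finset_sum, ← List.sum_map_mul_left, mul_assoc]
    · rw [genericWord_true_cons, Matrix.mul_apply, map_sum]
      simp only [Derivation.leibniz, ih, Matrix.map_apply, smul_eq_mul, MvPolynomial.pderiv_C,
        mul_zero, add_zero, splits, List.map_map]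
      simp only [Function.comp_def, genericWord_true_cons, Matrix.mul_apply, Matrix.map_apply,
          Finset.sum_mul, list_sum_map_finset_sum, ← List.sum_map_mul_left, mul_assoc]

/-- The derivation along the matrix `genericWord Y w`. -/
noncomputable def wordDeriv (w : List Bool) (G : MvPolynomial (Fin N × Fin N) ℂ) :
    MvPolynomial (Fin N × Fin N) ℂ :=
  ∑ i, ∑ j, genericWord Y w j i * MvPolynomial.pderiv (j, i) G

lemma wordDeriv_mul (w : List Bool) (F G : MvPolynomial (Fin N × Fin N) ℂ) :
    wordDeriv Y w (F * G) = F * wordDeriv Y w G + G * wordDeriv Y w F := by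
  simp only [wordDeriv, Derivation.leibniz, Finset.mul_sum, ← Finset.sum_add_distrib, smul_eq_mul]
  refine Finset.sum_congr rfl fun i _ => Finset.sum_congr rfl fun j _ => ?_
  ring

lemma wordDeriv_one (w : List Bool) : wordDeriv Y w 1 = 0 := by
  simp [wordDeriv]

/-- The derivation along a word merges it with another trace, in the place of one of its letters
`X`. -/
lemma wordDeriv_genericTrace (w w' : List Bool) :
    wordDeriv Y w (genericTrace Y w') =
      ((splits w').map fun p => genericTrace Y (w ++ (p.2 ++ p.1))).sum := by
  simp only [wordDeriv, genericTrace, MvPolynomial.pderiv_C_mul, Matrix.trace, map_sum,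
    Matrix.diag_apply, pderiv_genericWord, genericWord_append, Matrix.mul_apply, Finset.mul_sum,
    list_sum_map_finset_sum, ← List.sum_map_mul_left]
  rw [Finset.sum_comm]
  refine Finset.sum_congr rfl fun j _ => Finset.sum_congr rfl fun i _ =>
    Finset.sum_congr rfl fun k _ => ?_
  congr 1
  refine List.map_congr_left fun p _ => ?_
  ring

/-- The number of letters `X` in a list of words. -/
def countX (W : List (List Bool)) : ℕ := (W.map (List.count false)).sum

end Words

section Expectation

variable {N : ℕ} {Ω : Type*} [MeasurableSpace Ω] {P : Measure Ω}
  {X : Ω → Matrix (Fin N) (Fin N) ℂ} (Y : Matrix (Fin N) (Fin N) ℂ)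

/-- The expectation of a polynomial in the entries of a GUE matrix. -/
noncomputable def IsGUE.exp (hX : IsGUE P X) : MvPolynomial (Fin N × Fin N) ℂ →ₗ[ℂ] ℂ where
  toFun p := ∫ ω, evalEntries (X ω) p ∂P
  map_add' p q := by
    simp only [map_add]
    exact integral_add (hX.integrable_evalEntries p) (hX.integrable_evalEntries q)
  map_smul' c p := by
    simp only [evalEntries, MvPolynomial.smul_eval, RingHom.id_apply, smul_eq_mul]
    exact integral_const_mul _ _

lemma IsGUE.exp_X_mul (hN : N ≠ 0) (hX : IsGUE P X) (i j : Fin N)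
    (p : MvPolynomial (Fin N × Fin N) ℂ) :
    hX.exp (MvPolynomial.X (i, j) * p) = (N : ℂ)⁻¹ * hX.exp (MvPolynomial.pderiv (j, i) p) :=
  hX.integral_X_mul hN i j p

lemma IsGUE.exp_C [IsProbabilityMeasure P] (hX : IsGUE P X) (c : ℂ) :
    hX.exp (MvPolynomial.C c) = c := by
  simp [IsGUE.exp, evalEntries]

lemma IsGUE.exp_C_mul (hX : IsGUE P X) (c : ℂ) (p : MvPolynomial (Fin N × Fin N) ℂ) :
    hX.exp (MvPolynomial.C c * p) = c * hX.exp p := by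
  rw [← MvPolynomial.smul_eq_C_mul, map_smul, smul_eq_mul]

/-- The Schwinger-Dyson equation at finite `N`. A letter `X` at the start of a trace is removed: the
trace is split at another of its letters `X`, or it is merged with the traces in `G`. -/
lemma IsGUE.exp_genericTrace_mul (hN : N ≠ 0) (hX : IsGUE P X) (w : List Bool)
    (G : MvPolynomial (Fin N × Fin N) ℂ) :
    hX.exp (genericTrace Y (false :: w) * G) =
      ((splits w).map fun p => hX.exp (genericTrace Y p.1 * genericTrace Y p.2 * G)).sum +
        ((N : ℂ)⁻¹) ^ 2 * hX.exp (wordDeriv Y w G) := by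
  have e1 : genericTrace Y (false :: w) * G = MvPolynomial.C (N : ℂ)⁻¹ *
      ∑ i, ∑ j, MvPolynomial.X (i, j) * (genericWord Y w j i * G) := by
    simp only [genericTrace, genericWord_false_cons, Matrix.trace, Matrix.diag_apply,
      Matrix.mul_apply, Matrix.of_apply, Finset.sum_mul, mul_assoc]
  rw [e1, IsGUE.exp_C_mul]
  simp only [map_sum, hX.exp_X_mul hN, Derivation.leibniz, smul_eq_mul, map_add]
  simp only [← Finset.mul_sum, Finset.sum_add_distrib, mul_add]
  have e2 : ∑ i, ∑ j, hX.exp (genericWord Y w j i * MvPolynomial.pderiv (j, i) G) =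
      hX.exp (wordDeriv Y w G) := by
    simp only [wordDeriv, map_sum]
  have e3 : ∑ i, ∑ j, hX.exp (G * MvPolynomial.pderiv (j, i) (genericWord Y w j i)) =
      ((splits w).map fun p =>
        hX.exp (G * ((genericWord Y p.1).trace * (genericWord Y p.2).trace))).sum := by
    simp only [pderiv_genericWord, ← List.sum_map_mul_left, map_list_sum, List.map_map,
      Function.comp_def]
    simp only [← list_sum_map_finset_sum, ← map_sum, ← Finset.mul_sum, ← Finset.sum_mul]
    refine congrArg List.sum (List.map_congr_left fun p _ => ?_)
    simp only [Matrix.trace, Matrix.diag_apply]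
  rw [e2, e3, ← mul_assoc, add_comm, ← mul_assoc, ← sq, ← List.sum_map_mul_left]
  refine congrArg (· + _) (congrArg List.sum (List.map_congr_left fun p _ => ?_))
  rw [sq, mul_assoc, ← IsGUE.exp_C_mul, ← IsGUE.exp_C_mul]
  congr 1
  simp only [genericTrace]
  ring

end Expectation

section Limit

variable {Ω : ℕ → Type*} [∀ N, MeasurableSpace (Ω N)]
  {P : ∀ N, Measure (Ω N)}
  {X : ∀ N, Ω N → Matrix (Fin N) (Fin N) ℂ} (hX : ∀ N, IsGUE (P N) (X N))
  (Y : ∀ N, Matrix (Fin N) (Fin N) ℂ)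

/-- The limit, as `N → ∞`, of the expected normalized trace of a word. The value of `limUnder` is
meaningful only for convergent sequences; convergence is part of `Factorizes` for a single word. -/
noncomputable def limitMoment (w : List Bool) : ℂ :=
  limUnder atTop fun N => (hX N).exp (genericTrace (Y N) w)

/-- The expectation of a product of normalized traces of words converges to the product of the
limits for the single words. -/
def Factorizes (W : List (List Bool)) : Prop :=
  Tendsto (fun N => (hX N).exp (W.map (genericTrace (Y N))).prod) atTop
    (𝓝 (W.map (limitMoment hX Y)).prod)

lemma tendsto_list_sum_map {α : Type*} (l : List α) {f : α → ℕ → ℂ} {a : α → ℂ}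
    (h : ∀ x ∈ l, Tendsto (f x) atTop (𝓝 (a x))) :
    Tendsto (fun N => (l.map fun x => f x N).sum) atTop (𝓝 (l.map a).sum) := by
  induction l with
  | nil => simp
  | cons x l ih =>
    simp only [List.map_cons, List.sum_cons]
    exact (h x (by simp)).add (ih fun y hy => h y (by simp [hy]))

/-- If factorization holds for fewer letters `X`, then the merging terms of the Schwinger-Dyson
equation converge. Only their boundedness matters, because of the factor `1 / N ^ 2`. The product
is differentiated factor by factor, and `W'` collects the factors that have been passed. -/
lemma exists_tendsto_exp_wordDeriv {n : ℕ}
    (H : ∀ W, countX W < n → Factorizes hX Y W) (w : List Bool) (W W' : List (List Bool))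
    (hW : countX (w :: W ++ W') ≤ n) :
    ∃ l, Tendsto (fun N => (hX N).exp (wordDeriv (Y N) w (W.map (genericTrace (Y N))).prod *
      (W'.map (genericTrace (Y N))).prod)) atTop (𝓝 l) := by
  induction W generalizing W' with
  | nil => exact ⟨0, by simp [wordDeriv_one]⟩
  | cons a W ih =>
    obtain ⟨l, hl⟩ := ih (a :: W') (by simpa [countX, add_assoc, add_left_comm] using hW)
    have h2 : ∀ p ∈ splits a, Factorizes hX Y ((w ++ (p.2 ++ p.1)) :: (W ++ W')) := by
      intro p hp
      apply H
      have := eq_append_of_mem_splits hp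
      rw [this] at hW
      simp [countX] at hW ⊢
      omega
    refine ⟨_, (hl.add (tendsto_list_sum_map _ h2)).congr fun N => ?_⟩
    simp only [List.map_cons, List.prod_cons, wordDeriv_mul, wordDeriv_genericTrace]
    rw [show ∀ a b c d e : MvPolynomial (Fin N × Fin N) ℂ, (a * b + c * d) * e =
      b * (a * e) + d * (c * e) by intros; ring, map_add, ← List.sum_map_mul_right, map_list_sum]
    congr 1
    simp [Function.comp_def]

/-- The limit of the Schwinger-Dyson equation, if factorization holds for fewer letters `X`. -/
lemma tendsto_exp_false_cons {n : ℕ} (H : ∀ W, countX W < n → Factorizes hX Y W) (w : List Bool)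
    (W : List (List Bool)) (hW : countX (w :: W) < n) :
    Tendsto (fun N => (hX N).exp (((false :: w) :: W).map (genericTrace (Y N))).prod) atTop
      (𝓝 (((splits w).map fun p => limitMoment hX Y p.1 * limitMoment hX Y p.2).sum *
        (W.map (limitMoment hX Y)).prod)) := by
  obtain ⟨l, hl⟩ := exists_tendsto_exp_wordDeriv hX Y H w W [] (by simpa using hW.le)
  have h1 : ∀ p ∈ splits w, Factorizes hX Y (p.1 :: p.2 :: W) := by
    intro p hp
    apply H
    have := eq_append_of_mem_splits hp
    rw [this] at hW
    simp [countX] at hW ⊢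
    omega
  have h2 : Tendsto (fun N : ℕ => ((N : ℂ)⁻¹) ^ 2) atTop (𝓝 0) := by
    have := (tendsto_inv_atTop_nhds_zero_nat (𝕜 := ℂ)).pow 2
    simpa using this
  have h3 := (tendsto_list_sum_map _ h1).add (h2.mul hl)
  rw [zero_mul, add_zero] at h3
  have h4 : ((splits w).map fun p => ((p.1 :: p.2 :: W).map (limitMoment hX Y)).prod).sum =
      ((splits w).map fun p => limitMoment hX Y p.1 * limitMoment hX Y p.2).sum *
        (W.map (limitMoment hX Y)).prod := by
    rw [← List.sum_map_mul_right]
    simp [mul_assoc]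
  rw [h4] at h3
  refine h3.congr' ?_
  filter_upwards [eventually_ne_atTop 0] with N hN
  rw [List.map_cons, List.prod_cons, (hX N).exp_genericTrace_mul (Y N) hN]
  simp [mul_assoc]

lemma limitMoment_append_comm (u v : List Bool) :
    limitMoment hX Y (u ++ v) = limitMoment hX Y (v ++ u) := by
  simp only [limitMoment, genericTrace_append_comm _ u v]

variable [∀ N, IsProbabilityMeasure (P N)]

lemma limitMoment_replicate_true {m : ℕ → ℂ}
    (hY : ∀ n, Tendsto (fun N => normTrace (Y N ^ n)) atTop (𝓝 (m n))) (k : ℕ) :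
    limitMoment hX Y (List.replicate k true) = m k := by
  refine Tendsto.limUnder_eq ((hY k).congr fun N => ?_)
  rw [genericTrace_replicate_true, IsGUE.exp_C]

/-- The expectation of products of traces of words factorizes in the limit.  The induction is on
the number of letters `X`; the terms that merge two traces carry the factor `1 / N ^ 2`. -/
lemma factorizes {m : ℕ → ℂ} (hY : ∀ n, Tendsto (fun N => normTrace (Y N ^ n)) atTop (𝓝 (m n)))
    (W : List (List Bool)) : Factorizes hX Y W := by
  induction h : countX W using Nat.strong_induction_on generalizing W with
  | _ n ih =>
    subst h
    have H : ∀ W', countX W' < countX W → Factorizes hX Y W' := fun W' h => ih _ h _ rfl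
    by_cases h0 : ∃ a ∈ W, false ∈ a
    · obtain ⟨a, ha, hf⟩ := h0
      obtain ⟨s, t, rfl⟩ := List.append_of_mem hf
      have hp := List.perm_cons_erase ha
      set W' := W.erase (s ++ false :: t)
      have hc : countX ((t ++ s) :: W') < countX W := by
        have : countX W = countX ((s ++ false :: t) :: W') := (hp.map _).sum_eq
        rw [this]
        simp [countX]
        omega
      have h1 := tendsto_exp_false_cons hX Y H (t ++ s) W' hc
      have hc' : countX [t ++ s] < countX W := by
        refine lt_of_le_of_lt ?_ hc
        simp [countX]
      have h2 := tendsto_exp_false_cons hX Y H (t ++ s) [] hc'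
      have h3 : limitMoment hX Y (s ++ false :: t) =
          ((splits (t ++ s)).map fun p => limitMoment hX Y p.1 * limitMoment hX Y p.2).sum := by
        rw [limitMoment_append_comm]
        refine Tendsto.limUnder_eq ?_
        simpa using h2
      unfold Factorizes
      rw [(hp.map _).prod_eq, List.map_cons, List.prod_cons, h3]
      refine h1.congr fun N => ?_
      rw [(hp.map _).prod_eq, List.map_cons, List.map_cons, List.prod_cons, List.prod_cons,
        genericTrace_append_comm _ s]
      rfl
    · push Not at h0
      have h1 : ∀ a ∈ W, a = List.replicate a.length true := fun a ha => by
        refine List.eq_replicate_of_mem fun b hb => ?_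
        cases b
        · exact absurd hb (h0 a ha)
        · rfl
      clear ih H
      have key : Tendsto (fun N => (W.map fun a => normTrace (Y N ^ a.length)).prod) atTop
          (𝓝 (W.map (limitMoment hX Y)).prod) := by
        refine tendsto_list_prod W fun a ha => ?_
        rw [h1 a ha, limitMoment_replicate_true hX Y hY, List.length_replicate]
        exact hY _
      refine key.congr fun N => ?_
      rw [← (hX N).exp_C (W.map fun a => normTrace (Y N ^ a.length)).prod, map_list_prod,
        List.map_map]
      congr 2
      refine List.map_congr_left fun a ha => ?_
      conv_rhs => rw [h1 a ha, genericTrace_replicate_true]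
      rfl

lemma tendsto_exp_genericTrace {m : ℕ → ℂ}
    (hY : ∀ n, Tendsto (fun N => normTrace (Y N ^ n)) atTop (𝓝 (m n))) (w : List Bool) :
    Tendsto (fun N => (hX N).exp (genericTrace (Y N) w)) atTop (𝓝 (limitMoment hX Y w)) := by
  simpa [Factorizes] using factorizes hX Y hY [w]

/-- The Schwinger-Dyson equation in the limit. -/
lemma limitMoment_false_cons {m : ℕ → ℂ}
    (hY : ∀ n, Tendsto (fun N => normTrace (Y N ^ n)) atTop (𝓝 (m n))) (w : List Bool) :
    limitMoment hX Y (false :: w) =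
      ((splits w).map fun p => limitMoment hX Y p.1 * limitMoment hX Y p.2).sum := by
  refine Tendsto.limUnder_eq ?_
  simpa using tendsto_exp_false_cons hX Y (n := countX [w] + 1)
    (fun W _ => factorizes hX Y hY W) w [] (Nat.lt_succ_self _)

end Limit

/-! ### The limit functional on non-commutative polynomials -/

/-- The monomial of a word in the free algebra on `X` (letter `false`) and `Y` (letter `true`). -/
noncomputable def monom (w : List Bool) : FreeAlgebra ℂ Bool := (w.map (FreeAlgebra.ι ℂ)).prod

lemma monom_append (u v : List Bool) : monom (u ++ v) = monom u * monom v := by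
  simp [monom]

lemma monom_cons (b : Bool) (v : List Bool) : monom (b :: v) = FreeAlgebra.ι ℂ b * monom v := by
  simp [monom]

lemma monom_nil : monom [] = 1 := by simp [monom]

lemma monom_replicate (b : Bool) (k : ℕ) : monom (List.replicate k b) = FreeAlgebra.ι ℂ b ^ k := by
  simp [monom]

/-- The linear functional on the free algebra with given values on the monomials. -/
noncomputable def functionalOfMoments (φ : List Bool → ℂ) : FreeAlgebra ℂ Bool →ₗ[ℂ] ℂ :=
  (FreeAlgebra.basisFreeMonoid ℂ Bool).constr ℂ fun w => φ (FreeMonoid.toList w)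

lemma basisFreeMonoid_eq_monom (w : FreeMonoid Bool) :
    FreeAlgebra.basisFreeMonoid ℂ Bool w = monom (FreeMonoid.toList w) := by
  simp [FreeAlgebra.basisFreeMonoid, monom, FreeAlgebra.equivMonoidAlgebraFreeMonoid,
    FreeMonoid.lift_apply]

lemma functionalOfMoments_monom (φ : List Bool → ℂ) (w : List Bool) :
    functionalOfMoments φ (monom w) = φ w := by
  have := (FreeAlgebra.basisFreeMonoid ℂ Bool).constr_basis ℂ
    (fun w => φ (FreeMonoid.toList w)) (FreeMonoid.ofList w)
  rwa [basisFreeMonoid_eq_monom] at this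

/-- Linear statements about the free algebra need only be checked on monomials. -/
lemma free_induction {p : FreeAlgebra ℂ Bool → Prop} (hw : ∀ w, p (monom w))
    (hadd : ∀ f g, p f → p g → p (f + g)) (hsmul : ∀ (c : ℂ) f, p f → p (c • f))
    (f : FreeAlgebra ℂ Bool) : p f := by
  have h := (FreeAlgebra.basisFreeMonoid ℂ Bool).mem_span f
  induction h using Submodule.span_induction with
  | mem x hx => obtain ⟨w, rfl⟩ := hx; rw [basisFreeMonoid_eq_monom]; exact hw _
  | zero => simpa using hsmul 0 _ (hw [])
  | add x y _ _ hx hy => exact hadd _ _ hx hy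
  | smul c x _ hx => exact hsmul _ _ hx

lemma free_linearMap_ext {M : Type*} [AddCommMonoid M] [Module ℂ M]
    {φ ψ : FreeAlgebra ℂ Bool →ₗ[ℂ] M} (h : ∀ w, φ (monom w) = ψ (monom w)) : φ = ψ :=
  LinearMap.ext fun f => free_induction (p := fun f => φ f = ψ f) h
    (fun f g hf hg => by rw [map_add, map_add, hf, hg])
    (fun c f hf => by rw [map_smul, map_smul, hf]) f

/-- The pair `x, y` as a family indexed by the letters: `false` stands for `x`, `true` for `y`. -/
def pair {A : Type*} (x y : A) (b : Bool) : A := if b then y else x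

section Convergence

variable {N : ℕ} {Ω : Type*} {X : Ω → Matrix (Fin N) (Fin N) ℂ} (Y : Matrix (Fin N) (Fin N) ℂ)

/-- Evaluation of a non-commutative polynomial at the matrix of indeterminates and `Y`. -/
noncomputable def genericLift :
    FreeAlgebra ℂ Bool →ₐ[ℂ] Matrix (Fin N) (Fin N) (MvPolynomial (Fin N × Fin N) ℂ) :=
  FreeAlgebra.lift ℂ (pair (Matrix.of fun i j => MvPolynomial.X (i, j)) (Y.map MvPolynomial.C))

/-- Evaluation of a non-commutative polynomial at the random matrix `X` and the constant `Y`. -/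
noncomputable def randomLift (X : Ω → Matrix (Fin N) (Fin N) ℂ) :
    FreeAlgebra ℂ Bool →ₐ[ℂ] (Ω → Matrix (Fin N) (Fin N) ℂ) :=
  FreeAlgebra.lift ℂ (pair X (constMatrix Ω Y))

lemma normTrace_randomLift (ω : Ω) (f : FreeAlgebra ℂ Bool) :
    normTrace (randomLift Y X f ω) =
      evalEntries (X ω) (MvPolynomial.C (N : ℂ)⁻¹ * (genericLift Y f).trace) := by
  have h : (Pi.evalAlgHom ℂ (fun _ : Ω => Matrix (Fin N) (Fin N) ℂ) ω).comp (randomLift Y X) =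
      ((MvPolynomial.aeval fun e : Fin N × Fin N => X ω e.1 e.2).mapMatrix).comp
        (genericLift Y) := by
    ext b i j
    cases b <;> simp [randomLift, genericLift, pair, constMatrix]
  have h' : randomLift Y X f ω =
      (MvPolynomial.aeval fun e : Fin N × Fin N => X ω e.1 e.2).mapMatrix (genericLift Y f) :=
    DFunLike.congr_fun h f
  rw [h', normTrace, map_mul, div_eq_inv_mul]
  congr 1
  · simp [evalEntries]
  · simp [Matrix.trace, evalEntries]

variable [MeasurableSpace Ω] {P : Measure Ω}

lemma IsGUE.integrable_normTrace (hX : IsGUE P X) (f : FreeAlgebra ℂ Bool) :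
    Integrable (fun ω => normTrace (randomLift Y X f ω)) P := by
  simp only [normTrace_randomLift]
  exact hX.integrable_evalEntries _

/-- The expected normalized trace of non-commutative polynomials in `X` and `Y` as a linear
functional. -/
noncomputable def IsGUE.traceFunctional (hX : IsGUE P X) : FreeAlgebra ℂ Bool →ₗ[ℂ] ℂ where
  toFun f := expNormTrace P (randomLift Y X f)
  map_add' f g := by
    simp only [expNormTrace, normTrace, map_add, Pi.add_apply, Matrix.trace_add, add_div]
    exact integral_add (hX.integrable_normTrace Y f) (hX.integrable_normTrace Y g)
  map_smul' c f := by
    simp only [expNormTrace, normTrace, map_smul, Pi.smul_apply, Matrix.trace_smul,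
      smul_eq_mul, RingHom.id_apply, mul_div_assoc]
    exact integral_const_mul _ _

lemma IsGUE.traceFunctional_apply (hX : IsGUE P X) (f : FreeAlgebra ℂ Bool) :
    hX.traceFunctional Y f = expNormTrace P (randomLift Y X f) := rfl

lemma IsGUE.traceFunctional_monom (hX : IsGUE P X) (w : List Bool) :
    hX.traceFunctional Y (monom w) = hX.exp (genericTrace Y w) := by
  have : genericLift Y (monom w) = genericWord Y w := by
    simp only [genericLift, monom, genericWord, map_list_prod, List.map_map]
    congr 1
    refine List.map_congr_left fun b _ => ?_
    simp [pair]
  rw [IsGUE.traceFunctional_apply, expNormTrace]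
  simp only [normTrace_randomLift, this]
  rfl

end Convergence

/-! ### The free difference quotient -/

/-- The representation of the free algebra by upper triangular matrices whose corner is the free
difference quotient. -/
noncomputable def diffRep :
    FreeAlgebra ℂ Bool →ₐ[ℂ] Matrix (Fin 2) (Fin 2) (FreeAlgebra ℂ Bool ⊗[ℂ] FreeAlgebra ℂ Bool) :=
  FreeAlgebra.lift ℂ fun b =>
    !![FreeAlgebra.ι ℂ b ⊗ₜ 1, if b then 0 else 1; 0, 1 ⊗ₜ FreeAlgebra.ι ℂ b]

/-- The free difference quotient with respect to `X`: the derivation into `F ⊗ F` with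
`∂X = 1 ⊗ 1` and `∂Y = 0`, where `f ∈ F` acts by `f ⊗ 1` from the left and by `1 ⊗ f` from the
right. -/
noncomputable def freeDiff :
    FreeAlgebra ℂ Bool →ₗ[ℂ] FreeAlgebra ℂ Bool ⊗[ℂ] FreeAlgebra ℂ Bool where
  toFun f := diffRep f 0 1
  map_add' f g := by simp
  map_smul' c f := by simp

lemma diffRep_diag (f : FreeAlgebra ℂ Bool) :
    diffRep f 0 0 = f ⊗ₜ 1 ∧ diffRep f 1 1 = 1 ⊗ₜ f ∧ diffRep f 1 0 = 0 := by
  induction f using FreeAlgebra.induction with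
  | grade0 r =>
    simp [Algebra.algebraMap_eq_smul_one, Algebra.TensorProduct.one_def, TensorProduct.smul_tmul]
  | grade1 b => simp [diffRep]
  | mul f g hf hg =>
    simp [Matrix.mul_apply, Fin.sum_univ_two, hf, hg]
  | add f g hf hg =>
    simp [hf, hg, TensorProduct.add_tmul, TensorProduct.tmul_add]

lemma freeDiff_mul (f g : FreeAlgebra ℂ Bool) :
    freeDiff (f * g) = (f ⊗ₜ 1) * freeDiff g + freeDiff f * (1 ⊗ₜ g) := by
  change diffRep (f * g) 0 1 = (f ⊗ₜ 1) * diffRep g 0 1 + diffRep f 0 1 * (1 ⊗ₜ g)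
  rw [map_mul, Matrix.mul_apply, Fin.sum_univ_two, (diffRep_diag f).1, (diffRep_diag g).2.1]

lemma freeDiff_one : freeDiff 1 = 0 := by
  change diffRep 1 0 1 = 0
  simp

lemma freeDiff_ι (b : Bool) : freeDiff (FreeAlgebra.ι ℂ b) = if b then 0 else 1 := by
  change diffRep _ 0 1 = _
  simp [diffRep]

lemma freeDiff_monom (w : List Bool) :
    freeDiff (monom w) = ((splits w).map fun p => monom p.1 ⊗ₜ[ℂ] monom p.2).sum := by
  induction w with
  | nil => simp [monom_nil, freeDiff_one, splits]
  | cons b w ih =>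
    rw [monom_cons, freeDiff_mul, freeDiff_ι, ih, ← List.sum_map_mul_left]
    cases b
    · simp [splits, Function.comp_def, monom_cons, monom_nil, add_comm]
    · simp [splits, Function.comp_def, monom_cons]

/-- The functional `φ ⊗ φ`. -/
noncomputable def tensorSq (φ : FreeAlgebra ℂ Bool →ₗ[ℂ] ℂ) :
    FreeAlgebra ℂ Bool ⊗[ℂ] FreeAlgebra ℂ Bool →ₗ[ℂ] ℂ :=
  LinearMap.mul' ℂ ℂ ∘ₗ TensorProduct.map φ φ

lemma tensorSq_tmul (φ : FreeAlgebra ℂ Bool →ₗ[ℂ] ℂ) (f g : FreeAlgebra ℂ Bool) :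
    tensorSq φ (f ⊗ₜ g) = φ f * φ g := by
  simp [tensorSq]

/-- A unital trace on the free algebra which satisfies the Schwinger-Dyson equation for `X`. -/
structure IsSchwingerDyson (φ : FreeAlgebra ℂ Bool →ₗ[ℂ] ℂ) : Prop where
  map_one : φ 1 = 1
  map_mul_comm : ∀ f g, φ (f * g) = φ (g * f)
  map_X_mul : ∀ f, φ (FreeAlgebra.ι ℂ false * f) = tensorSq φ (freeDiff f)

section Limit

variable {Ω : ℕ → Type*} [∀ N, MeasurableSpace (Ω N)]
  {P : ∀ N, Measure (Ω N)} [∀ N, IsProbabilityMeasure (P N)]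
  {X : ∀ N, Ω N → Matrix (Fin N) (Fin N) ℂ} (hX : ∀ N, IsGUE (P N) (X N))
  (Y : ∀ N, Matrix (Fin N) (Fin N) ℂ) {m : ℕ → ℂ}

/-- The limit of the expected normalized traces of non-commutative polynomials. -/
noncomputable def limitFunctional : FreeAlgebra ℂ Bool →ₗ[ℂ] ℂ :=
  functionalOfMoments (limitMoment hX Y)

lemma tendsto_limitFunctional
    (hY : ∀ n, Tendsto (fun N => normTrace (Y N ^ n)) atTop (𝓝 (m n))) (f : FreeAlgebra ℂ Bool) :
    Tendsto (fun N => expNormTrace (P N) (randomLift (Y N) (X N) f)) atTop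
      (𝓝 (limitFunctional hX Y f)) := by
  simp only [← IsGUE.traceFunctional_apply _ (hX _)]
  refine free_induction (p := fun f => Tendsto (fun N => (hX N).traceFunctional (Y N) f) atTop
      (𝓝 (limitFunctional hX Y f))) ?_ ?_ ?_ f
  · intro w
    simp only [IsGUE.traceFunctional_monom, limitFunctional, functionalOfMoments_monom]
    exact tendsto_exp_genericTrace hX Y hY w
  · intro f g hf hg
    simp only [map_add]
    exact hf.add hg
  · intro c f hf
    simp only [map_smul]
    exact hf.const_smul c

lemma isSchwingerDyson_limitFunctional
    (hY : ∀ n, Tendsto (fun N => normTrace (Y N ^ n)) atTop (𝓝 (m n))) (hm : m 0 = 1) :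
    IsSchwingerDyson (limitFunctional hX Y) where
  map_one := by
    rw [← monom_nil, limitFunctional, functionalOfMoments_monom, ← hm]
    exact limitMoment_replicate_true hX Y hY 0
  map_mul_comm f g := by
    refine tendsto_nhds_unique (tendsto_limitFunctional hX Y hY (f * g))
      ((tendsto_limitFunctional hX Y hY (g * f)).congr fun N => ?_)
    simp only [expNormTrace, map_mul, Pi.mul_apply, normTrace]
    simp only [Matrix.trace_mul_comm (randomLift (Y N) (X N) g _)]
  map_X_mul f := by
    have : limitFunctional hX Y ∘ₗ LinearMap.mulLeft ℂ (FreeAlgebra.ι ℂ false) =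
        tensorSq (limitFunctional hX Y) ∘ₗ freeDiff := by
      refine free_linearMap_ext fun w => ?_
      simp only [LinearMap.comp_apply, LinearMap.mulLeft_apply, freeDiff_monom, ← monom_cons,
        map_list_sum, List.map_map, Function.comp_def, tensorSq_tmul]
      simp only [limitFunctional, functionalOfMoments_monom]
      exact limitMoment_false_cons hX Y hY w
    exact DFunLike.congr_fun this f

lemma limitFunctional_Y_pow
    (hY : ∀ n, Tendsto (fun N => normTrace (Y N ^ n)) atTop (𝓝 (m n))) (k : ℕ) :
    limitFunctional hX Y (FreeAlgebra.ι ℂ true ^ k) = m k := by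
  rw [← monom_replicate, limitFunctional, functionalOfMoments_monom,
    limitMoment_replicate_true hX Y hY]

end Limit

section Freeness

/-! ### Freeness from the Schwinger-Dyson equation -/

section Letters

variable {A : Type*} [Ring A] [Algebra ℂ A] (x y : A)

/-- The product of a list of letters. -/
noncomputable def letterProd (w : List (Bool × Polynomial ℂ)) : A := (w.map (letter x y)).prod

lemma letterProd_nil : letterProd x y [] = 1 := by simp [letterProd]

lemma letterProd_cons (a : Bool × Polynomial ℂ) (w : List (Bool × Polynomial ℂ)) :
    letterProd x y (a :: w) = letter x y a * letterProd x y w := by simp [letterProd]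

lemma letterProd_append (v w : List (Bool × Polynomial ℂ)) :
    letterProd x y (v ++ w) = letterProd x y v * letterProd x y w := by simp [letterProd]

lemma letterProd_concat (w : List (Bool × Polynomial ℂ)) (a : Bool × Polynomial ℂ) :
    letterProd x y (w ++ [a]) = letterProd x y w * letter x y a := by simp [letterProd]

lemma letter_mul (b : Bool) (p q : Polynomial ℂ) :
    letter x y (b, p * q) = letter x y (b, p) * letter x y (b, q) := by simp [letter]

lemma letter_sub_C (b : Bool) (p : Polynomial ℂ) (c : ℂ) :
    letter x y (b, p - Polynomial.C c) = letter x y (b, p) - algebraMap ℂ A c := by simp [letter]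

lemma letter_eq_add (b : Bool) (p : Polynomial ℂ) (c : ℂ) :
    letter x y (b, p) = letter x y (b, p - Polynomial.C c) + algebraMap ℂ A c := by
  rw [letter_sub_C, sub_add_cancel]

/-- Centring of one factor of a product of letters. -/
lemma letterProd_insert (u v : List (Bool × Polynomial ℂ)) (b : Bool) (p : Polynomial ℂ) (c : ℂ) :
    letterProd x y (u ++ (b, p) :: v) =
      letterProd x y (u ++ [(b, p - Polynomial.C c)] ++ v) + c • letterProd x y (u ++ v) := by
  simp only [letterProd_append, letterProd_cons, letterProd_nil, mul_one]
  rw [letter_eq_add x y b p c, add_mul, mul_add, Algebra.smul_def, ← mul_assoc,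
    ← mul_assoc, ← mul_assoc, Algebra.commutes]

end Letters

variable {φ : FreeAlgebra ℂ Bool →ₗ[ℂ] ℂ}

local notation "𝕩" => FreeAlgebra.ι ℂ false
local notation "𝕪" => FreeAlgebra.ι ℂ true

lemma freeDiff_aeval_Y (q : Polynomial ℂ) : freeDiff (Polynomial.aeval 𝕪 q) = 0 := by
  induction q using Polynomial.induction_on' with
  | add p q hp hq => rw [map_add, map_add, hp, hq, add_zero]
  | monomial n c =>
    rw [Polynomial.aeval_monomial, ← Algebra.smul_def, map_smul]
    have : freeDiff (𝕪 ^ n) = 0 := by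
      induction n with
      | zero => rw [pow_zero, freeDiff_one]
      | succ n ih => rw [pow_succ, freeDiff_mul, ih, freeDiff_ι]; simp
    rw [this, smul_zero]

lemma freeDiff_X_pow (m : ℕ) :
    freeDiff (𝕩 ^ m) = ∑ j ∈ Finset.range m, (𝕩 ^ j) ⊗ₜ[ℂ] (𝕩 ^ (m - 1 - j)) := by
  induction m with
  | zero => simp [freeDiff_one]
  | succ m ih =>
    rw [pow_succ, freeDiff_mul, ih, freeDiff_ι, Finset.sum_range_succ, add_comm]
    simp only [Bool.false_eq_true, if_false, mul_one, Finset.sum_mul,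
      Algebra.TensorProduct.tmul_mul_tmul, ← pow_succ]
    congr 1
    · refine Finset.sum_congr rfl fun j hj => ?_
      have := Finset.mem_range.1 hj
      congr 2
      omega
    · simp

/-- If `φ(a p(X)) = 0` for all polynomials `p`, then `φ ⊗ φ` vanishes on `a · ∂p(X) · b`. -/
lemma tensorSq_freeDiff_aeval_X {a : FreeAlgebra ℂ Bool}
    (ha : ∀ p : Polynomial ℂ, φ (a * Polynomial.aeval 𝕩 p) = 0) (p : Polynomial ℂ)
    (b : FreeAlgebra ℂ Bool) :
    tensorSq φ ((a ⊗ₜ 1) * freeDiff (Polynomial.aeval 𝕩 p) * (1 ⊗ₜ b)) = 0 := by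
  induction p using Polynomial.induction_on' with
  | add p q hp hq => rw [map_add, map_add, mul_add, add_mul, map_add, hp, hq, add_zero]
  | monomial n c =>
    rw [Polynomial.aeval_monomial, ← Algebra.smul_def, map_smul, mul_smul_comm, smul_mul_assoc,
      map_smul, freeDiff_X_pow, Finset.mul_sum, Finset.sum_mul, map_sum]
    rw [Finset.sum_eq_zero, smul_zero]
    intro j _
    have := ha (Polynomial.X ^ j)
    rw [map_pow, Polynomial.aeval_X] at this
    simp only [Algebra.TensorProduct.tmul_mul_tmul, tensorSq_tmul, mul_one, this, zero_mul]

/-- `φ ⊗ φ` vanishes on `a · ∂r`, for a product of letters `r`, if `φ` vanishes on the products of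
`a`, of an initial piece of `r` that ends before a polynomial in `X`, and of any polynomial in `X`:
each term of `∂r` has such a left leg. -/
lemma tensorSq_freeDiff_letterProd (r : List (Bool × Polynomial ℂ)) {a : FreeAlgebra ℂ Bool}
    (ha : ∀ u p v, r = u ++ (false, p) :: v →
      ∀ p' : Polynomial ℂ, φ (a * letterProd 𝕩 𝕪 u * Polynomial.aeval 𝕩 p') = 0) :
    tensorSq φ ((a ⊗ₜ 1) * freeDiff (letterProd 𝕩 𝕪 r)) = 0 := by
  induction r generalizing a with
  | nil => rw [letterProd_nil, freeDiff_one, mul_zero, map_zero]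
  | cons h r ih =>
    rw [letterProd_cons, freeDiff_mul, mul_add, map_add, ← mul_assoc, ← mul_assoc,
      Algebra.TensorProduct.tmul_mul_tmul, mul_one]
    rw [ih fun u p v hr p' => by
      have := ha (h :: u) p v (by rw [hr]; rfl) p'
      rwa [letterProd_cons, ← mul_assoc] at this, zero_add]
    obtain ⟨b, p⟩ := h
    cases b
    · exact tensorSq_freeDiff_aeval_X (fun p' => by simpa [letterProd_nil] using ha [] p r rfl p')
        p _
    · have : freeDiff (letter 𝕩 𝕪 (true, p)) = 0 := freeDiff_aeval_Y p
      rw [this, mul_zero, zero_mul, map_zero]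

/-- An alternating list of centred letters. -/
def IsCentredAlternating {A : Type*} [Ring A] [Algebra ℂ A] (τ : A →ₗ[ℂ] ℂ) (x y : A)
    (w : List (Bool × Polynomial ℂ)) : Prop :=
  w.IsChain (fun p p' => p.1 ≠ p'.1) ∧ ∀ p ∈ w, τ (letter x y p) = 0

lemma isChain_colour_iff (w : List (Bool × Polynomial ℂ)) :
    w.IsChain (fun p p' => p.1 ≠ p'.1) ↔ (w.map Prod.fst).IsChain (· ≠ ·) := by
  rw [List.isChain_map]

section Centred
variable {A : Type*} [Ring A] [Algebra ℂ A] {τ : A →ₗ[ℂ] ℂ} {x y : A}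

lemma IsCentredAlternating.left {u v : List (Bool × Polynomial ℂ)}
    (h : IsCentredAlternating τ x y (u ++ v)) : IsCentredAlternating τ x y u :=
  ⟨h.1.left_of_append, fun p hp => h.2 p (by simp [hp])⟩

lemma map_letter_centred (h1 : τ 1 = 1) (b : Bool) (p : Polynomial ℂ) :
    τ (letter x y (b, p - Polynomial.C (τ (letter x y (b, p))))) = 0 := by
  rw [letter_sub_C, map_sub, Algebra.algebraMap_eq_smul_one, map_smul, h1, smul_eq_mul, mul_one,
    sub_self]

lemma IsCentredAlternating.append_centred (h1 : τ 1 = 1) {u : List (Bool × Polynomial ℂ)}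
    (hu : IsCentredAlternating τ x y u) (b : Bool) (p q : Polynomial ℂ)
    (hc : (u ++ [(b, p)]).IsChain (fun p p' => p.1 ≠ p'.1)) :
    IsCentredAlternating τ x y (u ++ [(b, q - Polynomial.C (τ (letter x y (b, q))))]) := by
  refine ⟨?_, fun r hr => ?_⟩
  · rw [isChain_colour_iff] at hc ⊢
    simpa using hc
  · rw [List.mem_append, List.mem_singleton] at hr
    rcases hr with hr | rfl
    · exact hu.2 r hr
    · exact map_letter_centred h1 b q

end Centred

/-- The induction step of freeness: if alternating centred products with at most `n` factors have
expectation zero, then so do their products with any polynomial in `X` from the left, if the first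
factor is a polynomial in `Y`. -/
lemma IsSchwingerDyson.X_pow_mul_letterProd (hφ : IsSchwingerDyson φ) {n : ℕ}
    (IH : ∀ w, w ≠ [] → w.length ≤ n → IsCentredAlternating φ 𝕩 𝕪 w → φ (letterProd 𝕩 𝕪 w) = 0)
    (m : ℕ) (q : Polynomial ℂ) (r : List (Bool × Polynomial ℂ)) (hn : r.length < n)
    (hr : IsCentredAlternating φ 𝕩 𝕪 ((true, q) :: r)) :
    φ (𝕩 ^ m * letterProd 𝕩 𝕪 ((true, q) :: r)) = 0 := by
  induction m using Nat.strong_induction_on generalizing r with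
  | _ m ihm =>
  cases m with
  | zero => simpa using IH _ (by simp) (by simpa using hn) hr
  | succ m =>
    rw [pow_succ', mul_assoc, hφ.map_X_mul, freeDiff_mul, map_add, tensorSq_freeDiff_letterProd,
      zero_add, freeDiff_X_pow, Finset.sum_mul, map_sum]
    · refine Finset.sum_eq_zero fun j hj => ?_
      have := Finset.mem_range.1 hj
      rw [Algebra.TensorProduct.tmul_mul_tmul, tensorSq_tmul, ihm _ (by omega) _ hn hr, mul_zero]
    · intro u p v huv p'
      obtain _ | ⟨h, u⟩ := u
      · simp at huv
      · rw [List.cons_append, List.cons.injEq] at huv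
        obtain ⟨rfl, huv⟩ := huv
        rw [huv] at hr hn
        have hl : u.length + 1 ≤ r.length := by rw [huv]; simp
        simp only [List.length_append, List.length_cons] at hn
        have hr' : IsCentredAlternating φ 𝕩 𝕪 (((true, q) :: u ++ [(false, p)]) ++ v) := by
          simpa using hr
        have h1 := hr'.left.left.append_centred hφ.map_one false p p' hr'.left.1
        have h2 : φ (𝕩 ^ m * letterProd 𝕩 𝕪 ((true, q) :: u ++
            [(false, p' - Polynomial.C (φ (letter 𝕩 𝕪 (false, p'))))])) = 0 :=
          ihm m (by omega) (u ++ _) (by simp; omega) h1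
        have h3 := ihm m (by omega) u (by omega) hr'.left.left
        have e : Polynomial.aeval 𝕩 p' = letter 𝕩 𝕪 (false, p') := by simp [letter]
        rw [e, letter_eq_add _ _ _ _ (φ (letter 𝕩 𝕪 (false, p'))), mul_add, map_add,
          ← Algebra.commutes, ← Algebra.smul_def, map_smul, h3, smul_zero, add_zero]
        rw [letterProd_concat] at h2
        rw [mul_assoc, h2]

/-- Alternating centred products with at most `n` factors have expectation zero. A product that
starts with a polynomial in `X` is treated by the Schwinger-Dyson equation; any other product of at
least two factors is rotated into one of this kind, or into a shorter one, by the trace property.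
-/
lemma IsSchwingerDyson.letterProd_eq_zero (hφ : IsSchwingerDyson φ) (n : ℕ) :
    ∀ w, w ≠ [] → w.length ≤ n → IsCentredAlternating φ 𝕩 𝕪 w → φ (letterProd 𝕩 𝕪 w) = 0 := by
  induction n with
  | zero => intro w h0 hl; exact absurd (List.length_eq_zero_iff.1 (Nat.le_zero.1 hl)) h0
  | succ n IH =>
    have hX : ∀ p r, r.length ≤ n → IsCentredAlternating φ 𝕩 𝕪 ((false, p) :: r) →
        φ (letterProd 𝕩 𝕪 ((false, p) :: r)) = 0 := by
      intro p r hl hr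
      obtain _ | ⟨⟨b, q⟩, r⟩ := r
      · simpa [letterProd] using hr.2 (false, p) (by simp)
      obtain rfl : b = true := by
        have := hr.1
        rw [List.isChain_cons_cons] at this
        simpa using this.1
      have hr' : IsCentredAlternating φ 𝕩 𝕪 ((true, q) :: r) :=
        ⟨hr.1.tail, fun p hp => hr.2 p (by simp [hp])⟩
      have key := fun m => hφ.X_pow_mul_letterProd IH m q r (by simpa using hl) hr'
      rw [letterProd_cons]
      change φ (Polynomial.aeval 𝕩 p * _) = 0
      rw [Polynomial.aeval_eq_sum_range, Finset.sum_mul, map_sum]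
      refine Finset.sum_eq_zero fun j _ => ?_
      rw [smul_mul_assoc, map_smul, key, smul_zero]
    intro w h0 hl hw
    obtain _ | ⟨⟨b, q⟩, r⟩ := w
    · exact absurd rfl h0
    cases b
    · exact hX q r (by simpa using hl) hw
    -- a word that starts with a polynomial in `Y` is rotated
    rcases List.eq_nil_or_concat r with rfl | ⟨s, ⟨b, q'⟩, rfl⟩
    · simpa [letterProd] using hw.2 (true, q) (by simp)
    rw [letterProd_cons, hφ.map_mul_comm]
    obtain _ | ⟨⟨b', p⟩, s⟩ := s
    · obtain rfl : b = false := by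
        have := hw.1
        simp at this
        exact this
      have := hX q' [(true, q)] (by simpa using hl)
        ⟨by simp, fun p hp => hw.2 p (by simp at hp ⊢; tauto)⟩
      simpa [letterProd] using this
    have hb' : b' = false := by
      have := hw.1
      simp only [List.concat_eq_append, List.cons_append, List.isChain_cons_cons] at this
      simpa using this.1
    subst hb'
    have hs : IsCentredAlternating φ 𝕩 𝕪 ((false, p) :: s ++ [(b, q')]) :=
      ⟨by simpa using hw.1.tail, fun p hp => hw.2 p (by simp at hp ⊢; tauto)⟩
    cases b
    · have := hX p (s ++ [(false, q')] ++ [(true, q)]) (by simp at hl ⊢; omega)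
        ⟨?_, fun p hp => hw.2 p (by simp at hp ⊢; tauto)⟩
      · simpa [letterProd, mul_assoc] using this
      · have h1 : (((false, p) :: s) ++ (false, q') :: (true, q) :: []).IsChain
            (fun p p' : Bool × Polynomial ℂ => p.1 ≠ p'.1) :=
          List.isChain_append_cons_cons.2 ⟨hs.1, by simp, by simp⟩
        simpa using h1
    · have h1 := hs.left.append_centred hφ.map_one true q' (q' * q) hs.1
      have h2 := IH _ (by simp) (by simp at hl ⊢; omega) h1
      have h3 := IH _ (by simp) (by simp at hl ⊢; omega) hs.left
      rw [letterProd_concat, letter_sub_C, mul_sub, map_sub, ← Algebra.commutes,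
        ← Algebra.smul_def, map_smul, h3, smul_zero, sub_zero, letter_mul] at h2
      simpa [letterProd, mul_assoc] using h2

/-- The Schwinger-Dyson equation for `X`, together with the trace property, implies that `X` and `Y`
are free. -/
theorem IsSchwingerDyson.freelyIndependent (hφ : IsSchwingerDyson φ) :
    FreelyIndependent φ 𝕩 𝕪 := fun w h0 hc h =>
  hφ.letterProd_eq_zero w.length w h0 le_rfl ⟨hc, h⟩

/-! ### Freeness and the marginal moments determine the joint moments -/

section Determination

variable {A B : Type*} [Ring A] [Algebra ℂ A] [Ring B] [Algebra ℂ B] {τ : A →ₗ[ℂ] ℂ}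
  {τ' : B →ₗ[ℂ] ℂ} {x y : A} {x' y' : B}

/-- By induction on the number of letters, from the left to the right: a letter is centred, or
merged with its left neighbour, at the expense of products with fewer letters; on alternating
centred products both functionals vanish. -/
lemma FreelyIndependent.letterProd_eq (h : FreelyIndependent τ x y)
    (h' : FreelyIndependent τ' x' y') (h1 : τ 1 = 1) (h1' : τ' 1 = 1)
    (hl : ∀ a, τ (letter x y a) = τ' (letter x' y' a)) (w : List (Bool × Polynomial ℂ)) :
    τ (letterProd x y w) = τ' (letterProd x' y' w) := by
  induction hn : w.length using Nat.strong_induction_on generalizing w with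
  | _ n ih =>
  have key : ∀ v u, IsCentredAlternating τ x y u → (u ++ v).length = n →
      τ (letterProd x y (u ++ v)) = τ' (letterProd x' y' (u ++ v)) := by
    intro v
    induction v with
    | nil =>
      intro u hu _
      rw [List.append_nil]
      by_cases h0 : u = []
      · rw [h0, letterProd_nil, letterProd_nil, h1, h1']
      · exact (h u h0 hu.1 hu.2).trans
          (h' u h0 hu.1 fun a ha => (hl a).symm.trans (hu.2 a ha)).symm
    | cons a v ihv =>
      intro u hu hlen
      obtain ⟨b, p⟩ := a
      by_cases hc : (u ++ [(b, p)]).IsChain fun p p' => p.1 ≠ p'.1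
      · -- the first letter that is not yet centred is centred
        have e1 := ihv _ (hu.append_centred h1 b p p hc) (by simpa using hlen)
        have e2 := ih (u ++ v).length (by simp at hlen ⊢; omega) (u ++ v) rfl
        rw [letterProd_insert x y u v b p (τ (letter x y (b, p))),
          letterProd_insert x' y' u v b p (τ (letter x y (b, p))), map_add, map_add, e1,
          map_smul, map_smul, e2]
      · -- two neighbouring letters of the same colour are merged
        rcases List.eq_nil_or_concat u with rfl | ⟨s, ⟨b', q⟩, rfl⟩
        · simp at hc
        rw [List.concat_eq_append] at *
        have hb : b' = b := by
          by_contra hb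
          refine hc ?_
          rw [List.append_assoc]
          exact List.isChain_append_cons_cons.2 ⟨hu.1, hb, by simp⟩
        subst hb
        have e2 := ih (s ++ (b', q * p) :: v).length (by simp at hlen ⊢; omega) _ rfl
        simpa only [letterProd_append, letterProd_cons, letterProd_nil, mul_one, letter_mul,
          mul_assoc, List.append_assoc, List.cons_append, List.nil_append] using e2
  exact key w [] ⟨by simp, by simp⟩ (by simpa using hn)

lemma lift_monom_eq_letterProd (x y : A) (w : List Bool) :
    FreeAlgebra.lift ℂ (pair x y) (monom w) =
      letterProd x y (w.map fun b => (b, Polynomial.X)) := by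
  simp only [monom, letterProd, map_list_prod, List.map_map]
  refine congrArg List.prod (List.map_congr_left fun b _ => ?_)
  cases b <;> simp [pair, letter]

lemma map_letter_eq (hx : ∀ n : ℕ, τ (x ^ n) = τ' (x' ^ n)) (hy : ∀ n : ℕ, τ (y ^ n) = τ' (y' ^ n))
    (a : Bool × Polynomial ℂ) : τ (letter x y a) = τ' (letter x' y' a) := by
  obtain ⟨b, p⟩ := a
  cases b <;> simp [letter, Polynomial.aeval_eq_sum_range, hx, hy]

/-- The joint moments of freely independent variables are determined by the moments of each of
them. -/
theorem FreelyIndependent.lift_eq (h : FreelyIndependent τ x y)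
    (h' : FreelyIndependent τ' x' y') (h1 : τ 1 = 1) (h1' : τ' 1 = 1)
    (hx : ∀ n : ℕ, τ (x ^ n) = τ' (x' ^ n)) (hy : ∀ n : ℕ, τ (y ^ n) = τ' (y' ^ n))
    (f : FreeAlgebra ℂ Bool) :
    τ (FreeAlgebra.lift ℂ (pair x y) f) = τ' (FreeAlgebra.lift ℂ (pair x' y') f) := by
  have : τ ∘ₗ (FreeAlgebra.lift ℂ (pair x y)).toLinearMap =
      τ' ∘ₗ (FreeAlgebra.lift ℂ (pair x' y')).toLinearMap := by
    refine free_linearMap_ext fun w => ?_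
    simp only [LinearMap.comp_apply, AlgHom.toLinearMap_apply, lift_monom_eq_letterProd]
    exact h.letterProd_eq h' h1 h1' (map_letter_eq hx hy) _
  exact DFunLike.congr_fun this f

lemma lift_pair_ι (f : FreeAlgebra ℂ Bool) :
    FreeAlgebra.lift ℂ (pair (FreeAlgebra.ι ℂ false) (FreeAlgebra.ι ℂ true)) f = f := by
  have : FreeAlgebra.lift ℂ (pair (FreeAlgebra.ι ℂ false) (FreeAlgebra.ι ℂ true)) =
      AlgHom.id ℂ (FreeAlgebra ℂ Bool) := by
    ext b
    cases b <;> simp [pair]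
  rw [this, AlgHom.id_apply]

lemma lift_pair_letterProd (x y : A) (w : List (Bool × Polynomial ℂ)) :
    FreeAlgebra.lift ℂ (pair x y) (letterProd 𝕩 𝕪 w) = letterProd x y w := by
  simp only [letterProd, map_list_prod, List.map_map]
  refine congrArg List.prod (List.map_congr_left fun a _ => ?_)
  obtain ⟨b, p⟩ := a
  cases b <;> simp [letter, ← Polynomial.aeval_algHom_apply, pair]

end Determination

end Freeness

/-! ### The moments of the semicircle law -/

/-- The moments of the semicircle law: Catalan numbers in even degrees. -/
def semicircleMoment (n : ℕ) : ℕ := if Even n then catalan (n / 2) else 0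

lemma semicircleMoment_two_mul (n : ℕ) : semicircleMoment (2 * n) = catalan n := by
  simp [semicircleMoment]

lemma semicircleMoment_two_mul_add_one (n : ℕ) : semicircleMoment (2 * n + 1) = 0 := by
  simp [semicircleMoment]

lemma sum_range_even_odd {M : Type*} [AddCommMonoid M] (f : ℕ → M) (n : ℕ) :
    ∑ j ∈ Finset.range (2 * n + 1), f j =
      ∑ i ∈ Finset.range (n + 1), f (2 * i) + ∑ i ∈ Finset.range n, f (2 * i + 1) := by
  induction n with
  | zero => simp
  | succ n ih =>
    rw [show 2 * (n + 1) + 1 = 2 * n + 1 + 1 + 1 by ring, Finset.sum_range_succ,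
      Finset.sum_range_succ, ih, Finset.sum_range_succ _ (n + 1),
      Finset.sum_range_succ (fun i => f (2 * i + 1)) n, show 2 * n + 1 + 1 = 2 * (n + 1) by ring]
    ac_rfl

/-- The Catalan recursion. -/
lemma semicircleMoment_succ (m : ℕ) : semicircleMoment (m + 1) =
    ∑ j ∈ Finset.range m, semicircleMoment j * semicircleMoment (m - 1 - j) := by
  obtain ⟨n, rfl | rfl⟩ := Nat.even_or_odd' m
  · rw [semicircleMoment_two_mul_add_one]
    refine (Finset.sum_eq_zero fun j hj => ?_).symm
    have hj := Finset.mem_range.1 hj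
    obtain ⟨i, rfl | rfl⟩ := Nat.even_or_odd' j
    · rw [show 2 * n - 1 - 2 * i = 2 * (n - 1 - i) + 1 by omega, semicircleMoment_two_mul_add_one,
        mul_zero]
    · rw [semicircleMoment_two_mul_add_one, zero_mul]
  · rw [show 2 * n + 1 + 1 = 2 * (n + 1) by ring, semicircleMoment_two_mul, catalan_succ,
      sum_range_even_odd, Finset.sum_range (n := n + 1)]
    simp only [semicircleMoment_two_mul_add_one, zero_mul, Finset.sum_const_zero, add_zero]
    refine Finset.sum_congr rfl fun i _ => ?_
    rw [show 2 * n + 1 - 1 - 2 * (i : ℕ) = 2 * (n - i) by omega, semicircleMoment_two_mul,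
      semicircleMoment_two_mul]

/-- The bound `2 ^ n` reflects that the semicircle law is supported on `[-2, 2]`. -/
lemma semicircleMoment_le (n : ℕ) : semicircleMoment n ≤ 2 ^ n := by
  obtain ⟨k, rfl | rfl⟩ := Nat.even_or_odd' n
  · rw [semicircleMoment_two_mul, catalan_eq_centralBinom_div]
    exact (Nat.div_le_self _ _).trans (Nat.choose_le_two_pow _ _)
  · rw [semicircleMoment_two_mul_add_one]; positivity

/-- On powers of `X`, the Schwinger-Dyson equation is the Catalan recursion. -/
lemma IsSchwingerDyson.map_X_pow {φ : FreeAlgebra ℂ Bool →ₗ[ℂ] ℂ} (hφ : IsSchwingerDyson φ)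
    (n : ℕ) : φ (FreeAlgebra.ι ℂ false ^ n) = semicircleMoment n := by
  induction n using Nat.strong_induction_on with
  | _ n ih =>
  cases n with
  | zero => simp [hφ.map_one, semicircleMoment]
  | succ m =>
    rw [pow_succ', hφ.map_X_mul, freeDiff_X_pow, map_sum, semicircleMoment_succ]
    push_cast
    refine Finset.sum_congr rfl fun j hj => ?_
    have hj := Finset.mem_range.1 hj
    rw [tensorSq_tmul, ih _ (by omega), ih _ (by omega)]

/-- The moments of the density `√(4 - t²)` on `[-2, 2]`. -/
noncomputable def sqrtMoment (n : ℕ) : ℝ := ∫ t in (-2 : ℝ)..2, t ^ n * √(4 - t ^ 2)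

/-- Integration of the derivative of `t ^ n (4 - t²) √(4 - t²)`, which vanishes at `±2`. For
`n = 0` the power `n - 1` is truncated, but it is multiplied by zero. -/
lemma sqrtMoment_rec (n : ℕ) :
    (n + 3) * sqrtMoment (n + 1) = 4 * n * sqrtMoment (n - 1) := by
  have hd : ∀ t ∈ Set.Ioo (-2 : ℝ) 2,
      HasDerivAt (fun t : ℝ => t ^ n * ((4 - t ^ 2) * √(4 - t ^ 2)))
      (4 * n * (t ^ (n - 1) * √(4 - t ^ 2)) - (n + 3) * (t ^ (n + 1) * √(4 - t ^ 2))) t := by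
    intro t ht
    have hpos : 0 < 4 - t ^ 2 := by nlinarith [ht.1, ht.2]
    have h1 : HasDerivAt (fun t : ℝ => 4 - t ^ 2) (-(2 * t)) t := by
      simpa using (hasDerivAt_pow 2 t).const_sub 4
    have h2 := (hasDerivAt_pow n t).mul (h1.mul (h1.sqrt hpos.ne'))
    refine h2.congr_deriv ?_
    have hs : √(4 - t ^ 2) ≠ 0 := (Real.sqrt_pos.2 hpos).ne'
    have hs2 : √(4 - t ^ 2) ^ 2 = 4 - t ^ 2 := Real.sq_sqrt hpos.le
    have e : (4 - t ^ 2) * (-(2 * t) / (2 * √(4 - t ^ 2))) = - t * √(4 - t ^ 2) := by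
      field_simp
      rw [hs2]
    simp only [Pi.mul_apply]
    rw [e]
    cases n with
    | zero => simp; ring
    | succ n => simp only [Nat.add_sub_cancel]; push_cast; ring
  have hF := intervalIntegral.integral_eq_sub_of_hasDerivAt_of_le (a := -2) (b := 2) (by norm_num)
    (by fun_prop) hd (by
      apply Continuous.intervalIntegrable
      fun_prop)
  rw [intervalIntegral.integral_sub (by apply Continuous.intervalIntegrable; fun_prop)
    (by apply Continuous.intervalIntegrable; fun_prop), intervalIntegral.integral_const_mul,
    intervalIntegral.integral_const_mul] at hF
  norm_num at hF
  unfold sqrtMoment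
  linarith

lemma sqrtMoment_zero : sqrtMoment 0 = 2 * Real.pi := by
  have h := intervalIntegral.integral_comp_mul_left (a := -1) (b := 1)
    (fun t => √(4 - t ^ 2)) (two_ne_zero (α := ℝ))
  have e : ∀ x : ℝ, √(4 - (2 * x) ^ 2) = 2 * √(1 - x ^ 2) := by
    intro x
    rw [show 4 - (2 * x) ^ 2 = 2 ^ 2 * (1 - x ^ 2) by ring, Real.sqrt_mul (by norm_num),
      Real.sqrt_sq (by norm_num)]
  simp only [e, intervalIntegral.integral_const_mul, integral_sqrt_one_sub_sq] at h
  norm_num at h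
  simp only [sqrtMoment, pow_zero, one_mul]
  linarith

lemma sqrtMoment_eq (n : ℕ) : sqrtMoment n = 2 * Real.pi * semicircleMoment n := by
  have heven : ∀ k : ℕ, sqrtMoment (2 * k) = 2 * Real.pi * catalan k := by
    intro k
    induction k with
    | zero => simp [sqrtMoment_zero]
    | succ k ih =>
      have h := sqrtMoment_rec (2 * k + 1)
      rw [Nat.add_sub_cancel, ih] at h
      have h1 := succ_mul_catalan_eq_centralBinom k
      have h2 := succ_mul_catalan_eq_centralBinom (k + 1)
      have h3 := Nat.succ_mul_centralBinom_succ k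
      rw [← h1, ← h2] at h3
      have h4 : ((k : ℝ) + 1) * ((k + 1 + 1) * catalan (k + 1)) =
          2 * (2 * k + 1) * ((k + 1) * catalan k) := by exact_mod_cast h3
      have hk : (k : ℝ) + 1 ≠ 0 := by positivity
      have h5 : ((k : ℝ) + 2) * catalan (k + 1) = 2 * (2 * k + 1) * catalan k := by
        apply mul_left_cancel₀ hk
        linear_combination h4
      have h6 : (2 * (k : ℝ) + 4) ≠ 0 := by positivity
      rw [show 2 * (k + 1) = 2 * k + 1 + 1 by ring]
      apply mul_left_cancel₀ h6
      push_cast at h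
      linear_combination h - 4 * Real.pi * h5
  have hodd : ∀ k : ℕ, sqrtMoment (2 * k + 1) = 0 := by
    intro k
    induction k with
    | zero =>
      have h := sqrtMoment_rec 0
      simpa using h
    | succ k ih =>
      have h := sqrtMoment_rec (2 * k + 2)
      rw [show 2 * k + 2 - 1 = 2 * k + 1 by omega, ih, mul_zero] at h
      rcases mul_eq_zero.1 h with h | h
      · have : ((2 * k + 2 : ℕ) : ℝ) + 3 ≠ 0 := by positivity
        exact absurd h this
      · exact h
  obtain ⟨k, rfl | rfl⟩ := Nat.even_or_odd' n
  · rw [heven, semicircleMoment_two_mul]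
  · rw [hodd, semicircleMoment_two_mul_add_one]; simp

lemma sqrt_eq_zero_of_notMem {t : ℝ} (ht : t ∉ Set.Ioc (-2 : ℝ) 2) : √(4 - t ^ 2) = 0 := by
  apply Real.sqrt_eq_zero_of_nonpos
  rw [Set.mem_Ioc, not_and_or, not_lt, not_le] at ht
  rcases ht with h | h <;> nlinarith

lemma integral_pow_mul_sqrt (n : ℕ) :
    ∫ t : ℝ, t ^ n * √(4 - t ^ 2) = sqrtMoment n := by
  rw [sqrtMoment, intervalIntegral.integral_of_le (by norm_num)]
  exact (setIntegral_eq_integral_of_forall_compl_eq_zero fun t ht => by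
    rw [sqrt_eq_zero_of_notMem ht, mul_zero]).symm

lemma integral_semicircle_pow (n : ℕ) : ∫ t, t ^ n ∂semicircle = semicircleMoment n := by
  unfold semicircle
  rw [integral_withDensity_eq_integral_toReal_smul (by fun_prop) (by simp)]
  have : ∀ t : ℝ, (ENNReal.ofReal (√(4 - t ^ 2) / (2 * Real.pi))).toReal • t ^ n =
      (2 * Real.pi)⁻¹ * (t ^ n * √(4 - t ^ 2)) := by
    intro t
    rw [ENNReal.toReal_ofReal (by positivity), smul_eq_mul]
    ring
  simp only [this]
  rw [integral_const_mul, integral_pow_mul_sqrt, sqrtMoment_eq, ← mul_assoc,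
    inv_mul_cancel₀ (by positivity), one_mul]

lemma semicircle_compl_Icc : semicircle (Set.Icc (-2) 2)ᶜ = 0 := by
  unfold semicircle
  rw [withDensity_apply _ measurableSet_Icc.compl, lintegral_eq_zero_iff (by fun_prop)]
  rw [Filter.EventuallyEq, ae_restrict_iff' measurableSet_Icc.compl]
  refine ae_of_all _ fun t ht => ?_
  have : t ∉ Set.Ioc (-2 : ℝ) 2 := fun h => ht (Set.Ioc_subset_Icc_self h)
  simp [sqrt_eq_zero_of_notMem this]

instance : IsProbabilityMeasure semicircle := by
  refine ⟨?_⟩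
  have h : ∫ t : ℝ, √(4 - t ^ 2) / (2 * Real.pi) = 1 := by
    have := integral_pow_mul_sqrt 0
    simp only [pow_zero, one_mul] at this
    rw [integral_div, this, sqrtMoment_zero, div_self (by positivity)]
  unfold semicircle
  rw [withDensity_apply _ MeasurableSet.univ, setLIntegral_univ,
    ← ofReal_integral_eq_lintegral_ofReal _ (ae_of_all _ fun t => by positivity), h,
    ENNReal.ofReal_one]
  by_contra hi
  rw [integral_undef hi] at h
  exact zero_ne_one h

lemma hasDistribution_semicircle {A : Type*} [Ring A] [Algebra ℂ A] {τ : A →ₗ[ℂ] ℂ} {x : A}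
    (h : ∀ n, τ (x ^ n) = semicircleMoment n) : HasDistribution τ x semicircle where
  isProbabilityMeasure := inferInstance
  compactSupport := ⟨_, isCompact_Icc, semicircle_compl_Icc⟩
  moments n := by rw [h, integral_semicircle_pow]; simp

lemma HasDistribution.map_pow_semicircle {A : Type*} [Ring A] [Algebra ℂ A] {τ : A →ₗ[ℂ] ℂ} {x : A}
    (h : HasDistribution τ x semicircle) (n : ℕ) : τ (x ^ n) = semicircleMoment n := by
  rw [h.moments, integral_semicircle_pow]; simp

/-! ### A bound for the mixed moments -/

/-- The splittings of a word are enumerated by the number of letters `X` on the left of the letter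
that is removed. -/
lemma sum_splits_count {M : Type*} [AddCommMonoid M] (w : List Bool) (g : ℕ → ℕ → M) :
    ((splits w).map fun p => g (p.1.count false) (p.2.count false)).sum =
      ∑ i ∈ Finset.range (w.count false), g i (w.count false - 1 - i) := by
  induction w generalizing g with
  | nil => simp [splits]
  | cons b w ih =>
    cases b
    · have := ih fun i j => g (i + 1) j
      simp only [splits, List.map_cons, List.map_map, Function.comp_def, List.sum_cons,
        List.count_nil, List.count_cons_self, this]
      rw [Finset.sum_range_succ', add_comm]
      congr 1
      refine Finset.sum_congr rfl fun i _ => ?_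
      congr 1
      omega
    · have := ih g
      simpa [splits, Function.comp_def] using this

section Bound

variable {φ : FreeAlgebra ℂ Bool →ₗ[ℂ] ℂ} {R : ℝ}

/-- The Schwinger-Dyson equation bounds the moments of a word by the numbers of its letters, as if
all letters `Y` were the scalar `R`. -/
lemma IsSchwingerDyson.norm_monom_le (hφ : IsSchwingerDyson φ)
    (hR : ∀ k, ‖φ (FreeAlgebra.ι ℂ true ^ k)‖ ≤ R ^ k) (w : List Bool) :
    ‖φ (monom w)‖ ≤ semicircleMoment (w.count false) * R ^ (w.count true) := by
  induction h : w.length using Nat.strong_induction_on generalizing w with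
  | _ n ih =>
  by_cases hf : false ∈ w
  · obtain ⟨s, t, rfl⟩ := List.append_of_mem hf
    rw [monom_append, hφ.map_mul_comm, ← monom_append, List.cons_append, monom_cons, hφ.map_X_mul,
      freeDiff_monom, map_list_sum, List.map_map]
    have hcf : (s ++ false :: t).count false = (t ++ s).count false + 1 := by simp; omega
    have hct : (s ++ false :: t).count true = (t ++ s).count true := by simp; omega
    rw [hcf, hct, semicircleMoment_succ, ← sum_splits_count (t ++ s)
      fun i j => semicircleMoment i * semicircleMoment j]
    have key : ∀ l : List (List Bool × List Bool), (∀ p ∈ l, p ∈ splits (t ++ s)) →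
        ‖(l.map (tensorSq φ ∘ fun p => monom p.1 ⊗ₜ[ℂ] monom p.2)).sum‖ ≤
        (l.map fun p => semicircleMoment (p.1.count false) *
          semicircleMoment (p.2.count false)).sum * R ^ ((t ++ s).count true) := by
      intro l
      induction l with
      | nil => simp
      | cons p l ihl =>
        intro hl
        have hp := eq_append_of_mem_splits (hl p (by simp))
        have hlen : (t ++ s).length = p.1.length + p.2.length + 1 := by rw [hp]; simp; omega
        have hc : (t ++ s).count true = p.1.count true + p.2.count true := by rw [hp]; simp
        simp only [List.map_cons, List.sum_cons, Function.comp_apply, tensorSq_tmul]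
        push_cast
        rw [add_mul]
        refine (norm_add_le _ _).trans (add_le_add ?_ ?_)
        · rw [norm_mul]
          have h1 := ih p.1.length (by rw [← h]; simp at hlen ⊢; omega) p.1 rfl
          have h2 := ih p.2.length (by rw [← h]; simp at hlen ⊢; omega) p.2 rfl
          refine (mul_le_mul h1 h2 (norm_nonneg _) ((norm_nonneg _).trans h1)).trans_eq ?_
          rw [hc, pow_add]
          ring
        · simpa using ihl fun q hq => hl q (by simp [hq])
    exact key _ fun _ h => h
  · have hw : w = List.replicate w.length true := List.eq_replicate_of_mem fun b hb => by
      cases b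
      · exact absurd hb hf
      · rfl
    rw [hw, monom_replicate]
    simpa [List.count_replicate, semicircleMoment] using hR w.length

/-- The moments of `X + Y` grow at most exponentially, at the rate suggested by the norms `2` and
`R` of `X` and `Y`. -/
lemma IsSchwingerDyson.norm_add_pow_le (hφ : IsSchwingerDyson φ) (hR0 : 0 ≤ R)
    (hR : ∀ k, ‖φ (FreeAlgebra.ι ℂ true ^ k)‖ ≤ R ^ k) (n : ℕ) :
    ‖φ ((FreeAlgebra.ι ℂ false + FreeAlgebra.ι ℂ true) ^ n)‖ ≤ (2 + R) ^ n := by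
  have key : ∀ (n : ℕ) (w : List Bool),
      ‖φ (monom w * (FreeAlgebra.ι ℂ false + FreeAlgebra.ι ℂ true) ^ n)‖ ≤
        2 ^ w.count false * R ^ w.count true * (2 + R) ^ n := by
    intro n
    induction n with
    | zero =>
      intro w
      rw [pow_zero, mul_one, pow_zero, mul_one]
      refine (hφ.norm_monom_le hR w).trans ?_
      gcongr
      exact_mod_cast semicircleMoment_le _
    | succ n ih =>
      intro w
      have h1 := ih (w ++ [false])
      have h2 := ih (w ++ [true])
      rw [pow_succ', ← mul_assoc, mul_add, add_mul, map_add]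
      simp only [monom_append, monom_cons, monom_nil, mul_one] at h1 h2
      refine (norm_add_le _ _).trans ((add_le_add h1 h2).trans_eq ?_)
      simp [List.count_append]
      ring
  simpa [monom_nil] using key n []

end Bound

/-! ### Products over blocks -/

section Blocks

open scoped Classical in
/-- The product over the blocks of the partition of `I` by the values of `ℓ` of `f` at the sum of
`q` over the block. -/
noncomputable def blockProd {α β : Type*} (f : ℕ → ℂ) (ℓ : α → β) (I : Finset α) (q : α → ℕ) : ℂ :=
  ∏ c ∈ I.image ℓ, f (∑ i ∈ I with ℓ i = c, q i)

variable {α β γ : Type*} {f : ℕ → ℂ} {I J : Finset α} {q q' : α → ℕ} {ℓ : α → β}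

lemma blockProd_congr {ℓ' : α → γ} (h : ∀ i ∈ I, ∀ j ∈ I, ℓ i = ℓ j ↔ ℓ' i = ℓ' j)
    (hq : ∀ i ∈ I, q i = q' i) : blockProd f ℓ I q = blockProd f ℓ' I q' := by
  classical
  refine Finset.prod_bij (fun c hc => ℓ' (Finset.mem_image.1 hc).choose) ?_ ?_ ?_ ?_
  · intro c hc
    exact Finset.mem_image_of_mem _ (Finset.mem_image.1 hc).choose_spec.1
  · intro c hc d hd hcd
    have h1 := (Finset.mem_image.1 hc).choose_spec
    have h2 := (Finset.mem_image.1 hd).choose_spec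
    rw [← h1.2, ← h2.2]
    exact (h _ h1.1 _ h2.1).2 hcd
  · intro d hd
    obtain ⟨i, hi, rfl⟩ := Finset.mem_image.1 hd
    refine ⟨ℓ i, Finset.mem_image_of_mem _ hi, ?_⟩
    have h1 := (Finset.mem_image.1 (Finset.mem_image_of_mem ℓ hi)).choose_spec
    exact (h _ h1.1 _ hi).1 h1.2
  · intro c hc
    have h1 := (Finset.mem_image.1 hc).choose_spec
    congr 1
    refine Finset.sum_congr (Finset.filter_congr fun i hi => ?_) fun i hi =>
      hq i (Finset.mem_filter.1 hi).1
    conv_lhs => rw [← h1.2]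
    exact h _ hi _ h1.1

lemma blockProd_union [DecidableEq α] (h : ∀ i ∈ I, ∀ j ∈ J, ℓ i ≠ ℓ j) :
    blockProd f ℓ (I ∪ J) q = blockProd f ℓ I q * blockProd f ℓ J q := by
  classical
  unfold blockProd
  have hd : Disjoint (I.image ℓ) (J.image ℓ) := by
    rw [Finset.disjoint_left]
    intro c hc hc'
    obtain ⟨i, hi, rfl⟩ := Finset.mem_image.1 hc
    obtain ⟨j, hj, hij⟩ := Finset.mem_image.1 hc'
    exact h i hi j hj hij.symm
  rw [Finset.image_union, Finset.prod_union hd]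
  congr 1
  · refine Finset.prod_congr rfl fun c hc => ?_
    obtain ⟨i, hi, rfl⟩ := Finset.mem_image.1 hc
    rw [Finset.filter_union, Finset.filter_false_of_mem fun j hj => (h i hi j hj).symm,
      Finset.union_empty]
  · refine Finset.prod_congr rfl fun c hc => ?_
    obtain ⟨j, hj, rfl⟩ := Finset.mem_image.1 hc
    rw [Finset.filter_union, Finset.filter_false_of_mem fun i hi => h i hi j hj,
      Finset.empty_union]

/-- A point may be removed if its weight is given to another point of its block. -/
lemma blockProd_insert [DecidableEq α] {a k : α} (ha : a ∉ I) (hk : k ∈ I) (hℓ : ℓ a = ℓ k) :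
    blockProd f ℓ (insert a I) q =
      blockProd f ℓ I (fun i => q i + if i = k then q a else 0) := by
  classical
  unfold blockProd
  rw [Finset.image_insert, Finset.insert_eq_of_mem (hℓ ▸ Finset.mem_image_of_mem ℓ hk)]
  refine Finset.prod_congr rfl fun c _ => ?_
  congr 1
  rw [Finset.sum_add_distrib, Finset.filter_insert, Finset.sum_ite_eq']
  by_cases h : ℓ a = c
  · rw [if_pos h, Finset.sum_insert (by simp [ha]), if_pos (by simp [hk, ← hℓ, h]), add_comm]
  · rw [if_neg h, if_neg (by simp [← hℓ, h]), add_zero]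

lemma blockProd_image {δ : Type*} [DecidableEq α] (e : δ → α) (he : Function.Injective e)
    (I : Finset δ) : blockProd f ℓ (I.image e) q = blockProd f (ℓ ∘ e) I (q ∘ e) := by
  classical
  unfold blockProd
  rw [Finset.image_image]
  refine Finset.prod_congr rfl fun c _ => ?_
  rw [Finset.filter_image, Finset.sum_image he.injOn]
  rfl

end Blocks

/-! ### Non-crossing pairings of an interval -/

/-- `π` is a non-crossing pairing of the interval `(a, b]` of natural numbers, extended by the
identity. Pairings of all intervals are maps of one type, so that pieces can be glued without
changing the index set. -/
structure NonCrossingOn (a b : ℕ) (π : ℕ → ℕ) : Prop where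
  fixed : ∀ i, ¬(a < i ∧ i ≤ b) → π i = i
  mem : ∀ i, a < i → i ≤ b → a < π i ∧ π i ≤ b
  invol : ∀ i, π (π i) = i
  ne : ∀ i, a < i → i ≤ b → π i ≠ i
  noncrossing : ∀ i j, a < i → i < j → j < π i → π i < π j → π j ≤ b → False

/-- The pairing which pairs `a + 1` with `k` and is given by `π₁` and `π₂` inside and outside. -/
def gluePairings (a k : ℕ) (π₁ π₂ : ℕ → ℕ) (i : ℕ) : ℕ :=
  if i = a + 1 then k else if i = k then a + 1 else if i < k then π₁ i else π₂ i

lemma NonCrossingOn.glue {a b k : ℕ} {π₁ π₂ : ℕ → ℕ} (hk : a + 1 < k) (hkb : k ≤ b)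
    (h₁ : NonCrossingOn (a + 1) (k - 1) π₁) (h₂ : NonCrossingOn k b π₂) :
    NonCrossingOn a b (gluePairings a k π₁ π₂) := by
  have m₁ := h₁.mem
  have m₂ := h₂.mem
  have e1 : gluePairings a k π₁ π₂ (a + 1) = k := by simp [gluePairings]
  have e2 : gluePairings a k π₁ π₂ k = a + 1 := by simp [gluePairings]
  have e3 : ∀ i, i < k → i ≠ a + 1 → gluePairings a k π₁ π₂ i = π₁ i := by
    intro i hi hi'; simp [gluePairings, hi, hi', hi.ne]
  have e4 : ∀ i, k < i → gluePairings a k π₁ π₂ i = π₂ i := by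
    intro i hi
    simp [gluePairings, show i ≠ a + 1 by omega, show i ≠ k by omega, show ¬ i < k by omega]
  have cases : ∀ i, i = a + 1 ∨ i = k ∨ (i < k ∧ i ≠ a + 1) ∨ k < i := by intro i; omega
  constructor
  · intro i hi
    rcases cases i with rfl | rfl | ⟨h, h'⟩ | h
    · omega
    · omega
    · rw [e3 i h h', h₁.fixed]; omega
    · rw [e4 i h, h₂.fixed]; omega
  · intro i hi hi'
    rcases cases i with rfl | rfl | ⟨h, h'⟩ | h
    · rw [e1]; omega
    · rw [e2]; omega
    · rw [e3 i h h']; have := m₁ i (by omega) (by omega); omega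
    · rw [e4 i h]; have := m₂ i h hi'; omega
  · intro i
    rcases cases i with rfl | rfl | ⟨h, h'⟩ | h
    · rw [e1, e2]
    · rw [e2, e1]
    · rw [e3 i h h']
      by_cases hi : a + 1 < i
      · have := m₁ i hi (by omega)
        rw [e3 _ (by omega) (by omega), h₁.invol]
      · rw [h₁.fixed i (by omega), e3 i h h', h₁.fixed i (by omega)]
    · rw [e4 i h]
      by_cases hi : i ≤ b
      · have := m₂ i h hi
        rw [e4 _ (by omega), h₂.invol]
      · rw [h₂.fixed i (by omega), e4 i h, h₂.fixed i (by omega)]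
  · intro i hi hi'
    rcases cases i with rfl | rfl | ⟨h, h'⟩ | h
    · rw [e1]; omega
    · rw [e2]; omega
    · rw [e3 i h h']; exact h₁.ne i (by omega) (by omega)
    · rw [e4 i h]; exact h₂.ne i h hi'
  · intro i j hi hij hj hj' hb
    rcases cases i with rfl | rfl | ⟨h, h'⟩ | h
    · rw [e1] at hj hj'
      rw [e3 j (by omega) (by omega)] at hj'
      have := m₁ j (by omega) (by omega)
      omega
    · rw [e2] at hj; omega
    · rw [e3 i h h'] at hj hj'
      have := m₁ i (by omega) (by omega)
      rw [e3 j (by omega) (by omega)] at hj'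
      have hj2 := m₁ j (by omega) (by omega)
      exact h₁.noncrossing i j (by omega) hij hj hj' (by omega)
    · rw [e4 i h] at hj hj'
      rw [e4 j (by omega)] at hj' hb
      exact h₂.noncrossing i j h hij hj hj' hb

/-- A non-crossing pairing falls apart into the pairings inside and outside of the first arc. -/
lemma NonCrossingOn.exists_glue {a b : ℕ} {π : ℕ → ℕ} (h : NonCrossingOn a b π) (hab : a < b) :
    ∃ k π₁ π₂, a + 1 < k ∧ k ≤ b ∧ NonCrossingOn (a + 1) (k - 1) π₁ ∧ NonCrossingOn k b π₂ ∧
      π = gluePairings a k π₁ π₂ := by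
  have hm := h.mem
  obtain ⟨k, hk⟩ : ∃ k, π (a + 1) = k := ⟨_, rfl⟩
  have hk' : π k = a + 1 := by rw [← hk, h.invol]
  have h1 := hm (a + 1) (by omega) (by omega)
  have h2 := h.ne (a + 1) (by omega) (by omega)
  rw [hk] at h1 h2
  have hin : ∀ i, a + 1 < i → i < k → a + 1 < π i ∧ π i < k := by
    intro i hi hi'
    have h3 := hm i (by omega) (by omega)
    have h4 : π i ≠ a + 1 := fun e => by have := h.invol i; rw [e, hk] at this; omega
    have h5 : π i ≠ k := fun e => by have := h.invol i; rw [e, hk'] at this; omega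
    have h6 := h.noncrossing (a + 1) i (by omega) hi (by omega)
    rw [hk] at h6
    by_contra hc
    exact h6 (by omega) h3.2
  have hout : ∀ i, k < i → i ≤ b → k < π i ∧ π i ≤ b := by
    intro i hi hi'
    have h3 := hm i (by omega) hi'
    have h4 : π i ≠ a + 1 := fun e => by have := h.invol i; rw [e, hk] at this; omega
    have h5 : π i ≠ k := fun e => by have := h.invol i; rw [e, hk'] at this; omega
    refine ⟨?_, h3.2⟩
    by_contra hc
    have h6 := hin (π i) (by omega) (by omega)
    rw [h.invol] at h6
    omega
  refine ⟨k, fun i => if a + 1 < i ∧ i < k then π i else i,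
    fun i => if k < i ∧ i ≤ b then π i else i, by omega, by omega, ?_, ?_, ?_⟩
  · have e : ∀ i, a + 1 < i → i < k → (if a + 1 < i ∧ i < k then π i else i) = π i :=
      fun i hi hi' => if_pos ⟨hi, hi'⟩
    constructor
    · intro i hi; exact if_neg (by omega)
    · intro i hi hi'
      have := hin i hi (by omega)
      simp only [e i hi (by omega)]; omega
    · intro i
      by_cases hi : a + 1 < i ∧ i < k
      · have := hin i hi.1 hi.2
        simp only [e i hi.1 hi.2, h.invol, if_pos this]
      · simp only [if_neg hi]
    · intro i hi hi'
      simp only [e i hi (by omega)]; exact h.ne i (by omega) (by omega)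
    · intro i j hi hij hj hj' hb
      by_cases hi' : i < k
      · simp only [e i hi hi'] at hj hj'
        have := hin i hi hi'
        simp only [e j (by omega) (by omega)] at hj' hb
        exact h.noncrossing i j (by omega) hij hj hj' (by omega)
      · simp only [if_neg (show ¬(a + 1 < i ∧ i < k) by omega)] at hj; omega
  · have e : ∀ i, k < i → i ≤ b → (if k < i ∧ i ≤ b then π i else i) = π i :=
      fun i hi hi' => if_pos ⟨hi, hi'⟩
    constructor
    · intro i hi; exact if_neg hi
    · intro i hi hi'
      simp only [e i hi hi']; exact hout i hi hi'
    · intro i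
      by_cases hi : k < i ∧ i ≤ b
      · have := hout i hi.1 hi.2
        simp only [e i hi.1 hi.2, h.invol, if_pos this]
      · simp only [if_neg hi]
    · intro i hi hi'
      simp only [e i hi hi']; exact h.ne i (by omega) (by omega)
    · intro i j hi hij hj hj' hb
      by_cases hi' : i ≤ b
      · simp only [e i hi hi'] at hj hj'
        have := hout i hi hi'
        simp only [e j (by omega) (by omega)] at hj' hb
        exact h.noncrossing i j (by omega) hij hj hj' hb
      · simp only [if_neg (show ¬(k < i ∧ i ≤ b) by omega)] at hj; omega
  · funext i
    rcases (by omega : i = a + 1 ∨ i = k ∨ (i < k ∧ i ≠ a + 1) ∨ k < i) with rfl | rfl | hi | hi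
    · simp [gluePairings, hk]
    · rw [hk', gluePairings, if_neg h2, if_pos rfl]
    · simp only [gluePairings, if_neg hi.2, if_neg hi.1.ne, if_pos hi.1]
      split_ifs with c
      · rfl
      · exact h.fixed i (by omega)
    · simp only [gluePairings, if_neg (show i ≠ a + 1 by omega), if_neg hi.ne',
        if_neg (show ¬ i < k by omega)]
      split_ifs with c
      · rfl
      · exact h.fixed i (by omega)

/-- The first arc and the pieces inside and outside of it are determined by the pairing. -/
lemma gluePairings_inj {a b k k' : ℕ} {π₁ π₂ π₁' π₂' : ℕ → ℕ}
    (hk : a + 1 < k) (h₁ : NonCrossingOn (a + 1) (k - 1) π₁) (h₂ : NonCrossingOn k b π₂)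
    (h₁' : NonCrossingOn (a + 1) (k' - 1) π₁') (h₂' : NonCrossingOn k' b π₂')
    (h : gluePairings a k π₁ π₂ = gluePairings a k' π₁' π₂') : k = k' ∧ π₁ = π₁' ∧ π₂ = π₂' := by
  have e : k = k' := by simpa [gluePairings] using congrFun h (a + 1)
  subst e
  refine ⟨rfl, funext fun i => ?_, funext fun i => ?_⟩
  · by_cases hi : a + 1 < i ∧ i ≤ k - 1
    · have := congrFun h i
      simpa [gluePairings, show i ≠ a + 1 by omega, show i ≠ k by omega,
        show i < k by omega] using this
    · rw [h₁.fixed i hi, h₁'.fixed i hi]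
  · by_cases hi : k < i ∧ i ≤ b
    · have := congrFun h i
      simpa [gluePairings, show i ≠ a + 1 by omega, show i ≠ k by omega,
        show ¬ i < k by omega] using this
    · rw [h₂.fixed i hi, h₂'.fixed i hi]

/-! ### The gaps of a pairing -/

/-- The gap `i` lies between the points `i` and `i + 1`; a pairing `π` of `(a, b]` connects the gap
before each point `p` with the gap after `π p`. -/
def gapSetoid (a b : ℕ) (π : ℕ → ℕ) : Setoid ℕ :=
  Relation.EqvGen.setoid fun i j => ∃ p, a < p ∧ p ≤ b ∧ i = p - 1 ∧ j = π p

/-- The class of a gap under the connections. -/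
def gapLabel (a b : ℕ) (π : ℕ → ℕ) (i : ℕ) : Quotient (gapSetoid a b π) := Quotient.mk _ i

lemma gapLabel_eq {a b p : ℕ} {π : ℕ → ℕ} (hp : a < p) (hp' : p ≤ b) :
    gapLabel a b π (p - 1) = gapLabel a b π (π p) :=
  Quotient.sound (Relation.EqvGen.rel _ _ ⟨p, hp, hp', rfl, rfl⟩)

/-- A map which is constant along the generating connections is constant on classes. -/
lemma gapLabel_lift {a b : ℕ} {π : ℕ → ℕ} {β : Type*} (L : ℕ → β)
    (h : ∀ p, a < p → p ≤ b → L (p - 1) = L (π p)) {i j : ℕ}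
    (hij : gapLabel a b π i = gapLabel a b π j) : L i = L j := by
  have : Relation.EqvGen (fun i j => ∃ p, a < p ∧ p ≤ b ∧ i = p - 1 ∧ j = π p) i j :=
    Quotient.exact hij
  induction this with
  | rel x y hxy => obtain ⟨p, hp, hp', rfl, rfl⟩ := hxy; exact h p hp hp'
  | refl x => rfl
  | symm x y h ih => exact (ih (Quotient.sound h)).symm
  | trans x y z h1 h2 ih1 ih2 => exact (ih1 (Quotient.sound h1)).trans (ih2 (Quotient.sound h2))

lemma gapLabel_glue_inner {a b k : ℕ} {π₁ π₂ : ℕ → ℕ} (hkb : k ≤ b) {i j : ℕ}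
    (h : gapLabel (a + 1) (k - 1) π₁ i = gapLabel (a + 1) (k - 1) π₁ j) :
    gapLabel a b (gluePairings a k π₁ π₂) i = gapLabel a b (gluePairings a k π₁ π₂) j := by
  refine gapLabel_lift _ (fun p hp hp' => ?_) h
  rw [gapLabel_eq (by omega) (by omega)]
  simp [gluePairings, show p ≠ a + 1 by omega, show p ≠ k by omega, show p < k by omega]

lemma gapLabel_glue_outer {a b k : ℕ} {π₁ π₂ : ℕ → ℕ} (hk : a + 1 < k) {i j : ℕ}
    (h : gapLabel k b π₂ i = gapLabel k b π₂ j) :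
    gapLabel a b (gluePairings a k π₁ π₂) i = gapLabel a b (gluePairings a k π₁ π₂) j := by
  refine gapLabel_lift _ (fun p hp hp' => ?_) h
  rw [gapLabel_eq (by omega) (by omega)]
  simp [gluePairings, show p ≠ a + 1 by omega, show p ≠ k by omega, show ¬ p < k by omega]

lemma gapLabel_glue_arc {a b k : ℕ} {π₁ π₂ : ℕ → ℕ} (hk : a + 1 < k) (hkb : k ≤ b) :
    gapLabel a b (gluePairings a k π₁ π₂) a = gapLabel a b (gluePairings a k π₁ π₂) k := by
  have := gapLabel_eq (a := a) (b := b) (p := a + 1) (π := gluePairings a k π₁ π₂)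
    (by omega) (by omega)
  simpa [gluePairings] using this

/-- The first and the last gap are connected. -/
lemma NonCrossingOn.gapLabel_first_eq_last {a b : ℕ} {π : ℕ → ℕ} (h : NonCrossingOn a b π)
    (hab : a ≤ b) : gapLabel a b π a = gapLabel a b π b := by
  induction hn : b - a using Nat.strong_induction_on generalizing a π with
  | _ n ih =>
  obtain rfl | hab := hab.eq_or_lt
  · rfl
  obtain ⟨k, π₁, π₂, hk, hkb, h₁, h₂, rfl⟩ := h.exists_glue hab
  exact (gapLabel_glue_arc hk hkb).trans
    (gapLabel_glue_outer hk (ih (b - k) (by omega) h₂ hkb rfl))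

/-- The product over the connected gaps factorizes along the first arc. -/
lemma blockProd_glue {f : ℕ → ℂ} {a b k : ℕ} {π₁ π₂ : ℕ → ℕ} (hk : a + 1 < k) (hkb : k ≤ b)
    (h₁ : NonCrossingOn (a + 1) (k - 1) π₁) (h₂ : NonCrossingOn k b π₂) (q : ℕ → ℕ) :
    blockProd f (gapLabel a b (gluePairings a k π₁ π₂)) (Finset.Icc a b) q =
      blockProd f (gapLabel (a + 1) (k - 1) π₁) (Finset.Icc (a + 1) (k - 1)) q *
        blockProd f (gapLabel k b π₂) (Finset.Icc k b)
          (fun i => q i + if i = k then q a else 0) := by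
  set R := gapLabel a b (gluePairings a k π₁ π₂)
  let L : ℕ → Quotient (gapSetoid (a + 1) (k - 1) π₁) ⊕ Quotient (gapSetoid k b π₂) := fun i =>
    if i = a then Sum.inr (gapLabel k b π₂ k)
    else if i < k then Sum.inl (gapLabel (a + 1) (k - 1) π₁ i) else Sum.inr (gapLabel k b π₂ i)
  have L1 : L a = Sum.inr (gapLabel k b π₂ k) := if_pos rfl
  have L2 : ∀ i, i ≠ a → i < k → L i = Sum.inl (gapLabel (a + 1) (k - 1) π₁ i) := by
    intro i hi hi'; simp [L, hi, hi']
  have L3 : ∀ i, k ≤ i → L i = Sum.inr (gapLabel k b π₂ i) := by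
    intro i hi; simp [L, show i ≠ a by omega, show ¬ i < k by omega]
  have hRL : ∀ i j, R i = R j → L i = L j := by
    intro i j hij
    refine gapLabel_lift L (fun p hp hp' => ?_) hij
    rcases (by omega : p = a + 1 ∨ p = k ∨ (a + 1 < p ∧ p < k) ∨ k < p) with rfl | rfl | h | h
    · simp [gluePairings, L1, L3 k le_rfl]
    · rw [show gluePairings a p π₁ π₂ p = a + 1 by simp [gluePairings],
        L2 _ (by omega) (by omega), L2 _ (by omega) (by omega),
        h₁.gapLabel_first_eq_last (by omega)]
    · have := h₁.mem p h.1 (by omega)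
      rw [show gluePairings a k π₁ π₂ p = π₁ p by
          simp [gluePairings, show p ≠ a + 1 by omega, show p ≠ k by omega, h.2],
        L2 _ (by omega) (by omega), L2 _ (by omega) (by omega), gapLabel_eq h.1 (by omega)]
    · have := h₂.mem p h hp'
      rw [show gluePairings a k π₁ π₂ p = π₂ p by
          simp [gluePairings, show p ≠ a + 1 by omega, show p ≠ k by omega,
            show ¬ p < k by omega],
        L3 _ (by omega), L3 _ (by omega), gapLabel_eq h hp']
  have hka : R a = R k := gapLabel_glue_arc hk hkb
  have hLR : ∀ i, a ≤ i → ∀ j, a ≤ j → L i = L j → R i = R j := by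
    have key : ∀ i, a < i → ∀ j, a < j → L i = L j → R i = R j := by
      intro i hi j hj hij
      by_cases h1 : i < k <;> by_cases h2 : j < k
      · rw [L2 i (by omega) h1, L2 j (by omega) h2] at hij
        exact gapLabel_glue_inner hkb (Sum.inl.inj hij)
      · rw [L2 i (by omega) h1, L3 j (by omega)] at hij; cases hij
      · rw [L3 i (by omega), L2 j (by omega) h2] at hij; cases hij
      · rw [L3 i (by omega), L3 j (by omega)] at hij
        exact gapLabel_glue_outer hk (Sum.inr.inj hij)
    have hLk : L a = L k := by rw [L1, L3 k le_rfl]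
    intro i hi j hj hij
    obtain rfl | hi := hi.eq_or_lt
    · obtain rfl | hj := hj.eq_or_lt
      · rfl
      · exact hka.trans (key k (by omega) j hj (hLk.symm.trans hij))
    · obtain rfl | hj := hj.eq_or_lt
      · exact (key i hi k (by omega) (hij.trans hLk)).trans hka.symm
      · exact key i hi j hj hij
  have e1 : blockProd f R (Finset.Icc a b) q = blockProd f L (Finset.Icc a b) q :=
    blockProd_congr (fun i hi j hj => ⟨hRL i j,
      hLR i (Finset.mem_Icc.1 hi).1 j (Finset.mem_Icc.1 hj).1⟩) fun _ _ => rfl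
  have e2 : Finset.Icc a b = insert a (Finset.Icc (a + 1) (k - 1) ∪ Finset.Icc k b) := by
    ext i; simp only [Finset.mem_Icc, Finset.mem_insert, Finset.mem_union]; omega
  rw [e1, e2, blockProd_insert (k := k) (by simp; omega) (by simp; omega)
    (by rw [L1, L3 k le_rfl]), blockProd_union]
  · congr 1
    · refine blockProd_congr (fun i hi j hj => ?_) fun i hi => ?_
      · rw [Finset.mem_Icc] at hi hj
        rw [L2 i (by omega) (by omega), L2 j (by omega) (by omega), Sum.inl.injEq]
      · rw [Finset.mem_Icc] at hi
        rw [if_neg (by omega), add_zero]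
    · refine blockProd_congr (fun i hi j hj => ?_) fun i hi => rfl
      rw [Finset.mem_Icc] at hi hj
      rw [L3 i (by omega), L3 j (by omega), Sum.inr.injEq]
  · intro i hi j hj
    rw [Finset.mem_Icc] at hi hj
    rw [L2 i (by omega) (by omega), L3 j (by omega)]
    exact Sum.inl_ne_inr

/-- The sum over the non-crossing pairings of an interval is characterized by the recursion which
removes the arc of the first point. -/
lemma exists_sum_nonCrossing {f : ℕ → ℂ} {g : ℕ → ℕ → (ℕ → ℕ) → ℂ} (h0 : ∀ a q, g a a q = f (q a))
    (h1 : ∀ a b q, a < b → g a b q = ∑ k ∈ Finset.Ioc (a + 1) b,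
      g (a + 1) (k - 1) q * g k b (fun i => q i + if i = k then q a else 0))
    (a b : ℕ) (hab : a ≤ b) :
    ∃ S : Finset (ℕ → ℕ), (∀ π, π ∈ S ↔ NonCrossingOn a b π) ∧
      ∀ q, ∑ π ∈ S, blockProd f (gapLabel a b π) (Finset.Icc a b) q = g a b q := by
  classical
  induction hn : b - a using Nat.strong_induction_on generalizing a b with
  | _ n ih =>
  obtain rfl | hab := hab.eq_or_lt
  · refine ⟨{id}, fun π => ?_, fun q => ?_⟩
    · rw [Finset.mem_singleton]
      refine ⟨?_, fun h => funext fun i => h.fixed i (by omega)⟩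
      rintro rfl
      constructor <;> intros <;> first | rfl | (simp only [id] at *; omega)
    · simp [blockProd, h0, Finset.filter_true_of_mem]
  have H₁ : ∀ k, ∃ S : Finset (ℕ → ℕ), k ∈ Finset.Ioc (a + 1) b →
      (∀ π, π ∈ S ↔ NonCrossingOn (a + 1) (k - 1) π) ∧
      ∀ q, ∑ π ∈ S, blockProd f (gapLabel (a + 1) (k - 1) π) (Finset.Icc (a + 1) (k - 1)) q =
        g (a + 1) (k - 1) q := by
    intro k
    by_cases hk : k ∈ Finset.Ioc (a + 1) b
    · have hk' := Finset.mem_Ioc.1 hk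
      obtain ⟨S, hS⟩ := ih (k - 1 - (a + 1)) (by omega) (a + 1) (k - 1) (by omega) rfl
      exact ⟨S, fun _ => hS⟩
    · exact ⟨∅, fun h => absurd h hk⟩
  have H₂ : ∀ k, ∃ S : Finset (ℕ → ℕ), k ∈ Finset.Ioc (a + 1) b →
      (∀ π, π ∈ S ↔ NonCrossingOn k b π) ∧
      ∀ q, ∑ π ∈ S, blockProd f (gapLabel k b π) (Finset.Icc k b) q = g k b q := by
    intro k
    by_cases hk : k ∈ Finset.Ioc (a + 1) b
    · have hk' := Finset.mem_Ioc.1 hk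
      obtain ⟨S, hS⟩ := ih (b - k) (by omega) k b (by omega) rfl
      exact ⟨S, fun _ => hS⟩
    · exact ⟨∅, fun h => absurd h hk⟩
  choose S₁ hS₁ using H₁
  choose S₂ hS₂ using H₂
  let D := (Finset.Ioc (a + 1) b).sigma fun k => S₁ k ×ˢ S₂ k
  let G : (Σ _ : ℕ, (ℕ → ℕ) × (ℕ → ℕ)) → ℕ → ℕ := fun t => gluePairings a t.1 t.2.1 t.2.2
  have hD : ∀ t ∈ D, a + 1 < t.1 ∧ t.1 ≤ b ∧ NonCrossingOn (a + 1) (t.1 - 1) t.2.1 ∧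
      NonCrossingOn t.1 b t.2.2 := by
    intro t ht
    rw [Finset.mem_sigma, Finset.mem_product] at ht
    have h := Finset.mem_Ioc.1 ht.1
    exact ⟨h.1, h.2, ((hS₁ _ ht.1).1 _).1 ht.2.1, ((hS₂ _ ht.1).1 _).1 ht.2.2⟩
  have hinj : Set.InjOn G D := by
    rintro ⟨k, π₁, π₂⟩ ht ⟨k', π₁', π₂'⟩ ht' he
    obtain ⟨a1, a2, a3, a4⟩ := hD _ ht
    obtain ⟨b1, b2, b3, b4⟩ := hD _ ht'
    obtain ⟨rfl, rfl, rfl⟩ := gluePairings_inj a1 a3 a4 b3 b4 he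
    rfl
  refine ⟨D.image G, fun π => ?_, fun q => ?_⟩
  · rw [Finset.mem_image]
    constructor
    · rintro ⟨t, ht, rfl⟩
      obtain ⟨a1, a2, a3, a4⟩ := hD _ ht
      exact a3.glue a1 a2 a4
    · intro h
      obtain ⟨k, π₁, π₂, hk, hkb, h₁, h₂, rfl⟩ := h.exists_glue hab
      have hk' : k ∈ Finset.Ioc (a + 1) b := Finset.mem_Ioc.2 ⟨hk, hkb⟩
      refine ⟨⟨k, π₁, π₂⟩, Finset.mem_sigma.2 ⟨hk', Finset.mem_product.2
        ⟨((hS₁ _ hk').1 _).2 h₁, ((hS₂ _ hk').1 _).2 h₂⟩⟩, rfl⟩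
  · rw [Finset.sum_image hinj, h1 a b q hab, Finset.sum_sigma]
    refine Finset.sum_congr rfl fun k hk => ?_
    rw [← (hS₁ k hk).2, ← (hS₂ k hk).2, Finset.sum_mul_sum, Finset.sum_product]
    refine Finset.sum_congr rfl fun π₁ hπ₁ => Finset.sum_congr rfl fun π₂ hπ₂ => ?_
    have hk' := Finset.mem_Ioc.1 hk
    exact blockProd_glue hk'.1 hk'.2 (((hS₁ k hk).1 _).1 hπ₁) (((hS₂ k hk).1 _).1 hπ₂) q

section Pairings

local notation "𝕩" => FreeAlgebra.ι ℂ false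
local notation "𝕪" => FreeAlgebra.ι ℂ true

/-! ### The Schwinger-Dyson recursion for words and non-crossing pairings -/

/-- The word `Y ^ q a * (X * Y ^ q (a + 1)) * ⋯ * (X * Y ^ q b)`. -/
noncomputable def gapWord (q : ℕ → ℕ) (a b : ℕ) : FreeAlgebra ℂ Bool :=
  𝕪 ^ q a * ((List.range' (a + 1) (b - a)).map fun i => 𝕩 * 𝕪 ^ q i).prod

lemma gapWord_self (q : ℕ → ℕ) (a : ℕ) : gapWord q a a = 𝕪 ^ q a := by simp [gapWord]

lemma gapWord_of_lt (q : ℕ → ℕ) {a b : ℕ} (h : a < b) :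
    gapWord q a b = 𝕪 ^ q a * (𝕩 * gapWord q (a + 1) b) := by
  rw [gapWord, gapWord, show b - a = (b - (a + 1)) + 1 by omega, List.range'_succ, List.map_cons,
    List.prod_cons, mul_assoc 𝕩]

/-- The terms of `∂` correspond to the letters `X` of the word. -/
lemma freeDiff_gapWord (q : ℕ → ℕ) {a b : ℕ} (h : a ≤ b) :
    freeDiff (gapWord q a b) =
      ∑ k ∈ Finset.Ioc a b, gapWord q a (k - 1) ⊗ₜ[ℂ] gapWord q k b := by
  induction hn : b - a generalizing a with
  | zero =>
    obtain rfl : a = b := by omega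
    have := freeDiff_aeval_Y (Polynomial.X ^ q a)
    rw [map_pow, Polynomial.aeval_X] at this
    simp [gapWord_self, this]
  | succ n ih =>
    have hy := freeDiff_aeval_Y (Polynomial.X ^ q a)
    rw [map_pow, Polynomial.aeval_X] at hy
    have hI : Finset.Ioc a b = insert (a + 1) (Finset.Ioc (a + 1) b) := by
      ext i; simp only [Finset.mem_Ioc, Finset.mem_insert]; omega
    rw [gapWord_of_lt q (by omega), freeDiff_mul, hy, freeDiff_mul, freeDiff_ι,
      ih (by omega) (by omega), hI, Finset.sum_insert (by simp), Finset.mul_sum]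
    simp only [Bool.false_eq_true, if_false, one_mul, zero_mul, add_zero, mul_add,
      Finset.mul_sum, Algebra.TensorProduct.tmul_mul_tmul, mul_one]
    rw [add_comm, add_tsub_cancel_right, gapWord_self]
    congr 1
    refine Finset.sum_congr rfl fun k hk => ?_
    rw [gapWord_of_lt q (a := a) (b := k - 1) (by simp at hk; omega)]

lemma gapWord_congr {q q' : ℕ → ℕ} {a b : ℕ} (h : ∀ i, a < i → i ≤ b → q i = q' i) (m : ℕ)
    (ha : q' a = m + q a) : gapWord q' a b = 𝕪 ^ m * gapWord q a b := by
  rw [gapWord, gapWord, ha, pow_add, mul_assoc]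
  congr 3
  refine List.map_congr_left fun i hi => ?_
  rw [List.mem_range'_1] at hi
  rw [h i (by omega) (by omega)]

variable {φ : FreeAlgebra ℂ Bool →ₗ[ℂ] ℂ}

/-- The recursion for `φ` over the partner `k` of the first letter `X`: the word between the two
letters splits off, and the power of `Y` in front of the first letter moves to the gap after `k`.
-/
lemma IsSchwingerDyson.map_gapWord (hφ : IsSchwingerDyson φ) (q : ℕ → ℕ) {a b : ℕ} (h : a < b) :
    φ (gapWord q a b) = ∑ k ∈ Finset.Ioc (a + 1) b, φ (gapWord q (a + 1) (k - 1)) *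
      φ (gapWord (fun i => q i + if i = k then q a else 0) k b) := by
  have hy := freeDiff_aeval_Y (Polynomial.X ^ q a)
  rw [map_pow, Polynomial.aeval_X] at hy
  rw [gapWord_of_lt q h, hφ.map_mul_comm, mul_assoc, hφ.map_X_mul, freeDiff_mul, hy, mul_zero,
    zero_add, freeDiff_gapWord q (by omega), Finset.sum_mul, map_sum]
  refine Finset.sum_congr rfl fun k hk => ?_
  have e : gapWord (fun i => q i + if i = k then q a else 0) k b = 𝕪 ^ q a * gapWord q k b :=
    gapWord_congr (fun i hi _ => by simp [hi.ne']) (q a) (by simp [add_comm])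
  rw [Algebra.TensorProduct.tmul_mul_tmul, mul_one, tensorSq_tmul, hφ.map_mul_comm (gapWord q k b),
    e]

/-! ### Cycles of a permutation and gaps of a pairing -/

/-- The product of powers of `y` along the cycle through `k` collects the exponents of the cycle. -/
lemma cycleProd_pow {A : Type*} [Ring A] {n : ℕ} (σ : Equiv.Perm (Fin n)) (y : A) (q : Fin n → ℕ)
    (k : Fin n) [DecidableRel σ.SameCycle] :
    cycleProd σ (fun i => y ^ q i) k = y ^ ∑ l with σ.SameCycle l k, q l := by
  have hpos : 0 < Function.minimalPeriod σ k :=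
    Function.minimalPeriod_pos_of_mem_periodicPts
      (Function.Injective.mem_periodicPts σ.injective k)
  have hsum : ∑ l with σ.SameCycle l k, q l =
      ∑ j ∈ Finset.range (Function.minimalPeriod σ k), q ((σ ^ j) k) := by
    symm
    refine Finset.sum_bij (fun j _ => (σ ^ j) k) ?_ ?_ ?_ ?_
    · intro j _
      simp only [Finset.mem_filter, Finset.mem_univ, true_and]
      exact (Equiv.Perm.sameCycle_pow_left).2 (Equiv.Perm.SameCycle.refl _ _)
    · intro i hi j hj hij
      rw [Equiv.Perm.coe_pow, Equiv.Perm.coe_pow] at hij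
      exact Function.iterate_injOn_Iio_minimalPeriod (Finset.mem_range.1 hi)
        (Finset.mem_range.1 hj) hij
    · intro l hl
      obtain ⟨i, hi⟩ := (Finset.mem_filter.1 hl).2.symm.exists_nat_pow_eq
      refine ⟨i % Function.minimalPeriod σ k, Finset.mem_range.2 (Nat.mod_lt _ hpos), ?_⟩
      rw [← hi, Equiv.Perm.coe_pow, Equiv.Perm.coe_pow, Function.iterate_mod_minimalPeriod_eq]
    · intro j _; rfl
  rw [hsum, cycleProd]
  generalize Function.minimalPeriod σ k = m
  induction m with
  | zero => simp
  | succ m ih =>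
    rw [List.range_succ, List.map_append, List.prod_append, ih, Finset.sum_range_succ, pow_add]
    simp

/-- The product of the moments of `y` over the cycles of `σ`. -/
lemma cycleExpectation_pow {A β : Type*} [Ring A] (τ : A → ℂ) {n : ℕ} {σ : Equiv.Perm (Fin n)}
    {ℓ : Fin n → β} (hℓ : ∀ i j, σ.SameCycle i j ↔ ℓ i = ℓ j) (y : A) (q : Fin n → ℕ) :
    cycleExpectation τ σ (fun i => y ^ q i) =
      blockProd (fun m => τ (y ^ m)) ℓ Finset.univ q := by
  classical
  unfold cycleExpectation blockProd
  refine Finset.prod_bij (fun k _ => ℓ k) ?_ ?_ ?_ ?_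
  · intro k _; exact Finset.mem_image_of_mem _ (Finset.mem_univ _)
  · intro k hk l hl hkl
    have h : σ.SameCycle k l := (hℓ _ _).2 hkl
    exact le_antisymm ((Finset.mem_filter.1 hk).2 l h) ((Finset.mem_filter.1 hl).2 k h.symm)
  · intro c hc
    obtain ⟨i, _, rfl⟩ := Finset.mem_image.1 hc
    have hne : (Finset.univ.filter fun l => σ.SameCycle i l).Nonempty :=
      ⟨i, Finset.mem_filter.2 ⟨Finset.mem_univ _, Equiv.Perm.SameCycle.refl _ _⟩⟩
    have hm := Finset.min'_mem _ hne
    refine ⟨_, Finset.mem_filter.2 ⟨Finset.mem_univ _, fun l hl => Finset.min'_le _ l ?_⟩,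
      (hℓ _ _).1 (Finset.mem_filter.1 hm).2.symm⟩
    exact Finset.mem_filter.2 ⟨Finset.mem_univ _, (Finset.mem_filter.1 hm).2.trans hl⟩
  · intro k _
    rw [cycleProd_pow]
    simp only [hℓ]

/-- A permutation of `Fin n` as a map of the interval `(0, n]` of natural numbers. -/
def shiftPerm {n : ℕ} (π : Equiv.Perm (Fin n)) (i : ℕ) : ℕ :=
  if h : 0 < i ∧ i ≤ n then π ⟨i - 1, by omega⟩ + 1 else i

lemma shiftPerm_succ {n : ℕ} (π : Equiv.Perm (Fin n)) (i : Fin n) :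
    shiftPerm π (i + 1) = π i + 1 := by
  rw [shiftPerm, dif_pos ⟨by omega, i.2⟩]; rfl

lemma shiftPerm_injective {n : ℕ} :
    Function.Injective (shiftPerm : Equiv.Perm (Fin n) → ℕ → ℕ) := by
  intro π π' h
  ext i
  have := congrFun h (i + 1)
  rw [shiftPerm_succ, shiftPerm_succ] at this
  omega

lemma exists_fin_succ {n i : ℕ} (h : 0 < i) (h' : i ≤ n) : ∃ k : Fin n, i = k + 1 :=
  ⟨⟨i - 1, by omega⟩, by simp; omega⟩

lemma nonCrossingOn_shiftPerm {n : ℕ} {π : Equiv.Perm (Fin n)} (h : IsNonCrossingPairing π) :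
    NonCrossingOn 0 n (shiftPerm π) := by
  obtain ⟨h1, h2, h3⟩ := h
  refine ⟨fun i hi => dif_neg hi, ?_, ?_, ?_, ?_⟩
  · intro i hi hi'
    obtain ⟨k, rfl⟩ := exists_fin_succ hi hi'
    rw [shiftPerm_succ]; omega
  · intro i
    by_cases hi : 0 < i ∧ i ≤ n
    · obtain ⟨k, rfl⟩ := exists_fin_succ hi.1 hi.2
      rw [shiftPerm_succ, shiftPerm_succ, h1]
    · have : shiftPerm π i = i := dif_neg hi
      rw [this, this]
  · intro i hi hi' he
    obtain ⟨k, rfl⟩ := exists_fin_succ hi hi'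
    rw [shiftPerm_succ] at he
    exact h2 k (Fin.ext (by omega))
  · intro i j hi hij hj hj' hn
    have hjn : ¬ n < j := fun hc => by
      have : shiftPerm π j = j := dif_neg (by omega)
      omega
    obtain ⟨k, rfl⟩ := exists_fin_succ hi (by omega : i ≤ n)
    obtain ⟨l, rfl⟩ := exists_fin_succ (by omega) (by omega : j ≤ n)
    rw [shiftPerm_succ] at hj hj'
    rw [shiftPerm_succ] at hj'
    exact h3 ⟨k, l, π k, π l, by omega, by omega, by omega, rfl, rfl⟩

lemma exists_shiftPerm {n : ℕ} {π : ℕ → ℕ} (h : NonCrossingOn 0 n π) :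
    ∃ π' : Equiv.Perm (Fin n), IsNonCrossingPairing π' ∧ shiftPerm π' = π := by
  have hm : ∀ i : Fin n, 0 < π (i + 1) ∧ π (i + 1) ≤ n := fun i => h.mem _ (by omega) i.2
  let g : Fin n → Fin n := fun i => ⟨π (i + 1) - 1, by have := hm i; omega⟩
  have hg : ∀ i, (g i : ℕ) + 1 = π (i + 1) := fun i => by have := hm i; simp [g]; omega
  have hgi : Function.Involutive g := fun i => Fin.ext (by
    have := hg (g i)
    rw [hg i, h.invol] at this
    omega)
  refine ⟨hgi.toPerm, ⟨hgi, fun i hi => ?_, ?_⟩, funext fun i => ?_⟩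
  · have := hg i
    rw [show g i = i from hi] at this
    exact h.ne (i + 1) (by omega) i.2 this.symm
  · rintro ⟨a, b, c, d, hab, hbc, hcd, rfl, rfl⟩
    have ha := hg a
    have hb := hg b
    simp only [Function.Involutive.coe_toPerm, Fin.lt_def] at hab hbc hcd
    refine h.noncrossing (a + 1) (b + 1) (by omega) (by omega) (by omega) (by omega) (hm b).2
  · by_cases hi : 0 < i ∧ i ≤ n
    · obtain ⟨k, rfl⟩ := exists_fin_succ hi.1 hi.2
      rw [shiftPerm_succ]; exact hg k
    · rw [h.fixed i hi]; exact dif_neg hi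

/-- The cycles of `π γ` are the classes of connected gaps of the pairing `π`. -/
lemma sameCycle_iff_gapLabel {n : ℕ} {π : Equiv.Perm (Fin n)} (h : IsNonCrossingPairing π)
    (i j : Fin n) : (π * finRotate n).SameCycle i j ↔
      gapLabel 0 n (shiftPerm π) (i + 1) = gapLabel 0 n (shiftPerm π) (j + 1) := by
  obtain _ | m := n
  · exact i.elim0
  constructor
  · have key : ∀ i : Fin (m + 1), gapLabel 0 (m + 1) (shiftPerm π) (i + 1) =
        gapLabel 0 (m + 1) (shiftPerm π) ((π * finRotate (m + 1)) i + 1) := by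
      intro i
      rw [Equiv.Perm.mul_apply]
      by_cases hi : i = Fin.last m
      · have h0 := gapLabel_eq (a := 0) (b := m + 1) (p := 1) (π := shiftPerm π)
          (by omega) (by omega)
        have h1 : shiftPerm π 1 = π 0 + 1 := shiftPerm_succ π 0
        rw [hi, finRotate_last, ← h1, ← h0]
        exact ((nonCrossingOn_shiftPerm h).gapLabel_first_eq_last (by omega)).symm
      · have hi' := coe_finRotate_of_ne_last hi
        have h0 := gapLabel_eq (a := 0) (b := m + 1) (p := finRotate (m + 1) i + 1)
          (π := shiftPerm π) (by omega) (by omega)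
        rw [shiftPerm_succ, add_tsub_cancel_right, hi'] at h0
        exact h0
    intro hij
    obtain ⟨k, rfl⟩ := hij.exists_nat_pow_eq
    clear hij
    induction k with
    | zero => rfl
    | succ k ih => rw [pow_succ', Equiv.Perm.mul_apply, ← key]; exact ih
  · intro hij
    let idx : ℕ → Fin (m + 1) := fun k =>
      if h : 0 < k ∧ k ≤ m + 1 then ⟨k - 1, by omega⟩ else Fin.last m
    have hidx : ∀ k : Fin (m + 1), idx (k + 1) = k := fun k => by
      simp only [idx]; rw [dif_pos ⟨by omega, k.2⟩]; rfl
    have hrot : ∀ k : Fin (m + 1), finRotate (m + 1) (idx k) = k := by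
      intro k
      obtain ⟨k, hk⟩ := k
      obtain _ | k := k
      · simp [idx]
      · have h1 : idx (k + 1) = ⟨k, by omega⟩ := hidx ⟨k, by omega⟩
        refine Fin.ext ?_
        simp only [h1]
        rw [coe_finRotate_of_ne_last]
        intro hc
        have := congrArg Fin.val hc
        simp at this
        omega
    have := gapLabel_lift (a := 0) (b := m + 1) (π := shiftPerm π)
      (fun k => (Quotient.mk (Equiv.Perm.SameCycle.setoid (π * finRotate (m + 1))) (idx k)))
      (fun p hp hp' => by
        obtain ⟨k, rfl⟩ := exists_fin_succ hp hp'
        rw [shiftPerm_succ, hidx, add_tsub_cancel_right]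
        refine Quotient.sound ?_
        have h2 : π k = (π * finRotate (m + 1)) (idx k) := by
          rw [Equiv.Perm.mul_apply, hrot]
        rw [h2]
        exact (Equiv.Perm.sameCycle_apply_right).2 (Equiv.Perm.SameCycle.refl _ _)) hij
    simp only [hidx] at this
    exact Quotient.exact this

/-- The mixed moments of a functional which satisfies the Schwinger-Dyson equation are sums over
non-crossing pairings. -/
theorem IsSchwingerDyson.map_prod_eq_sum (hφ : IsSchwingerDyson φ) {A : Type*} [Ring A]
    (τ : A → ℂ) (y : A) (hy : ∀ k, φ (𝕪 ^ k) = τ (y ^ k)) (n : ℕ) (q : Fin n → ℕ) :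
    φ (List.ofFn fun k => 𝕩 * 𝕪 ^ q k).prod =
      ∑ π ∈ nonCrossingPairings n, cycleExpectation τ (π * finRotate n) fun k => y ^ q k := by
  classical
  obtain rfl | hn := n.eq_zero_or_pos
  · have h1 : nonCrossingPairings 0 = {1} := by
      refine Finset.eq_singleton_iff_unique_mem.2 ⟨?_, fun _ _ => Subsingleton.elim _ _⟩
      refine Finset.mem_filter.2 ⟨Finset.mem_univ _, fun k => k.elim0, fun k => k.elim0, ?_⟩
      rintro ⟨a, _⟩
      exact a.elim0
    rw [h1, Finset.sum_singleton]
    simp [cycleExpectation, hφ.map_one]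
  -- the word is read on the interval `(0, n]`, with the empty power in the gap `0`
  let q' : ℕ → ℕ := fun i => if h : 0 < i ∧ i ≤ n then q ⟨i - 1, by omega⟩ else 0
  have hq' : ∀ k : Fin n, q' (k + 1) = q k := fun k => by
    simp only [q']; rw [dif_pos ⟨by omega, k.2⟩]; rfl
  have hq0 : q' 0 = 0 := by simp [q']
  obtain ⟨S, hS, hsum⟩ := exists_sum_nonCrossing (f := fun m => τ (y ^ m))
    (g := fun a b q => φ (gapWord q a b)) (fun a q => by rw [gapWord_self, hy])
    (fun a b q h => hφ.map_gapWord q h) 0 n (by omega)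
  have hword : (List.ofFn fun k => 𝕩 * 𝕪 ^ q k).prod = gapWord q' 0 n := by
    rw [gapWord, hq0, pow_zero, one_mul]
    congr 1
    refine List.ext_getElem (by simp) fun i h1 h2 => ?_
    have hi : i < n := by simpa using h1
    have := hq' ⟨i, hi⟩
    simp only [List.getElem_ofFn, List.getElem_map, List.getElem_range', ← this]
    rw [zero_add, one_mul, add_comm]
  rw [hword, ← hsum]
  symm
  refine Finset.sum_bij (fun π _ => shiftPerm π) ?_ ?_ ?_ ?_
  · intro π hπ
    exact (hS _).2 (nonCrossingOn_shiftPerm (Finset.mem_filter.1 hπ).2)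
  · intro π _ π' _ h
    exact shiftPerm_injective h
  · intro π hπ
    obtain ⟨π', h, rfl⟩ := exists_shiftPerm ((hS _).1 hπ)
    exact ⟨π', Finset.mem_filter.2 ⟨Finset.mem_univ _, h⟩, rfl⟩
  · intro π hπ
    have h := (Finset.mem_filter.1 hπ).2
    have h0 : Finset.Icc 0 n = insert 0 (Finset.univ.image fun k : Fin n => (k : ℕ) + 1) := by
      ext i
      simp only [Finset.mem_Icc, Finset.mem_insert, Finset.mem_image, Finset.mem_univ, true_and]
      constructor
      · intro hi
        rcases i.eq_zero_or_pos with h | h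
        · exact Or.inl h
        · obtain ⟨k, rfl⟩ := exists_fin_succ h hi.2
          exact Or.inr ⟨k, rfl⟩
      · rintro (rfl | ⟨k, rfl⟩) <;> omega
    rw [cycleExpectation_pow _ (sameCycle_iff_gapLabel h), h0, blockProd_insert (k := n) (by simp)
      (Finset.mem_image.2 ⟨⟨n - 1, by omega⟩, Finset.mem_univ _, by simp; omega⟩)
      ((nonCrossingOn_shiftPerm h).gapLabel_first_eq_last (by omega)),
      blockProd_image _ (fun i j hij => Fin.ext (by simpa using hij))]
    exact blockProd_congr (fun _ _ _ _ => Iff.rfl) fun i _ => by simp [hq0, hq']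

end Pairings

/-! ### Moments and weak convergence -/

section Clamp

/-- The projection of the line onto `[-R, R]`. -/
noncomputable def clamp (R t : ℝ) : ℝ := max (-R) (min R t)

lemma continuous_clamp (R : ℝ) : Continuous (clamp R) := by unfold clamp; fun_prop

lemma abs_clamp_le {R : ℝ} (hR : 0 ≤ R) (t : ℝ) : |clamp R t| ≤ R :=
  abs_le.2 ⟨le_max_left _ _, max_le (by linarith) (min_le_left _ _)⟩

lemma abs_clamp_le_abs {R : ℝ} (hR : 0 ≤ R) (t : ℝ) : |clamp R t| ≤ |t| := by
  refine abs_le.2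
    ⟨?_, max_le (by linarith [abs_nonneg t]) ((min_le_right _ _).trans (le_abs_self t))⟩
  exact le_max_of_le_right (le_min (by linarith [abs_nonneg t]) (neg_abs_le t))

lemma clamp_of_abs_le {R t : ℝ} (h : |t| ≤ R) : clamp R t = t := by
  rw [abs_le] at h
  rw [clamp, min_eq_right h.2, max_eq_right h.1]

lemma clamp_eq_self_iff {R t : ℝ} (hR : 0 ≤ R) : clamp R t = t ↔ |t| ≤ R :=
  ⟨fun h => h ▸ abs_clamp_le hR t, clamp_of_abs_le⟩

/-- The projection onto `[-R, R]` as a bounded continuous function. -/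
noncomputable def clampBCF (R : ℝ) (hR : 0 ≤ R) : ℝ →ᵇ ℝ :=
  BoundedContinuousFunction.ofNormedAddCommGroup (clamp R) (continuous_clamp R) R (abs_clamp_le hR)

end Clamp

lemma integrable_pow_of_compl_Icc {μ : Measure ℝ} [IsFiniteMeasure μ] {R : ℝ}
    (h : μ (Set.Icc (-R) R)ᶜ = 0) (p : Polynomial ℝ) : Integrable (fun t => p.eval t) μ := by
  obtain ⟨B, hB⟩ := (isCompact_Icc (a := -R) (b := R)).exists_bound_of_continuousOn
    p.continuous.continuousOn
  refine Integrable.of_bound p.continuous.aestronglyMeasurable B ?_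
  filter_upwards [measure_eq_zero_iff_ae_notMem.1 h] with t ht
  exact hB t (by simpa using ht)

/-- A probability measure on a compact interval is determined by its moments: polynomials are dense
in the continuous functions on the interval. -/
lemma ext_of_moments {μ ν : Measure ℝ} [IsProbabilityMeasure μ] [IsProbabilityMeasure ν]
    {R : ℝ} (hμ : μ (Set.Icc (-R) R)ᶜ = 0) (hν : ν (Set.Icc (-R) R)ᶜ = 0)
    (h : ∀ n : ℕ, ∫ t, t ^ n ∂μ = ∫ t, t ^ n ∂ν) : μ = ν := by
  have hpoly : ∀ p : Polynomial ℝ, ∫ t, p.eval t ∂μ = ∫ t, p.eval t ∂ν := by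
    intro p
    have key : ∀ (ρ : Measure ℝ) [IsProbabilityMeasure ρ], ρ (Set.Icc (-R) R)ᶜ = 0 →
        ∫ t, p.eval t ∂ρ = ∑ n ∈ p.support, p.coeff n * ∫ t, t ^ n ∂ρ := by
      intro ρ _ hρ
      simp only [Polynomial.eval_eq_sum, Polynomial.sum]
      rw [integral_finsetSum]
      · simp only [integral_const_mul]
      · intro n _
        simpa using (integrable_pow_of_compl_Icc hρ (Polynomial.X ^ n)).const_mul (p.coeff n)
    rw [key μ hμ, key ν hν]
    simp only [h]
  refine ext_of_forall_integral_eq_of_IsFiniteMeasure fun f => ?_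
  refine eq_of_forall_dist_le fun ε hε => ?_
  obtain ⟨p, hp⟩ := exists_polynomial_near_of_continuousOn (-R) R f f.continuous.continuousOn
    (ε / 2) (by positivity)
  have key : ∀ (ρ : Measure ℝ) [IsProbabilityMeasure ρ], ρ (Set.Icc (-R) R)ᶜ = 0 →
      |∫ t, p.eval t ∂ρ - ∫ t, f t ∂ρ| ≤ ε / 2 := by
    intro ρ _ hρ
    rw [← integral_sub (integrable_pow_of_compl_Icc hρ p) (f.integrable ρ)]
    have hb : ∀ᵐ t ∂ρ, ‖p.eval t - f t‖ ≤ ε / 2 := by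
      filter_upwards [measure_eq_zero_iff_ae_notMem.1 hρ] with t ht
      exact (hp t (by simpa using ht)).le
    simpa using norm_integral_le_of_norm_le_const hb
  have h1 := abs_le.1 (key μ hμ)
  have h2 := abs_le.1 (key ν hν)
  rw [hpoly] at h1
  rw [Real.dist_eq, abs_le]
  constructor <;> linarith

section Limit

variable {m : ℕ → Measure ℝ} {L : ℕ → ℝ} {C : ℝ}

/-- The mass outside of `[-(C + 1), C + 1]` vanishes in the limit, even after integrating
powers. -/
lemma tendsto_integral_tail (hi : ∀ N n, Integrable (fun t : ℝ => t ^ n) (m N))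
    (hm : ∀ n, Tendsto (fun N => ∫ t, t ^ n ∂(m N)) atTop (𝓝 (L n)))
    (hC : 0 ≤ C) (hL : ∀ n, |L n| ≤ C ^ n) (j : ℕ) {g : ℝ → ℝ} {B : ℝ} (hB : 0 ≤ B)
    (hg : ∀ t, |g t| ≤ if C + 1 < |t| then B * t ^ (2 * j) else 0) :
    Tendsto (fun N => ∫ t, g t ∂(m N)) atTop (𝓝 0) := by
  rw [Metric.tendsto_atTop]
  intro ε hε
  have h0 : Tendsto (fun k : ℕ => B * C ^ (2 * j) * ((C / (C + 1)) ^ 2) ^ k) atTop (𝓝 0) := by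
    have h1 : C / (C + 1) < 1 := by rw [div_lt_one (by linarith)]; linarith
    have h2 : 0 ≤ C / (C + 1) := by positivity
    have := tendsto_pow_atTop_nhds_zero_of_lt_one (sq_nonneg (C / (C + 1)))
      (pow_lt_one₀ h2 h1 two_ne_zero)
    simpa using this.const_mul (B * C ^ (2 * j))
  obtain ⟨k, hk⟩ := (h0.eventually (gt_mem_nhds hε)).exists
  -- Chebyshev's inequality, with a power `2 * k` for which the bound drops below `ε` in the limit
  have hbound : ∀ t : ℝ, |g t| ≤ B / (C + 1) ^ (2 * k) * t ^ (2 * j + 2 * k) := by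
    intro t
    have h1 : 0 ≤ t ^ (2 * j) := by rw [pow_mul]; positivity
    have h2 : 0 ≤ t ^ (2 * k) := by rw [pow_mul]; positivity
    refine (hg t).trans ?_
    rw [div_mul_eq_mul_div, le_div_iff₀ (by positivity), pow_add]
    split_ifs with ht
    · have h3 : (C + 1) ^ (2 * k) ≤ t ^ (2 * k) := by
        rw [pow_mul, pow_mul, ← sq_abs t]
        gcongr
      calc B * t ^ (2 * j) * (C + 1) ^ (2 * k) ≤ B * t ^ (2 * j) * t ^ (2 * k) := by gcongr
        _ = _ := by ring
    · rw [zero_mul]; positivity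
  have hlim := (hm (2 * j + 2 * k)).const_mul (B / (C + 1) ^ (2 * k))
  have hlt : B / (C + 1) ^ (2 * k) * L (2 * j + 2 * k) < ε := by
    refine lt_of_le_of_lt ?_ hk
    calc B / (C + 1) ^ (2 * k) * L (2 * j + 2 * k)
        ≤ B / (C + 1) ^ (2 * k) * C ^ (2 * j + 2 * k) := by
          gcongr
          exact (le_abs_self _).trans (hL _)
      _ = _ := by rw [← pow_mul, div_pow, pow_add]; ring
  obtain ⟨N₀, hN₀⟩ := eventually_atTop.1 (hlim.eventually (gt_mem_nhds hlt))
  refine ⟨N₀, fun N hN => ?_⟩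
  rw [dist_zero_right]
  refine lt_of_le_of_lt ?_ (hN₀ N hN)
  rw [← integral_const_mul]
  exact norm_integral_le_of_norm_le ((hi N _).const_mul _) (ae_of_all _ hbound)

/-- The method of moments: if the moments of probability measures converge to a sequence of
exponential growth, then the measures converge weakly, and the limit is compactly supported and has
the limits as its moments. -/
theorem exists_tendsto_of_tendsto_moments [∀ N, IsProbabilityMeasure (m N)]
    (hi : ∀ N n, Integrable (fun t : ℝ => t ^ n) (m N))
    (hm : ∀ n, Tendsto (fun N => ∫ t, t ^ n ∂(m N)) atTop (𝓝 (L n)))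
    (hC : 0 ≤ C) (hL : ∀ n, |L n| ≤ C ^ n) :
    ∃ σ : Measure ℝ, IsProbabilityMeasure σ ∧ (∃ K : Set ℝ, IsCompact K ∧ σ Kᶜ = 0) ∧
      (∀ n, ∫ t, t ^ n ∂σ = L n) ∧
      ∀ f : ℝ →ᵇ ℝ, Tendsto (fun N => ∫ t, f t ∂(m N)) atTop (𝓝 (∫ t, f t ∂σ)) := by
  have hR : 0 ≤ C + 1 := by linarith
  set R := C + 1 with hRdef
  let K := Set.Icc (-R) R
  have hcK : ∀ t, clamp R t ∈ K := fun t => abs_le.1 (abs_clamp_le hR t)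
  have hcm : Measurable (clamp R) := (continuous_clamp R).measurable
  -- the measures pushed to the compact interval
  let m' : ℕ → ProbabilityMeasure ℝ := fun N =>
    ⟨(m N).map (clamp R), Measure.isProbabilityMeasure_map hcm.aemeasurable⟩
  have hm' : ∀ (N) (f : ℝ →ᵇ ℝ), ∫ t, f t ∂(m' N : Measure ℝ) = ∫ t, f (clamp R t) ∂(m N) :=
    fun N f => integral_map hcm.aemeasurable f.continuous.aestronglyMeasurable
  let S : Set (ProbabilityMeasure ℝ) := {μ | (μ : Measure ℝ) Kᶜ = 0}
  have hS : IsCompact (closure S) := by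
    refine isCompact_closure_of_isTightMeasureSet
      (isTightMeasureSet_iff_exists_isCompact_measure_compl_le.2 fun ε _ =>
        ⟨K, isCompact_Icc, ?_⟩)
    rintro _ ⟨μ, hμ, rfl⟩
    exact (le_of_eq hμ).trans zero_le
  have hm'S : ∀ N, m' N ∈ closure S := fun N => subset_closure (by
    change (m N).map (clamp R) Kᶜ = 0
    rw [Measure.map_apply hcm measurableSet_Icc.compl]
    convert measure_empty (μ := m N)
    exact Set.eq_empty_of_forall_notMem fun t ht => ht (hcK t))
  have hmom : ∀ n, Tendsto (fun N => ∫ t, clamp R t ^ n ∂(m N)) atTop (𝓝 (L n)) := by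
    intro n
    have hint : ∀ N, Integrable (fun t => clamp R t ^ n) (m N) := fun N =>
      (hi N n).mono ((continuous_clamp R).pow n).aestronglyMeasurable (ae_of_all _ fun t => by
        simp only [norm_pow]
        exact pow_le_pow_left₀ (abs_nonneg _) (abs_clamp_le_abs hR t) n)
    have := tendsto_integral_tail hi hm hC hL n (g := fun t => clamp R t ^ n - t ^ n) (B := 2)
      (by norm_num) (fun t => by
        rw [← hRdef]
        split_ifs with ht
        · have h1 : |clamp R t| ^ n ≤ |t| ^ n :=
            pow_le_pow_left₀ (abs_nonneg _) (abs_clamp_le_abs hR t) n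
          have h2 : |t| ^ n ≤ t ^ (2 * n) := by
            rw [pow_mul, ← sq_abs, ← pow_mul]
            exact pow_le_pow_right₀ (by linarith) (by omega)
          calc |clamp R t ^ n - t ^ n| ≤ |clamp R t ^ n| + |t ^ n| := abs_sub _ _
            _ ≤ _ := by rw [abs_pow, abs_pow]; linarith
        · rw [clamp_of_abs_le (not_lt.1 ht), sub_self, abs_zero])
    have h2 := this.add (hm n)
    rw [zero_add] at h2
    refine h2.congr fun N => ?_
    rw [integral_sub (hint N) (hi N n), sub_add_cancel]
  -- every cluster point is supported on the interval and has the prescribed moments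
  have hclust : ∀ σ : ProbabilityMeasure ℝ, MapClusterPt σ atTop m' →
      (σ : Measure ℝ) Kᶜ = 0 ∧ ∀ n, ∫ t, t ^ n ∂(σ : Measure ℝ) = L n := by
    intro σ hσ
    obtain ⟨U, hU, hUσ⟩ := mapClusterPt_iff_ultrafilter.1 hσ
    rw [ProbabilityMeasure.tendsto_iff_forall_integral_tendsto] at hUσ
    have hsupp : (σ : Measure ℝ) Kᶜ = 0 := by
      -- a bounded continuous function which vanishes exactly on the interval
      let d : ℝ →ᵇ ℝ := BoundedContinuousFunction.ofNormedAddCommGroup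
        (fun t => min 1 |t - clamp R t|)
        (by have := continuous_clamp R; fun_prop) 1
        (fun t => by rw [Real.norm_eq_abs, abs_le]; exact
          ⟨by linarith [le_min (zero_le_one' ℝ) (abs_nonneg (t - clamp R t))], min_le_left _ _⟩)
      have hd : ∀ t, d t = min 1 |t - clamp R t| := fun t => rfl
      have h1 := hUσ d
      have h2 : ∀ N, ∫ t, d t ∂(m' N : Measure ℝ) = 0 := by
        intro N
        rw [hm']
        simp [hd, clamp_of_abs_le (abs_clamp_le hR _)]
      simp only [h2] at h1
      have h3 := tendsto_nhds_unique h1 tendsto_const_nhds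
      have hd0 : ∀ t, 0 ≤ d t := fun t => le_min zero_le_one (abs_nonneg _)
      rw [integral_eq_zero_iff_of_nonneg hd0 (d.integrable _)] at h3
      refine measure_mono_null ?_ (ae_iff.1 h3)
      intro t ht h0
      refine ht (abs_le.1 ?_)
      rw [← clamp_eq_self_iff hR]
      have h4 : min 1 |t - clamp R t| = 0 := h0
      rcases min_choice 1 |t - clamp R t| with h | h
      · rw [h] at h4; norm_num at h4
      · rw [h, abs_eq_zero, sub_eq_zero] at h4; exact h4.symm
    refine ⟨hsupp, fun n => ?_⟩
    have h1 := hUσ ((clampBCF R hR) ^ n)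
    have e : ∀ t, ((clampBCF R hR) ^ n) t = clamp R t ^ n := fun t => rfl
    simp only [hm'] at h1
    simp only [e, clamp_of_abs_le (abs_clamp_le hR _)] at h1
    rw [← tendsto_nhds_unique h1 ((hmom n).mono_left hU)]
    refine integral_congr_ae ?_
    filter_upwards [measure_eq_zero_iff_ae_notMem.1 hsupp] with t ht
    rw [clamp_of_abs_le (abs_le.2 (by simpa [K] using ht))]
  obtain ⟨σ, -, hσ⟩ := hS.exists_mapClusterPt (f := atTop) (u := m')
    (by rw [le_principal_iff, mem_map]; exact univ_mem' hm'S)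
  obtain ⟨h1, h2⟩ := hclust σ hσ
  have hlim : Tendsto m' atTop (𝓝 σ) :=
    hS.tendsto_nhds_of_unique_mapClusterPt (Eventually.of_forall hm'S) fun ρ _ hρ => by
      obtain ⟨h3, h4⟩ := hclust ρ hρ
      have h5 : (ρ : Measure ℝ) = (σ : Measure ℝ) :=
        ext_of_moments h3 h1 fun n => (h4 n).trans (h2 n).symm
      exact Subtype.ext h5
  refine ⟨σ, inferInstance, ⟨K, isCompact_Icc, h1⟩, h2, fun f => ?_⟩
  have h5 := (ProbabilityMeasure.tendsto_iff_forall_integral_tendsto.1 hlim) f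
  simp only [hm'] at h5
  have h6 := tendsto_integral_tail hi hm hC hL 0 (g := fun t => f t - f (clamp R t))
    (B := 2 * ‖f‖) (by positivity) (fun t => by
      rw [← hRdef]
      split_ifs with ht
      · rw [mul_zero, pow_zero, mul_one, two_mul]
        exact (norm_sub_le _ _).trans (add_le_add (f.norm_coe_le_norm _) (f.norm_coe_le_norm _))
      · rw [clamp_of_abs_le (not_lt.1 ht), sub_self, abs_zero])
  have h7 := h6.add h5
  rw [zero_add] at h7
  refine h7.congr fun N => ?_
  have hfc : Integrable (fun t => f (clamp R t)) (m N) :=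
    (f.compContinuous ⟨clamp R, continuous_clamp R⟩).integrable _
  rw [integral_sub (f.integrable _) hfc, sub_add_cancel]

end Limit

/-! ### Spectral measures -/

section Spectral

variable {N : ℕ} {A B : Matrix (Fin N) (Fin N) ℂ}

lemma integral_spectralMeasure {E : Type*} [NormedAddCommGroup E] [NormedSpace ℝ E]
    [CompleteSpace E] (hA : A.IsHermitian) (f : ℝ → E) :
    ∫ t, f t ∂(spectralMeasure hA) = (N : ℝ)⁻¹ • ∑ k, f (hA.eigenvalues k) := by
  rw [spectralMeasure, integral_smul_measure, integral_finsetSum_measure]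
  · simp
  · intro k _
    exact integrable_dirac (by simp)

lemma isProbabilityMeasure_spectralMeasure (hN : N ≠ 0) (hA : A.IsHermitian) :
    IsProbabilityMeasure (spectralMeasure hA) := by
  constructor
  simp only [spectralMeasure, Measure.smul_apply, Measure.coe_finsetSum, Finset.sum_apply,
    measure_univ, Finset.sum_const, Finset.card_univ, Fintype.card_fin, nsmul_eq_mul, mul_one,
    smul_eq_mul]
  exact ENNReal.inv_mul_cancel (by simpa using hN) (ENNReal.natCast_ne_top N)

lemma spectralMeasure_congr (h : A = B) (hA : A.IsHermitian) (hB : B.IsHermitian) :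
    spectralMeasure hA = spectralMeasure hB := by subst h; rfl

lemma spectralMeasure_real (hA : A.IsHermitian) {s : Set ℝ} [DecidablePred (· ∈ s)]
    (hs : MeasurableSet s) :
    (spectralMeasure hA).real s =
      (N : ℝ)⁻¹ * (Finset.univ.filter fun k => hA.eigenvalues k ∈ s).card := by
  classical
  rw [← integral_indicator_one hs, integral_spectralMeasure, smul_eq_mul, Finset.card_filter]
  congr 1
  push_cast
  refine Finset.sum_congr rfl fun k _ => ?_
  simp [Set.indicator_apply]

lemma isHermitian_cfc (hA : A.IsHermitian) (g : ℝ → ℝ) : (hA.cfc g).IsHermitian := by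
  rw [Matrix.IsHermitian, Matrix.IsHermitian.cfc, ← Matrix.star_eq_conjTranspose, ← map_star,
    Matrix.star_eq_conjTranspose, Matrix.diagonal_conjTranspose]
  congr 2
  funext k
  simp

lemma cfc_id (hA : A.IsHermitian) : hA.cfc id = A := hA.spectral_theorem.symm

lemma trace_cfc_pow (hA : A.IsHermitian) (g : ℝ → ℝ) (n : ℕ) :
    (hA.cfc g ^ n).trace = ∑ k, ((g (hA.eigenvalues k) ^ n : ℝ) : ℂ) := by
  rw [Matrix.IsHermitian.cfc, ← map_pow, Unitary.conjStarAlgAut_apply, Matrix.trace_mul_comm,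
    ← mul_assoc, Unitary.coe_star_mul_self, one_mul, Matrix.diagonal_pow, Matrix.trace_diagonal]
  simp

/-- The normalized trace of powers of a function of a matrix is an integral with respect to its
spectral measure. -/
lemma normTrace_cfc_pow (hA : A.IsHermitian) (g : ℝ → ℝ) (n : ℕ) :
    normTrace (hA.cfc g ^ n) = ((∫ t, g t ^ n ∂(spectralMeasure hA) : ℝ) : ℂ) := by
  rw [normTrace, trace_cfc_pow, integral_spectralMeasure, smul_eq_mul]
  push_cast
  rw [div_eq_inv_mul]

lemma normTrace_pow (hA : A.IsHermitian) (n : ℕ) :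
    normTrace (A ^ n) = ((∫ t, t ^ n ∂(spectralMeasure hA) : ℝ) : ℂ) := by
  have := normTrace_cfc_pow hA id n
  rwa [cfc_id] at this

/-! ### Comparison of the eigenvalues of two matrices -/

open Matrix in
/-- The coordinates of a vector in an orthonormal basis of eigenvectors. -/
noncomputable def eigenCoord (hA : A.IsHermitian) (v : Fin N → ℂ) : Fin N → ℂ :=
  star (hA.eigenvectorUnitary : Matrix (Fin N) (Fin N) ℂ) *ᵥ v

open Matrix in
lemma eigenCoord_cfc_mulVec (hA : A.IsHermitian) (g : ℝ → ℝ) (v : Fin N → ℂ) (k : Fin N) :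
    eigenCoord hA (hA.cfc g *ᵥ v) k = g (hA.eigenvalues k) * eigenCoord hA v k := by
  rw [eigenCoord, Matrix.IsHermitian.cfc, Unitary.conjStarAlgAut_apply, mulVec_mulVec, mul_assoc,
    ← mul_assoc, Unitary.coe_star_mul_self, one_mul, ← mulVec_mulVec, mulVec_diagonal]
  simp [eigenCoord]

open Matrix in
lemma eigenCoord_injective (hA : A.IsHermitian) : Function.Injective (eigenCoord hA) := by
  intro v w h
  have := congrArg ((hA.eigenvectorUnitary : Matrix (Fin N) (Fin N) ℂ) *ᵥ ·) h
  simpa [eigenCoord, mulVec_mulVec] using this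

open Matrix in
/-- The quadratic form of `A - t` in the coordinates of a basis of eigenvectors. -/
lemma dotProduct_mulVec_eq_sum (hA : A.IsHermitian) (v : Fin N → ℂ) (t : ℝ) :
    star v ⬝ᵥ (A *ᵥ v) - t * (star v ⬝ᵥ v) =
      ((∑ k, (hA.eigenvalues k - t) * ‖eigenCoord hA v k‖ ^ 2 : ℝ) : ℂ) := by
  have h1 : ∀ w, star v ⬝ᵥ w = star (eigenCoord hA v) ⬝ᵥ eigenCoord hA w := by
    intro w
    rw [eigenCoord, eigenCoord, star_mulVec, ← dotProduct_mulVec, mulVec_mulVec,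
      ← star_eq_conjTranspose, star_star,
      Unitary.mul_star_self_of_mem hA.eigenvectorUnitary.2, one_mulVec]
  have h2 : ∀ k, eigenCoord hA (A *ᵥ v) k = hA.eigenvalues k * eigenCoord hA v k := by
    intro k
    have := eigenCoord_cfc_mulVec hA id v k
    rwa [cfc_id] at this
  rw [h1, h1, dotProduct, dotProduct, Finset.mul_sum, ← Finset.sum_sub_distrib]
  push_cast
  refine Finset.sum_congr rfl fun k _ => ?_
  have h3 : star (eigenCoord hA v k) * eigenCoord hA v k = (‖eigenCoord hA v k‖ : ℂ) ^ 2 := by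
    rw [← Complex.conj_mul']; rfl
  rw [h2, Pi.star_apply, sub_mul, ← h3]
  ring

open Matrix in
/-- If two Hermitian matrices coincide on a subspace of codimension at most `J.card`, here the
common kernel of the linear forms `ξ k` for `k ∈ J`, then their numbers of eigenvalues below `t`
differ by at most `J.card`. -/
lemma card_eigenvalues_le (hA : A.IsHermitian) (hB : B.IsHermitian)
    (J : Finset (Fin N)) (ξ : (Fin N → ℂ) →ₗ[ℂ] Fin N → ℂ)
    (h : ∀ v, (∀ k ∈ J, ξ v k = 0) → A *ᵥ v = B *ᵥ v) (t : ℝ) :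
    (Finset.univ.filter fun k => hA.eigenvalues k ≤ t).card ≤
      (Finset.univ.filter fun k => hB.eigenvalues k ≤ t).card + J.card := by
  classical
  let Ia := Finset.univ.filter fun k => ¬ hA.eigenvalues k ≤ t
  let Ib := Finset.univ.filter fun k => hB.eigenvalues k ≤ t
  let UA := (star (hA.eigenvectorUnitary : Matrix (Fin N) (Fin N) ℂ)).mulVecLin
  let UB := (star (hB.eigenvectorUnitary : Matrix (Fin N) (Fin N) ℂ)).mulVecLin
  -- a vector killed by `T` is a combination of eigenvectors of `A` below `t`, and of eigenvectors
  -- of `B` above `t`, and `A` and `B` coincide on it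
  let T : (Fin N → ℂ) →ₗ[ℂ] (Ia → ℂ) × (Ib → ℂ) × (J → ℂ) :=
    (LinearMap.funLeft ℂ ℂ ((↑) : Ia → Fin N) ∘ₗ UA).prod
      ((LinearMap.funLeft ℂ ℂ ((↑) : Ib → Fin N) ∘ₗ UB).prod
        (LinearMap.funLeft ℂ ℂ ((↑) : J → Fin N) ∘ₗ ξ))
  have hT : Function.Injective T := by
    rw [← LinearMap.ker_eq_bot, LinearMap.ker_eq_bot']
    intro v hv
    have hv1 : ∀ k, ¬ hA.eigenvalues k ≤ t → eigenCoord hA v k = 0 := fun k hk =>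
      congrFun (congrArg Prod.fst hv) ⟨k, by simpa [Ia] using hk⟩
    have hv2 : ∀ k, hB.eigenvalues k ≤ t → eigenCoord hB v k = 0 := fun k hk =>
      congrFun (congrArg (fun p => p.2.1) hv) ⟨k, by simpa [Ib] using hk⟩
    have hv3 : ∀ k ∈ J, ξ v k = 0 := fun k hk =>
      congrFun (congrArg (fun p => p.2.2) hv) ⟨k, hk⟩
    have he := dotProduct_mulVec_eq_sum hA v t
    rw [h v hv3, dotProduct_mulVec_eq_sum hB v t, Complex.ofReal_inj] at he
    have h1 : ∑ k, (hA.eigenvalues k - t) * ‖eigenCoord hA v k‖ ^ 2 ≤ 0 := by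
      refine Finset.sum_nonpos fun k _ => ?_
      by_cases hk : hA.eigenvalues k ≤ t
      · exact mul_nonpos_of_nonpos_of_nonneg (by linarith) (by positivity)
      · simp [hv1 k hk]
    have h2 : ∀ k ∈ Finset.univ, 0 ≤ (hB.eigenvalues k - t) * ‖eigenCoord hB v k‖ ^ 2 := by
      intro k _
      by_cases hk : hB.eigenvalues k ≤ t
      · simp [hv2 k hk]
      · exact mul_nonneg (by linarith) (by positivity)
    have h3 := (Finset.sum_eq_zero_iff_of_nonneg h2).1
      (le_antisymm (he.le.trans h1) (Finset.sum_nonneg h2))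
    refine eigenCoord_injective hB (funext fun k => ?_)
    have h4 : eigenCoord hB v k = 0 := by
      by_cases hk : hB.eigenvalues k ≤ t
      · exact hv2 k hk
      · have := h3 k (Finset.mem_univ _)
        have hne : hB.eigenvalues k - t ≠ 0 := by linarith
        simpa [hne] using this
    rw [h4]
    simp [eigenCoord]
  have hd := LinearMap.finrank_le_finrank_of_injective hT
  simp only [Module.finrank_prod, Module.finrank_fintype_fun_eq_card, Fintype.card_coe,
    Fintype.card_fin] at hd
  have hc := Finset.card_filter_add_card_filter_not (s := Finset.univ)
    (p := fun k => hA.eigenvalues k ≤ t)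
  rw [Finset.card_univ, Fintype.card_fin] at hc
  simp only [Ia, Ib] at hd
  omega

/-- Truncation of a summand changes the distribution function of the spectral measure at most by
the mass which is moved. -/
lemma spectralMeasure_real_Iic_le {X Y : Matrix (Fin N) (Fin N) ℂ} (hY : Y.IsHermitian)
    (g : ℝ → ℝ) (hg : Measurable g) (hA : (X + Y).IsHermitian)
    (hB : (X + hY.cfc g).IsHermitian) (t : ℝ) :
    |(spectralMeasure hA).real (Set.Iic t) - (spectralMeasure hB).real (Set.Iic t)| ≤
      (spectralMeasure hY).real {s | g s ≠ s} := by
  classical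
  have hms : MeasurableSet {s | g s ≠ s} := (measurableSet_eq_fun hg measurable_id).compl
  rw [spectralMeasure_real hA measurableSet_Iic, spectralMeasure_real hB measurableSet_Iic,
    spectralMeasure_real hY hms, ← mul_sub, abs_mul, abs_of_nonneg (by positivity)]
  refine mul_le_mul_of_nonneg_left ?_ (by positivity)
  have key : ∀ v, (∀ k ∈ Finset.univ.filter fun k => hY.eigenvalues k ∈ {s | g s ≠ s},
      (star (hY.eigenvectorUnitary : Matrix (Fin N) (Fin N) ℂ)).mulVecLin v k = 0) →
      Y.mulVec v = (hY.cfc g).mulVec v := by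
    intro v hv
    refine eigenCoord_injective hY (funext fun k => ?_)
    have h1 := eigenCoord_cfc_mulVec hY id v k
    rw [cfc_id] at h1
    rw [h1, eigenCoord_cfc_mulVec]
    by_cases hk : g (hY.eigenvalues k) = hY.eigenvalues k
    · rw [hk]; rfl
    · have : eigenCoord hY v k = 0 := hv k (by simpa using hk)
      rw [this, mul_zero, mul_zero]
  have h1 := card_eigenvalues_le hA hB _ _
    (fun v hv => by rw [Matrix.add_mulVec, Matrix.add_mulVec, key v hv]) t
  have h2 := card_eigenvalues_le hB hA _ _
    (fun v hv => by rw [Matrix.add_mulVec, Matrix.add_mulVec, key v hv]) t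
  simp only [Set.mem_Iic]
  rw [abs_sub_le_iff, sub_le_iff_le_add', sub_le_iff_le_add']
  exact ⟨by exact_mod_cast h1, by exact_mod_cast h2⟩

end Spectral

section Convolution

/-! ### Positivity of the limit functional -/

section FreeStar

open MulOpposite

/-- The conjugate-linear anti-endomorphism of the free algebra which fixes the generators, as a
homomorphism to the opposite algebra. -/
noncomputable def freeStarHom : FreeAlgebra ℂ Bool →+* (FreeAlgebra ℂ Bool)ᵐᵒᵖ :=
  letI : Algebra ℂ (FreeAlgebra ℂ Bool)ᵐᵒᵖ := Algebra.compHom _ (starRingEnd ℂ)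
  (FreeAlgebra.lift ℂ fun b => op (FreeAlgebra.ι ℂ b)).toRingHom

lemma freeStarHom_ι (b : Bool) : freeStarHom (FreeAlgebra.ι ℂ b) = op (FreeAlgebra.ι ℂ b) := by
  let _ : Algebra ℂ (FreeAlgebra ℂ Bool)ᵐᵒᵖ := Algebra.compHom _ (starRingEnd ℂ)
  exact FreeAlgebra.lift_ι_apply _ _

lemma freeStarHom_algebraMap (c : ℂ) : freeStarHom (algebraMap ℂ _ c) =
    op (algebraMap ℂ (FreeAlgebra ℂ Bool) (conj c)) := by
  let _ : Algebra ℂ (FreeAlgebra ℂ Bool)ᵐᵒᵖ := Algebra.compHom _ (starRingEnd ℂ)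
  exact AlgHom.commutes (FreeAlgebra.lift ℂ fun b => op (FreeAlgebra.ι ℂ b)) c

/-- The conjugate-linear star operation of the free algebra under which the generators are
self-adjoint. It differs from the linear star operation which Mathlib provides as an instance. -/
@[reducible] noncomputable def freeStarRing : StarRing (FreeAlgebra ℂ Bool) where
  star f := unop (freeStarHom f)
  star_involutive f := by
    induction f using FreeAlgebra.induction with
    | grade0 c => simp [freeStarHom_algebraMap]
    | grade1 b => simp [freeStarHom_ι]
    | mul f g hf hg => simp [hf, hg]
    | add f g hf hg => simp [hf, hg]
  star_mul f g := by simp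
  star_add f g := by simp

lemma freeStarModule : @StarModule ℂ (FreeAlgebra ℂ Bool) _ freeStarRing.toStar _ := by
  let _ := freeStarRing
  refine ⟨fun c f => ?_⟩
  have hstar : ∀ f : FreeAlgebra ℂ Bool, star f = (freeStarHom f).unop := fun _ => rfl
  rw [Algebra.smul_def, hstar, map_mul, freeStarHom_algebraMap, unop_mul, unop_op,
    ← Algebra.commutes, ← Algebra.smul_def]
  rfl

end FreeStar

variable {Ω : ℕ → Type*} [∀ N, MeasurableSpace (Ω N)]
  {P : ∀ N, Measure (Ω N)} [∀ N, IsProbabilityMeasure (P N)]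
  {X : ∀ N, Ω N → Matrix (Fin N) (Fin N) ℂ} (hX : ∀ N, IsGUE (P N) (X N))
  {Y : ∀ N, Matrix (Fin N) (Fin N) ℂ} {m : ℕ → ℂ}

/-- For Hermitian matrices, evaluation takes the star operation to the conjugate transpose. -/
lemma randomLift_freeStar {N : ℕ} {Ω : Type*} {X : Ω → Matrix (Fin N) (Fin N) ℂ}
    (hX : ∀ ω, (X ω).IsHermitian) {Y : Matrix (Fin N) (Fin N) ℂ} (hY : Y.IsHermitian)
    (f : FreeAlgebra ℂ Bool) (ω : Ω) :
    randomLift Y X (freeStarHom f).unop ω = (randomLift Y X f ω).conjTranspose := by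
  induction f using FreeAlgebra.induction with
  | grade0 c =>
    rw [freeStarHom_algebraMap, MulOpposite.unop_op, AlgHom.commutes, AlgHom.commutes]
    simp only [Pi.algebraMap_apply, Matrix.algebraMap_eq_diagonal, Matrix.diagonal_conjTranspose]
    congr 1
  | grade1 b =>
    rw [freeStarHom_ι]
    cases b
    · simpa [randomLift, pair] using (hX ω).eq.symm
    · simpa [randomLift, pair, constMatrix] using hY.eq.symm
  | mul f g hf hg => simp [hf, hg, Matrix.conjTranspose_mul]
  | add f g hf hg => simp [hf, hg, Matrix.conjTranspose_add]

/-- The limit functional inherits positivity from the normalized trace of Hermitian matrices. -/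
lemma isStarExpectation_limitFunctional (hYh : ∀ N, (Y N).IsHermitian)
    (hY : ∀ n, Tendsto (fun N => normTrace (Y N ^ n)) atTop (𝓝 (m n))) (hm : m 0 = 1) :
    letI := freeStarRing
    letI := freeStarModule
    IsStarExpectation (limitFunctional hX Y) := by
  let _ := freeStarRing
  let _ := freeStarModule
  have hstar : ∀ f : FreeAlgebra ℂ Bool, star f = (freeStarHom f).unop := fun _ => rfl
  refine ⟨?_, fun f => ?_, fun f => ?_⟩
  · exact (isSchwingerDyson_limitFunctional hX Y hY hm).map_one
  · refine tendsto_nhds_unique (tendsto_limitFunctional hX Y hY (star f)) ?_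
    refine (Complex.continuous_conj.continuousAt.tendsto.comp
      (tendsto_limitFunctional hX Y hY f)).congr fun N => ?_
    simp only [Function.comp_apply, expNormTrace, hstar,
      randomLift_freeStar (hX N).isHermitian (hYh N), normTrace, Matrix.trace_conjTranspose]
    rw [← integral_conj]
    congr 1
    funext ω
    simp
  · have h1 := tendsto_limitFunctional hX Y hY (f * star f)
    let r : ℕ → ℝ := fun N => ∫ ω, (∑ i, ∑ j, ‖randomLift (Y N) (X N) f ω i j‖ ^ 2) / N ∂(P N)
    have hr : ∀ N, expNormTrace (P N) (randomLift (Y N) (X N) (f * star f)) = (r N : ℂ) := by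
      intro N
      simp only [r]
      rw [expNormTrace, ← integral_complex_ofReal]
      congr 1
      funext ω
      rw [map_mul, hstar, Pi.mul_apply, randomLift_freeStar (hX N).isHermitian (hYh N), normTrace]
      push_cast
      congr 1
      simp [Matrix.trace, Matrix.mul_apply, Complex.mul_conj']
    simp only [hr] at h1
    refine ⟨(limitFunctional hX Y (f * star f)).re, ?_, ?_⟩
    · refine ge_of_tendsto' ((Complex.continuous_re.tendsto _).comp h1) fun N => ?_
      simp only [Function.comp_apply, Complex.ofReal_re]
      exact integral_nonneg fun ω => by positivity
    · refine Complex.ext (by simp) ?_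
      have h2 := (Complex.continuous_im.tendsto _).comp h1
      simp only [Function.comp_def, Complex.ofReal_im] at h2
      rw [Complex.ofReal_im]
      exact tendsto_nhds_unique h2 tendsto_const_nhds

/-! ### Existence and uniqueness of the free convolution with the semicircle -/

/-- The moments of a free convolution with the semicircle are those of `X + Y` under any functional
that satisfies the Schwinger-Dyson equation and has the right moments of `Y`. -/
lemma IsFreeConvolution.integral_pow_eq {φ : FreeAlgebra ℂ Bool →ₗ[ℂ] ℂ}
    (hφ : IsSchwingerDyson φ)
    {ν ρ : Measure ℝ} (hν : ∀ n : ℕ, φ (FreeAlgebra.ι ℂ true ^ n) = ((∫ t, t ^ n ∂ν : ℝ) : ℂ))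
    (h : IsFreeConvolution semicircle ν ρ) (n : ℕ) :
    ((∫ t, t ^ n ∂ρ : ℝ) : ℂ) = φ ((FreeAlgebra.ι ℂ false + FreeAlgebra.ι ℂ true) ^ n) := by
  obtain ⟨A, _, _, _, _, τ, x, y, hτ, -, -, hfree, hx, hy, hxy⟩ := h
  rw [← hxy.moments n]
  have := hfree.lift_eq hφ.freelyIndependent hτ.unital hφ.map_one
    (fun n => (HasDistribution.map_pow_semicircle hx n).trans (hφ.map_X_pow n).symm)
    (fun n => (hy.moments n).trans (hν n).symm)
    ((FreeAlgebra.ι ℂ false + FreeAlgebra.ι ℂ true) ^ n)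
  rw [lift_pair_ι] at this
  rw [← this]
  simp [pair]

/-- The limit functional realizes a free convolution with the semicircle. -/
lemma isFreeConvolution_of_moments (hYh : ∀ N, (Y N).IsHermitian) {ν σ : Measure ℝ}
    [IsProbabilityMeasure ν] [IsProbabilityMeasure σ]
    (hνK : ∃ K : Set ℝ, IsCompact K ∧ ν Kᶜ = 0) (hσK : ∃ K : Set ℝ, IsCompact K ∧ σ Kᶜ = 0)
    (hY : ∀ n : ℕ, Tendsto (fun N => normTrace (Y N ^ n)) atTop (𝓝 ((∫ t, t ^ n ∂ν : ℝ) : ℂ)))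
    (hσ : ∀ n : ℕ, limitFunctional hX Y ((FreeAlgebra.ι ℂ false + FreeAlgebra.ι ℂ true) ^ n) =
      ((∫ t, t ^ n ∂σ : ℝ) : ℂ)) :
    IsFreeConvolution semicircle ν σ := by
  have hm : ((∫ t, t ^ 0 ∂ν : ℝ) : ℂ) = 1 := by simp
  have hφ := isSchwingerDyson_limitFunctional hX Y hY hm
  have hself : ∀ b, (freeStarHom (FreeAlgebra.ι ℂ b)).unop = FreeAlgebra.ι ℂ b := fun b => by
    rw [freeStarHom_ι, MulOpposite.unop_op]
  exact ⟨FreeAlgebra ℂ Bool, inferInstance, freeStarRing, inferInstance, freeStarModule,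
    limitFunctional hX Y, FreeAlgebra.ι ℂ false, FreeAlgebra.ι ℂ true,
    isStarExpectation_limitFunctional hX hYh hY hm, hself false, hself true,
    hφ.freelyIndependent, hasDistribution_semicircle hφ.map_X_pow,
    ⟨inferInstance, hνK, limitFunctional_Y_pow hX Y hY⟩, ⟨inferInstance, hσK, hσ⟩⟩

/-- Compactly supported measures are determined by their moments. -/
lemma eq_of_moments_of_compactSupport {μ ν : Measure ℝ} [IsProbabilityMeasure μ]
    [IsProbabilityMeasure ν] (hμ : ∃ K : Set ℝ, IsCompact K ∧ μ Kᶜ = 0)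
    (hν : ∃ K : Set ℝ, IsCompact K ∧ ν Kᶜ = 0)
    (h : ∀ n : ℕ, ∫ t, t ^ n ∂μ = ∫ t, t ^ n ∂ν) : μ = ν := by
  obtain ⟨K, hK, hμK⟩ := hμ
  obtain ⟨K', hK', hνK⟩ := hν
  obtain ⟨R, hR⟩ := (hK.union hK').isBounded.exists_norm_le
  refine ext_of_moments (R := R) (measure_mono_null (Set.compl_subset_compl.2 fun t ht => ?_) hμK)
    (measure_mono_null (Set.compl_subset_compl.2 fun t ht => ?_) hνK) h
  · exact abs_le.1 (hR t (Or.inl ht))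
  · exact abs_le.1 (hR t (Or.inr ht))

lemma IsFreeConvolution.compactSupport {μ ν ρ : Measure ℝ} (h : IsFreeConvolution μ ν ρ) :
    IsProbabilityMeasure ρ ∧ ∃ K : Set ℝ, IsCompact K ∧ ρ Kᶜ = 0 := by
  obtain ⟨A, _, _, _, _, τ, x, y, -, -, -, -, -, -, hxy⟩ := h
  exact ⟨hxy.isProbabilityMeasure, hxy.compactSupport⟩

/-- The free convolution of the semicircle law with `ν` exists and is unique: it is the compactly
supported measure whose moments are those of `X + Y` under the limit functional of a matrix model
of `ν`. -/
lemma isFreeConvolution_iff_eq (hYh : ∀ N, (Y N).IsHermitian) {ν σ : Measure ℝ}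
    [IsProbabilityMeasure ν] [IsProbabilityMeasure σ]
    (hνK : ∃ K : Set ℝ, IsCompact K ∧ ν Kᶜ = 0) (hσK : ∃ K : Set ℝ, IsCompact K ∧ σ Kᶜ = 0)
    (hY : ∀ n : ℕ, Tendsto (fun N => normTrace (Y N ^ n)) atTop (𝓝 ((∫ t, t ^ n ∂ν : ℝ) : ℂ)))
    (hσ : ∀ n : ℕ, limitFunctional hX Y ((FreeAlgebra.ι ℂ false + FreeAlgebra.ι ℂ true) ^ n) =
      ((∫ t, t ^ n ∂σ : ℝ) : ℂ)) (ρ : Measure ℝ) :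
    IsFreeConvolution semicircle ν ρ ↔ ρ = σ := by
  constructor
  · intro h
    obtain ⟨hρ, hρK⟩ := h.compactSupport
    refine eq_of_moments_of_compactSupport hρK hσK fun n => ?_
    have := h.integral_pow_eq (isSchwingerDyson_limitFunctional hX Y hY (by simp))
      (limitFunctional_Y_pow hX Y hY) n
    rw [hσ] at this
    exact_mod_cast this
  · rintro rfl
    exact isFreeConvolution_of_moments hX hYh hνK hσK hY hσ

end Convolution

section MeanSpectral

/-! ### Mean spectral measures -/

section Measurability

variable {N : ℕ} {S : Type*} [MeasurableSpace S] {M : S → Matrix (Fin N) (Fin N) ℂ}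

lemma measurable_matrix_pow (hM : ∀ i j, Measurable fun s => M s i j) (n : ℕ) (i j : Fin N) :
    Measurable fun s => (M s ^ n) i j := by
  induction n generalizing i j with
  | zero => simp only [pow_zero]; exact measurable_const
  | succ n ih =>
    simp only [pow_succ, Matrix.mul_apply]
    exact Finset.measurable_sum _ fun k _ => (ih i k).mul (hM k j)

/-- The linear statistics of the eigenvalues of a measurable family of Hermitian matrices are
measurable: for polynomials they are traces, and polynomials approximate continuous functions
locally uniformly. -/
lemma measurable_sum_eigenvalues (hM : ∀ i j, Measurable fun s => M s i j)
    (h : ∀ s, (M s).IsHermitian) {f : ℝ → ℝ} (hf : Continuous f) :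
    Measurable fun s => ∑ k, f ((h s).eigenvalues k) := by
  have hpoly : ∀ p : Polynomial ℝ, Measurable fun s => ∑ k, p.eval ((h s).eigenvalues k) := by
    intro p
    induction p using Polynomial.induction_on' with
    | add p q hp hq =>
      simp only [Polynomial.eval_add, Finset.sum_add_distrib]
      exact hp.add hq
    | monomial n c =>
      simp only [Polynomial.eval_monomial, ← Finset.mul_sum]
      refine Measurable.const_mul ?_ c
      have e : (fun s => ∑ k, (h s).eigenvalues k ^ n) = fun s => ((M s ^ n).trace).re := by
        funext s
        have := trace_cfc_pow (h s) id n
        rw [cfc_id] at this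
        rw [this, ← Complex.ofReal_sum, Complex.ofReal_re]
        rfl
      rw [e]
      exact Complex.measurable_re.comp
        (Finset.measurable_sum _ fun i _ => measurable_matrix_pow hM n i i)
  have happ : ∀ k : ℕ, ∃ p : Polynomial ℝ,
      ∀ x ∈ Set.Icc (-(k : ℝ)) k, |p.eval x - f x| < 1 / ((k : ℝ) + 1) := fun k =>
    exists_polynomial_near_of_continuousOn _ _ f hf.continuousOn _ (by positivity)
  choose p hp using happ
  refine measurable_of_tendsto_metrizable (fun k => hpoly (p k)) (tendsto_pi_nhds.2 fun s => ?_)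
  refine tendsto_finsetSum _ fun k _ => ?_
  rw [tendsto_iff_dist_tendsto_zero]
  refine squeeze_zero' (Eventually.of_forall fun _ => dist_nonneg) ?_
    tendsto_one_div_add_atTop_nhds_zero_nat
  obtain ⟨K, hK⟩ := exists_nat_ge |(h s).eigenvalues k|
  filter_upwards [eventually_ge_atTop K] with n hn
  exact (hp n _ (abs_le.1 (hK.trans (by exact_mod_cast hn)))).le

/-- The measurability is checked on closed sets, whose indicators are limits of continuous
functions; `measurable_sum_eigenvalues` applies to those. -/
lemma measurable_spectralMeasure (hN : N ≠ 0) (hM : ∀ i j, Measurable fun s => M s i j)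
    (h : ∀ s, (M s).IsHermitian) : Measurable fun s => spectralMeasure (h s) := by
  have : ∀ s, IsProbabilityMeasure (spectralMeasure (h s)) := fun s =>
    isProbabilityMeasure_spectralMeasure hN (h s)
  refine Measurable.measure_of_isPiSystem_of_isProbabilityMeasure
    (S := {F : Set ℝ | IsClosed F}) ?_ isPiSystem_isClosed fun F hF => ?_
  · rw [BorelSpace.measurable_eq (α := ℝ), borel_eq_generateFrom_isClosed]
  · refine measurable_of_tendsto_metrizable (fun n => ?_) (tendsto_pi_nhds.2 fun s =>
      HasOuterApproxClosed.tendsto_lintegral_apprSeq hF (spectralMeasure (h s)))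
    let g : ℝ → ℝ := fun t => (IsClosed.apprSeq hF n t : ℝ)
    have hg : Continuous g := NNReal.continuous_coe.comp (IsClosed.apprSeq hF n).continuous
    have e : ∀ s, ∫⁻ t, (IsClosed.apprSeq hF n t : ℝ≥0∞) ∂(spectralMeasure (h s)) =
        (N : ℝ≥0∞)⁻¹ * ENNReal.ofReal (∑ k, g ((h s).eigenvalues k)) := by
      intro s
      rw [spectralMeasure, lintegral_smul_measure, lintegral_finsetSum_measure, smul_eq_mul,
        ENNReal.ofReal_sum_of_nonneg fun _ _ => NNReal.coe_nonneg _]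
      simp
    simp only [e]
    exact ((measurable_sum_eigenvalues hM h hg).ennreal_ofReal).const_mul _

end Measurability

variable {N : ℕ} {Ω : Type*} [MeasurableSpace Ω] {P : Measure Ω}
  {X : Ω → Matrix (Fin N) (Fin N) ℂ} {B : Matrix (Fin N) (Fin N) ℂ}

/-- The Hermitian part of the matrix with given entries. -/
noncomputable def hermPart (Z : Fin N → Fin N → ℂ) : Matrix (Fin N) (Fin N) ℂ :=
  Matrix.of fun i j => (Z i j + conj (Z j i)) / 2

lemma isHermitian_hermPart (Z : Fin N → Fin N → ℂ) : (hermPart Z).IsHermitian := by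
  ext i j
  simp [hermPart, add_comm]

lemma hermPart_of_isHermitian {M : Matrix (Fin N) (Fin N) ℂ} (h : M.IsHermitian) :
    hermPart (fun i j => M i j) = M := by
  ext i j
  have : conj (M j i) = M i j := h.apply i j
  simp [hermPart, this]

/-- The spectral measure of `Z + B` as a function of the entries of a Hermitian matrix `Z`; the
Hermitian part is used to define it on all matrices. A kernel on the space of entries is used
because `X` is only almost everywhere measurable on its probability space. -/
noncomputable def spectralKernel (hN : N ≠ 0) (hB : B.IsHermitian) :
    Kernel (Fin N → Fin N → ℂ) ℝ where
  toFun Z := spectralMeasure ((isHermitian_hermPart Z).add hB)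
  measurable' := measurable_spectralMeasure hN (fun i j => by
    simp only [hermPart, Matrix.add_apply, Matrix.of_apply]
    fun_prop) _

instance (hN : N ≠ 0) (hB : B.IsHermitian) : IsMarkovKernel (spectralKernel hN hB) :=
  ⟨fun _ => isProbabilityMeasure_spectralMeasure hN _⟩

instance isProbabilityMeasure_gueLaw : IsProbabilityMeasure (gueLaw N) :=
  Measure.isProbabilityMeasure_map (by fun_prop)

/-- The mean spectral measure of `X + B`, with `X` a GUE matrix. It depends on the law of `X` only.
The case `N = 0` is excluded, since the spectral measure of the empty matrix is zero. -/
noncomputable def meanSpectralMeasure (hN : N ≠ 0) (hB : B.IsHermitian) : Measure ℝ :=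
  spectralKernel hN hB ∘ₘ gueLaw N

instance (hN : N ≠ 0) (hB : B.IsHermitian) :
    IsProbabilityMeasure (meanSpectralMeasure hN hB) := by
  unfold meanSpectralMeasure; infer_instance

lemma spectralKernel_apply (hX : IsGUE P X) (hN : N ≠ 0) (hB : B.IsHermitian) (ω : Ω) :
    spectralKernel hN hB (fun i j => X ω i j) =
      spectralMeasure ((hX.isHermitian ω).add hB) :=
  spectralMeasure_congr (by rw [hermPart_of_isHermitian (hX.isHermitian ω)]) _ _

lemma integrable_spectralKernel (hN : N ≠ 0) (hB : B.IsHermitian)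
    {f : ℝ → ℝ} (hf : Integrable f (meanSpectralMeasure hN hB)) :
    Integrable (fun Z => ∫ t, f t ∂(spectralKernel hN hB Z)) (gueLaw N) := by
  rw [meanSpectralMeasure, Measure.comp_eq_comp_const_apply] at hf
  simpa only [Kernel.const_apply] using hf.integral_comp

lemma IsGUE.integrable_integral_spectralMeasure (hX : IsGUE P X) (hN : N ≠ 0) (hB : B.IsHermitian)
    {f : ℝ → ℝ} (hf : Integrable f (meanSpectralMeasure hN hB)) :
    Integrable (fun ω => ∫ t, f t ∂(spectralMeasure ((hX.isHermitian ω).add hB))) P := by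
  have h := integrable_spectralKernel hN hB hf
  rw [← hX.hasLaw.map_eq] at h
  simpa only [Function.comp_def, spectralKernel_apply hX] using
    h.comp_aemeasurable hX.hasLaw.aemeasurable

lemma IsGUE.integral_meanSpectralMeasure (hX : IsGUE P X) (hN : N ≠ 0) (hB : B.IsHermitian)
    {f : ℝ → ℝ} (hf : Integrable f (meanSpectralMeasure hN hB)) :
    ∫ t, f t ∂(meanSpectralMeasure hN hB) =
      ∫ ω, ∫ t, f t ∂(spectralMeasure ((hX.isHermitian ω).add hB)) ∂P := by
  have h := hX.hasLaw.integral_comp (integrable_spectralKernel hN hB hf).aestronglyMeasurable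
  simp only [Function.comp_def, spectralKernel_apply hX] at h
  rw [h]
  rw [meanSpectralMeasure, Measure.comp_eq_comp_const_apply] at hf ⊢
  rw [Kernel.integral_comp hf, Kernel.const_apply]

lemma randomLift_add_pow {Ω : Type*} (B : Matrix (Fin N) (Fin N) ℂ)
    (X : Ω → Matrix (Fin N) (Fin N) ℂ) (n : ℕ) :
    randomLift B X ((FreeAlgebra.ι ℂ false + FreeAlgebra.ι ℂ true) ^ n) =
      (X + constMatrix Ω B) ^ n := by
  simp [randomLift, pair]

lemma normTrace_add_pow (hX : IsGUE P X) (hB : B.IsHermitian) (n : ℕ) (ω : Ω) :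
    normTrace (((X + constMatrix Ω B) ^ n) ω) =
      ((∫ t, t ^ n ∂(spectralMeasure ((hX.isHermitian ω).add hB)) : ℝ) : ℂ) :=
  normTrace_pow _ n

/-- The integrability of all powers: `|t| ^ n ≤ 1 + t ^ (2 n)`, and the mean of the even moments is
an expected trace of a polynomial in the entries. -/
lemma IsGUE.integrable_pow_meanSpectralMeasure (hX : IsGUE P X) (hN : N ≠ 0)
    (hB : B.IsHermitian) (n : ℕ) : Integrable (fun t => t ^ n) (meanSpectralMeasure hN hB) := by
  have hsm : ∀ n : ℕ, StronglyMeasurable fun t : ℝ => t ^ n := fun n =>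
    (continuous_pow n).stronglyMeasurable
  have hint : ∀ (Z) (f : ℝ → ℝ), Integrable f (spectralKernel hN hB Z) := fun Z f =>
    Integrable.smul_measure (integrable_finsetSum_measure.2 fun k _ => integrable_dirac (by simp))
      (by simpa using hN)
  rw [meanSpectralMeasure, Measure.integrable_comp_iff (hsm n).aestronglyMeasurable]
  refine ⟨ae_of_all _ fun Z => hint Z _, ?_⟩
  have h2 : Integrable (fun Z => ∫ t, t ^ (2 * n) ∂(spectralKernel hN hB Z)) (gueLaw N) := by
    rw [← hX.hasLaw.map_eq, integrable_map_measure
      (hsm (2 * n)).integral_kernel.aestronglyMeasurable hX.hasLaw.aemeasurable]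
    have := (hX.integrable_normTrace B
      ((FreeAlgebra.ι ℂ false + FreeAlgebra.ι ℂ true) ^ (2 * n))).re
    rw [randomLift_add_pow] at this
    simp only [normTrace_add_pow hX hB, RCLike.re_eq_complex_re, Complex.ofReal_re] at this
    simpa only [Function.comp_def, spectralKernel_apply hX] using this
  refine ((integrable_const 1).add h2).mono
    (hsm n).norm.integral_kernel.aestronglyMeasurable (ae_of_all _ fun Z => ?_)
  have h3 : (0 : ℝ) ≤ ∫ t, t ^ (2 * n) ∂(spectralKernel hN hB Z) :=
    integral_nonneg fun t => by rw [pow_mul]; positivity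
  rw [Real.norm_of_nonneg (integral_nonneg fun t => norm_nonneg _), Pi.add_apply,
    Real.norm_of_nonneg (by positivity)]
  have h4 : (1 : ℝ) + ∫ t, t ^ (2 * n) ∂(spectralKernel hN hB Z) =
      ∫ t, (1 + t ^ (2 * n)) ∂(spectralKernel hN hB Z) := by
    rw [integral_add (hint Z _) (hint Z _)]
    simp
  rw [h4]
  refine integral_mono (hint Z _) (hint Z _) fun t => ?_
  simp only [norm_pow, Real.norm_eq_abs]
  rw [mul_comm, pow_mul, ← sq_abs, abs_pow]
  nlinarith [sq_nonneg (|t| ^ n - 1)]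

/-- The moments of the mean spectral measure are expected normalized traces. -/
lemma IsGUE.expNormTrace_add_pow (hX : IsGUE P X) (hN : N ≠ 0) (hB : B.IsHermitian) (n : ℕ) :
    expNormTrace P ((X + constMatrix Ω B) ^ n) =
      ((∫ t, t ^ n ∂(meanSpectralMeasure hN hB) : ℝ) : ℂ) := by
  rw [hX.integral_meanSpectralMeasure hN hB (hX.integrable_pow_meanSpectralMeasure hN hB n),
    ← integral_complex_ofReal]
  simp only [expNormTrace, normTrace_add_pow hX hB]

/-- Truncation of `B` changes the mean distribution function of `X + B` at most by the mass which is
moved. -/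
lemma IsGUE.abs_meanSpectralMeasure_real_sub_le [IsProbabilityMeasure P] (hX : IsGUE P X)
    (hN : N ≠ 0) (hB : B.IsHermitian) {g : ℝ → ℝ} (hg : Measurable g) (t : ℝ) :
    |(meanSpectralMeasure hN hB).real (Set.Iic t) -
      (meanSpectralMeasure hN (isHermitian_cfc hB g)).real (Set.Iic t)| ≤
      (spectralMeasure hB).real {s | g s ≠ s} := by
  have hi : ∀ {C : Matrix (Fin N) (Fin N) ℂ} (hC : C.IsHermitian),
      Integrable ((Set.Iic t).indicator (1 : ℝ → ℝ)) (meanSpectralMeasure hN hC) := fun hC =>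
    (integrable_const (1 : ℝ)).indicator measurableSet_Iic
  rw [← integral_indicator_one measurableSet_Iic, ← integral_indicator_one measurableSet_Iic,
    hX.integral_meanSpectralMeasure hN hB (hi hB),
    hX.integral_meanSpectralMeasure hN (isHermitian_cfc hB g) (hi _),
    ← integral_sub (hX.integrable_integral_spectralMeasure hN hB (hi hB))
      (hX.integrable_integral_spectralMeasure hN (isHermitian_cfc hB g) (hi _))]
  simp only [integral_indicator_one measurableSet_Iic]
  have h : ∀ ω, ‖(spectralMeasure ((hX.isHermitian ω).add hB)).real (Set.Iic t) -
      (spectralMeasure ((hX.isHermitian ω).add (isHermitian_cfc hB g))).real (Set.Iic t)‖ ≤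
      (spectralMeasure hB).real {s | g s ≠ s} := fun ω =>
    spectralMeasure_real_Iic_le hB g hg _ _ t
  simpa using norm_integral_le_of_norm_le_const (μ := P) (ae_of_all _ h)

end MeanSpectral

section LimitDistribution

/-! ### The limit distribution of GUE plus deterministic matrices -/

/-- Weak convergence carries over to measures whose distribution functions are uniformly close. It
suffices to test it on intervals whose end points are not atoms of the limit. -/
lemma tendsto_integral_of_abs_real_Iic_sub_le {μ μ' : ℕ → Measure ℝ} {σ : Measure ℝ}
    [∀ N, IsProbabilityMeasure (μ N)] [∀ N, IsProbabilityMeasure (μ' N)] [IsProbabilityMeasure σ]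
    {d : ℕ → ℝ} (hd : Tendsto d atTop (𝓝 0))
    (h : ∀ N t, |(μ N).real (Set.Iic t) - (μ' N).real (Set.Iic t)| ≤ d N)
    (h' : ∀ f : ℝ →ᵇ ℝ, Tendsto (fun N => ∫ t, f t ∂(μ' N)) atTop (𝓝 (∫ t, f t ∂σ)))
    (f : ℝ →ᵇ ℝ) : Tendsto (fun N => ∫ t, f t ∂(μ N)) atTop (𝓝 (∫ t, f t ∂σ)) := by
  let p : ℕ → ProbabilityMeasure ℝ := fun N => ⟨μ N, inferInstance⟩
  let p' : ℕ → ProbabilityMeasure ℝ := fun N => ⟨μ' N, inferInstance⟩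
  let s : ProbabilityMeasure ℝ := ⟨σ, inferInstance⟩
  have hp' : Tendsto p' atTop (𝓝 s) :=
    ProbabilityMeasure.tendsto_iff_forall_integral_tendsto.2 h'
  suffices hp : Tendsto p atTop (𝓝 s) from
    ProbabilityMeasure.tendsto_iff_forall_integral_tendsto.1 hp f
  -- the points which are not atoms of the limit are dense
  let D : Set ℝ := {t | σ {t} = 0}
  have hD : Dense D := by
    have hc : Set.Countable {t : ℝ | 0 < σ {a : ℝ | id a = t}} :=
      Measure.countable_meas_level_set_pos measurable_id
    refine (hc.dense_compl ℝ).mono fun t ht => ?_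
    simpa [D, pos_iff_ne_zero] using ht
  refine (isPiSystem_Ioc_mem D D).tendsto_probabilityMeasure_of_tendsto_of_mem ?_ ?_ ?_
  · rintro _ ⟨a, -, b, -, -, rfl⟩
    exact measurableSet_Ioc
  · intro u hu x hx
    obtain ⟨ε, hε, hεu⟩ := Metric.isOpen_iff.1 hu x hx
    obtain ⟨a, ha, ha1, ha2⟩ := hD.exists_between (show x - ε < x by linarith)
    obtain ⟨b, hb, hb1, hb2⟩ := hD.exists_between (show x < x + ε by linarith)
    refine ⟨Set.Ioc a b, ⟨a, ha, b, hb, ha2.trans hb1, rfl⟩, Ioc_mem_nhds ha2 hb1,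
      fun y hy => hεu ?_⟩
    rw [Real.ball_eq_Ioo]
    exact ⟨ha1.trans hy.1, hy.2.trans_lt hb2⟩
  · rintro _ ⟨a, ha, b, hb, hab, rfl⟩
    have hfr : σ (frontier (Set.Ioc a b)) = 0 := by
      rw [frontier_Ioc hab]
      refine measure_mono_null (t := {a} ∪ {b}) (by intro t; simp [or_comm]) ?_
      exact measure_union_null ha hb
    have h1 := (ENNReal.tendsto_toReal (measure_ne_top _ _)).comp
      (ProbabilityMeasure.tendsto_measure_of_null_frontier_of_tendsto' hp' hfr)
    have h2 : Tendsto (fun N => (μ N).real (Set.Ioc a b) - (μ' N).real (Set.Ioc a b)) atTop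
        (𝓝 0) := by
      have hd2 : Tendsto (fun N => d N + d N) atTop (𝓝 0) := by simpa using hd.add hd
      refine squeeze_zero_norm (fun N => ?_) hd2
      have e : ∀ (ρ : Measure ℝ) [IsProbabilityMeasure ρ],
          ρ.real (Set.Ioc a b) = ρ.real (Set.Iic b) - ρ.real (Set.Iic a) := by
        intro ρ _
        rw [← measureReal_sdiff (Set.Iic_subset_Iic.2 hab.le) measurableSet_Iic]
        congr 1
        ext t
        simp [and_comm]
      rw [e, e, Real.norm_eq_abs]
      have ha' := abs_le.1 (h N a)
      have hb' := abs_le.1 (h N b)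
      exact abs_le.2 ⟨by linarith [ha'.1, ha'.2], by linarith [hb'.1, hb'.2]⟩
    have h3 := h2.add h1
    rw [zero_add] at h3
    rw [← NNReal.tendsto_coe]
    refine h3.congr fun N => ?_
    exact sub_add_cancel _ _

/-- If the spectral measures converge weakly to a measure on `[-R, R]`, then the proportion of the
eigenvalues outside of `[-(R + 1), R + 1]` vanishes in the limit. -/
lemma tendsto_spectralMeasure_clamp_ne {Y : ∀ N, Matrix (Fin N) (Fin N) ℂ}
    (hY : ∀ N, (Y N).IsHermitian) {ν : Measure ℝ} {R : ℝ} (hR : 0 ≤ R)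
    (hν : ν (Set.Icc (-R) R)ᶜ = 0)
    (h : ∀ f : ℝ →ᵇ ℝ,
      Tendsto (fun N => ∫ t, f t ∂(spectralMeasure (hY N))) atTop (𝓝 (∫ t, f t ∂ν))) :
    Tendsto (fun N => (spectralMeasure (hY (N + 1))).real {s | clamp (R + 1) s ≠ s}) atTop
      (𝓝 0) := by
  -- a bounded continuous function which vanishes on `[-R, R]` and dominates the indicator function
  let b : ℝ →ᵇ ℝ := BoundedContinuousFunction.ofNormedAddCommGroup
    (fun t => min 1 |t - clamp R t|) (by have := continuous_clamp R; fun_prop) 1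
    (fun t => by
      rw [Real.norm_of_nonneg (le_min zero_le_one (abs_nonneg _))]
      exact min_le_left _ _)
  have hb : ∀ t, b t = min 1 |t - clamp R t| := fun _ => rfl
  have h0 : ∫ t, b t ∂ν = 0 := by
    refine integral_eq_zero_of_ae ?_
    filter_upwards [measure_eq_zero_iff_ae_notMem.1 hν] with t ht
    rw [hb, clamp_of_abs_le (abs_le.2 (by simpa using ht))]
    simp
  have h1 := (tendsto_add_atTop_iff_nat 1).2 (h b)
  rw [h0] at h1
  refine squeeze_zero (fun _ => measureReal_nonneg) (fun N => ?_) h1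
  have hp := isProbabilityMeasure_spectralMeasure N.succ_ne_zero (hY (N + 1))
  have hm : MeasurableSet {s | clamp (R + 1) s ≠ s} :=
    (measurableSet_eq_fun (continuous_clamp _).measurable measurable_id).compl
  rw [← integral_indicator_one hm]
  refine integral_mono ((integrable_const (1 : ℝ)).indicator hm) (b.integrable _) fun t => ?_
  by_cases ht : clamp (R + 1) t = t
  · rw [Set.indicator_of_notMem (by simpa using ht)]
    exact le_min zero_le_one (abs_nonneg _)
  · rw [Set.indicator_of_mem (by simpa using ht), hb, Pi.one_apply]
    rw [clamp_eq_self_iff (by linarith), not_le] at ht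
    refine le_min le_rfl ?_
    have h2 := abs_sub_abs_le_abs_sub t (clamp R t)
    have h3 := abs_clamp_le hR t
    linarith

/-- The moments of the truncated matrices converge, as they are integrals of bounded continuous
functions with respect to the spectral measures. -/
lemma tendsto_normTrace_clamp_pow {Y : ∀ N, Matrix (Fin N) (Fin N) ℂ}
    (hY : ∀ N, (Y N).IsHermitian) {ν : Measure ℝ} {R R' : ℝ} (hR : 0 ≤ R') (hRR' : R ≤ R')
    (hν : ν (Set.Icc (-R) R)ᶜ = 0)
    (h : ∀ f : ℝ →ᵇ ℝ,
      Tendsto (fun N => ∫ t, f t ∂(spectralMeasure (hY N))) atTop (𝓝 (∫ t, f t ∂ν))) (n : ℕ) :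
    Tendsto (fun N => normTrace ((hY N).cfc (clamp R') ^ n)) atTop
      (𝓝 ((∫ t, t ^ n ∂ν : ℝ) : ℂ)) := by
  simp only [normTrace_cfc_pow]
  refine (Complex.continuous_ofReal.tendsto _).comp ?_
  have e : ∫ t, t ^ n ∂ν = ∫ t, (clampBCF R' hR ^ n) t ∂ν := by
    refine integral_congr_ae ?_
    filter_upwards [measure_eq_zero_iff_ae_notMem.1 hν] with t ht
    change t ^ n = clamp R' t ^ n
    rw [clamp_of_abs_le ((abs_le.2 (by simpa using ht)).trans hRR')]
  rw [e]
  exact h (clampBCF R' hR ^ n)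

variable {Ω : ℕ → Type*} [∀ N, MeasurableSpace (Ω N)]
  {P : ∀ N, Measure (Ω N)} [∀ N, IsProbabilityMeasure (P N)]
  {X : ∀ N, Ω N → Matrix (Fin N) (Fin N) ℂ}

/-- The limit distribution in the case that the moments of `Y` converge to those of `ν`. The
sequence of measures starts at `N = 1`, because there is no mean spectral probability measure for
`N = 0`. -/
lemma exists_limit_distribution (hX : ∀ N, IsGUE (P N) (X N))
    {Y : ∀ N, Matrix (Fin N) (Fin N) ℂ} (hYh : ∀ N, (Y N).IsHermitian)
    {ν : Measure ℝ} [IsProbabilityMeasure ν] {R : ℝ} (hR : 0 ≤ R) (hν : ν (Set.Icc (-R) R)ᶜ = 0)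
    (hY : ∀ n : ℕ, Tendsto (fun N => normTrace (Y N ^ n)) atTop
      (𝓝 ((∫ t, t ^ n ∂ν : ℝ) : ℂ))) :
    ∃ σ : Measure ℝ, IsProbabilityMeasure σ ∧ (∃ K : Set ℝ, IsCompact K ∧ σ Kᶜ = 0) ∧
      (∀ n : ℕ, limitFunctional hX Y ((FreeAlgebra.ι ℂ false + FreeAlgebra.ι ℂ true) ^ n) =
        ((∫ t, t ^ n ∂σ : ℝ) : ℂ)) ∧
      ∀ f : ℝ →ᵇ ℝ,
        Tendsto (fun N => ∫ t, f t ∂(meanSpectralMeasure N.succ_ne_zero (hYh (N + 1)))) atTop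
          (𝓝 (∫ t, f t ∂σ)) := by
  have hφ := isSchwingerDyson_limitFunctional hX Y hY (by simp)
  set φ := limitFunctional hX Y
  have hlim : ∀ n : ℕ, Tendsto
      (fun N => ((∫ t, t ^ n ∂(meanSpectralMeasure N.succ_ne_zero (hYh (N + 1))) : ℝ) : ℂ)) atTop
      (𝓝 (φ ((FreeAlgebra.ι ℂ false + FreeAlgebra.ι ℂ true) ^ n))) := by
    intro n
    have := (tendsto_add_atTop_iff_nat 1).2 (tendsto_limitFunctional hX Y hY
      ((FreeAlgebra.ι ℂ false + FreeAlgebra.ι ℂ true) ^ n))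
    refine this.congr fun N => ?_
    rw [randomLift_add_pow, (hX (N + 1)).expNormTrace_add_pow N.succ_ne_zero (hYh (N + 1))]
  have hre : ∀ n : ℕ, φ ((FreeAlgebra.ι ℂ false + FreeAlgebra.ι ℂ true) ^ n) =
      ((φ ((FreeAlgebra.ι ℂ false + FreeAlgebra.ι ℂ true) ^ n)).re : ℂ) := by
    intro n
    refine Complex.ext (by simp) ?_
    have h2 := (Complex.continuous_im.tendsto _).comp (hlim n)
    simp only [Function.comp_def, Complex.ofReal_im] at h2
    rw [Complex.ofReal_im]
    exact tendsto_nhds_unique h2 tendsto_const_nhds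
  have hνR : ∀ k, ‖φ (FreeAlgebra.ι ℂ true ^ k)‖ ≤ R ^ k := by
    intro k
    rw [limitFunctional_Y_pow hX Y hY, Complex.norm_real]
    have : ∀ᵐ t ∂ν, ‖t ^ k‖ ≤ R ^ k := by
      filter_upwards [measure_eq_zero_iff_ae_notMem.1 hν] with t ht
      rw [norm_pow]
      exact pow_le_pow_left₀ (norm_nonneg _) (abs_le.2 (by simpa using ht)) k
    simpa using norm_integral_le_of_norm_le_const this
  obtain ⟨σ, h1, h2, h3, h4⟩ := exists_tendsto_of_tendsto_moments
    (m := fun N => meanSpectralMeasure N.succ_ne_zero (hYh (N + 1)))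
    (L := fun n => (φ ((FreeAlgebra.ι ℂ false + FreeAlgebra.ι ℂ true) ^ n)).re) (C := 2 + R)
    (fun N n => (hX (N + 1)).integrable_pow_meanSpectralMeasure N.succ_ne_zero (hYh (N + 1)) n)
    (fun n => by
      have := (Complex.continuous_re.tendsto _).comp (hlim n)
      simpa only [Function.comp_def, Complex.ofReal_re] using this)
    (by linarith)
    (fun n => (Complex.abs_re_le_norm _).trans (hφ.norm_add_pow_le hR hνR n))
  exact ⟨σ, h1, h2, fun n => by rw [h3, ← hre], h4⟩

/-- The limit distribution under weak convergence of the spectral measures of `Y`. -/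
theorem exists_freeConvolution_limit (hX : ∀ N, IsGUE (P N) (X N))
    {Y : ∀ N, Matrix (Fin N) (Fin N) ℂ} (hYh : ∀ N, (Y N).IsHermitian)
    {ν : Measure ℝ} [IsProbabilityMeasure ν] (hν : ∃ K : Set ℝ, IsCompact K ∧ ν Kᶜ = 0)
    (hY : ∀ f : ℝ →ᵇ ℝ,
      Tendsto (fun N => ∫ t, f t ∂(spectralMeasure (hYh N))) atTop (𝓝 (∫ t, f t ∂ν))) :
    ∃ σ : Measure ℝ, (∀ ρ : Measure ℝ, IsFreeConvolution semicircle ν ρ ↔ ρ = σ) ∧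
      (∀ f : ℝ →ᵇ ℝ, Tendsto
        (fun N => ∫ ω, ∫ t, f t ∂(spectralMeasure (((hX N).isHermitian ω).add (hYh N))) ∂(P N))
        atTop (𝓝 (∫ t, f t ∂σ))) ∧
      ((∀ n : ℕ, Tendsto (fun N => normTrace (Y N ^ n)) atTop
          (𝓝 ((∫ t, t ^ n ∂ν : ℝ) : ℂ))) →
        ∀ n : ℕ, Tendsto
          (fun N => expNormTrace (P N) ((X N + constMatrix (Ω N) (Y N)) ^ n))
          atTop (𝓝 ((∫ t, t ^ n ∂σ : ℝ) : ℂ))) := by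
  obtain ⟨R, hR, hνR⟩ : ∃ R, 0 ≤ R ∧ ν (Set.Icc (-R) R)ᶜ = 0 := by
    obtain ⟨K, hK, hνK⟩ := hν
    obtain ⟨r, hr⟩ := hK.isBounded.exists_norm_le
    refine ⟨max 0 r, le_max_left _ _, measure_mono_null (Set.compl_subset_compl.2 fun t ht => ?_)
      hνK⟩
    exact abs_le.1 ((hr t ht).trans (le_max_right _ _))
  -- the truncated matrices have convergent moments, and rarely differ from the original ones
  have hY' := tendsto_normTrace_clamp_pow hYh (R' := R + 1) (by linarith) (by linarith) hνR hY
  have hYh' : ∀ N, ((hYh N).cfc (clamp (R + 1))).IsHermitian := fun N => isHermitian_cfc (hYh N) _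
  obtain ⟨σ, hσ, hσK, hmom, hconv⟩ := exists_limit_distribution hX hYh' hR hνR hY'
  refine ⟨σ, isFreeConvolution_iff_eq hX hYh' hν hσK hY' hmom, fun f => ?_, fun hYm n => ?_⟩
  · rw [← tendsto_add_atTop_iff_nat 1]
    have h := tendsto_integral_of_abs_real_Iic_sub_le
      (μ := fun N => meanSpectralMeasure N.succ_ne_zero (hYh (N + 1)))
      (tendsto_spectralMeasure_clamp_ne hYh hR hνR hY)
      (fun N t => (hX (N + 1)).abs_meanSpectralMeasure_real_sub_le N.succ_ne_zero (hYh (N + 1))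
        (continuous_clamp (R + 1)).measurable t) hconv f
    refine h.congr fun N => ?_
    exact (hX (N + 1)).integral_meanSpectralMeasure N.succ_ne_zero (hYh (N + 1)) (f.integrable _)
  · -- the limit functionals of the original and of the truncated model have the same moments
    have h1 := tendsto_limitFunctional hX Y hYm
      ((FreeAlgebra.ι ℂ false + FreeAlgebra.ι ℂ true) ^ n)
    simp only [randomLift_add_pow] at h1
    have hφ := isSchwingerDyson_limitFunctional hX Y hYm (by simp)
    have hφ' := isSchwingerDyson_limitFunctional hX _ hY' (by simp)
    have h2 := hφ.freelyIndependent.lift_eq hφ'.freelyIndependent hφ.map_one hφ'.map_one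
      (fun n => (hφ.map_X_pow n).trans (hφ'.map_X_pow n).symm)
      (fun n => (limitFunctional_Y_pow hX Y hYm n).trans (limitFunctional_Y_pow hX _ hY' n).symm)
      ((FreeAlgebra.ι ℂ false + FreeAlgebra.ι ℂ true) ^ n)
    simp only [lift_pair_ι] at h2
    rwa [h2, hmom] at h1

end LimitDistribution

section Models

/-! ### Matrix models of a random variable -/

variable {Ω : ℕ → Type*} [∀ N, MeasurableSpace (Ω N)]
  {P : ∀ N, Measure (Ω N)} [∀ N, IsProbabilityMeasure (P N)]
  {X : ∀ N, Ω N → Matrix (Fin N) (Fin N) ℂ} {Y : ∀ N, Matrix (Fin N) (Fin N) ℂ} {m : ℕ → ℂ}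

lemma lift_pair_prod_pow {A : Type*} [Ring A] [Algebra ℂ A] (x y : A) {n : ℕ} (p q : Fin n → ℕ) :
    FreeAlgebra.lift ℂ (pair x y)
        (List.ofFn fun k => FreeAlgebra.ι ℂ false ^ p k * FreeAlgebra.ι ℂ true ^ q k).prod =
      (List.ofFn fun k => x ^ p k * y ^ q k).prod := by
  rw [map_list_prod, List.map_ofFn]
  congr 2
  funext k
  simp [pair]

lemma lift_pair_prod {A : Type*} [Ring A] [Algebra ℂ A] (x y : A) {n : ℕ} (q : Fin n → ℕ) :
    FreeAlgebra.lift ℂ (pair x y)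
        (List.ofFn fun k => FreeAlgebra.ι ℂ false * FreeAlgebra.ι ℂ true ^ q k).prod =
      (List.ofFn fun k => x * y ^ q k).prod := by
  simpa only [pow_one] using lift_pair_prod_pow x y (fun _ => 1) q

lemma lift_pair_letter {A : Type*} [Ring A] [Algebra ℂ A] (x y : A) (a : Bool × Polynomial ℂ) :
    FreeAlgebra.lift ℂ (pair x y) (letter (FreeAlgebra.ι ℂ false) (FreeAlgebra.ι ℂ true) a) =
      letter x y a := by
  simpa [letterProd] using lift_pair_letterProd x y [a]

/-- Factors whose expectations tend to zero are centred under the limit functional, so its freeness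
applies. -/
theorem asymptoticallyFree (hX : ∀ N, IsGUE (P N) (X N))
    (hY : ∀ n, Tendsto (fun N => normTrace (Y N ^ n)) atTop (𝓝 (m n))) (hm : m 0 = 1) :
    AsymptoticallyFree (fun N => expNormTrace (P N)) X (fun N => constMatrix (Ω N) (Y N)) := by
  intro w hw hchain hlim
  have hφ := isSchwingerDyson_limitFunctional hX Y hY hm
  have h0 := hφ.freelyIndependent w hw hchain fun a ha => by
    refine tendsto_nhds_unique (tendsto_limitFunctional hX Y hY _) ((hlim a ha).congr fun N => ?_)
    rw [randomLift, lift_pair_letter]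
  have h1 := tendsto_limitFunctional hX Y hY
    (letterProd (FreeAlgebra.ι ℂ false) (FreeAlgebra.ι ℂ true) w)
  rw [show limitFunctional hX Y (letterProd _ _ w) = 0 from h0] at h1
  refine h1.congr fun N => ?_
  rw [randomLift, lift_pair_letterProd]
  rfl

end Models

end FreeProb

open FreeProb
theorem mainTheorem3
    (Ω : ℕ → Type*) [∀ N, MeasurableSpace (Ω N)]
    (P : ∀ N, Measure (Ω N)) [∀ N, IsProbabilityMeasure (P N)]
    (X : ∀ N, Ω N → Matrix (Fin N) (Fin N) ℂ) (hX : ∀ N, IsGUE (P N) (X N)) :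
    -- a deterministic matrix model `Y N` of a random variable `y`
    (∀ (A : Type*) [Ring A] [Algebra ℂ A] (τ : A →ₗ[ℂ] ℂ) (_ : τ 1 = 1) (y : A)
        (Y : ∀ N, Matrix (Fin N) (Fin N) ℂ)
        (_ : ∀ n : ℕ, Tendsto (fun N => normTrace (Y N ^ n)) atTop (𝓝 (τ (y ^ n)))),
      -- the limits of the mixed moments
      (∀ (n : ℕ) (q : Fin n → ℕ),
        Tendsto
          (fun N => expNormTrace (P N)
            (List.ofFn fun k => X N * constMatrix (Ω N) (Y N) ^ q k).prod)
          atTop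
          (𝓝 (∑ π ∈ nonCrossingPairings n,
            cycleExpectation τ (π * finRotate n) fun k => y ^ q k))) ∧
      -- asymptotic freeness
      AsymptoticallyFree (fun N => expNormTrace (P N)) X (fun N => constMatrix (Ω N) (Y N)) ∧
      -- if `x` is semicircular and free from `y`, then `X N, Y N` model the pair `x, y`
      ∀ x : A, IsSemicircular τ x → FreelyIndependent τ x y →
        (∀ (n : ℕ) (q : Fin n → ℕ),
          τ (List.ofFn fun k => x * y ^ q k).prod =
            ∑ π ∈ nonCrossingPairings n,
              cycleExpectation τ (π * finRotate n) fun k => y ^ q k) ∧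
        (∀ (n : ℕ) (p q : Fin n → ℕ),
          Tendsto
            (fun N => expNormTrace (P N)
              (List.ofFn fun k => X N ^ p k * constMatrix (Ω N) (Y N) ^ q k).prod)
            atTop (𝓝 (τ (List.ofFn fun k => x ^ p k * y ^ q k).prod)))) ∧
    -- GUE + deterministic: the limit distribution is the free convolution with the semicircle
    (∀ (Y : ∀ N, Matrix (Fin N) (Fin N) ℂ) (hY : ∀ N, (Y N).IsHermitian)
        (ν : Measure ℝ) [IsProbabilityMeasure ν] (_ : ∃ K : Set ℝ, IsCompact K ∧ ν Kᶜ = 0)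
        (_ : ∀ f : ℝ →ᵇ ℝ,
          Tendsto (fun N => ∫ t, f t ∂(spectralMeasure (hY N))) atTop (𝓝 (∫ t, f t ∂ν))),
      ∃ σ : Measure ℝ,
        -- `σ` is the free convolution `semicircle ⊞ ν`, which exists and is unique
        (∀ ρ : Measure ℝ, IsFreeConvolution semicircle ν ρ ↔ ρ = σ) ∧
        -- the mean spectral measures of `X N + Y N` converge weakly to `σ`
        (∀ f : ℝ →ᵇ ℝ,
          Tendsto
            (fun N => ∫ ω, ∫ t, f t
              ∂(spectralMeasure (((hX N).isHermitian ω).add (hY N))) ∂(P N))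
            atTop (𝓝 (∫ t, f t ∂σ))) ∧
        -- if the moments of `Y N` converge as well, then so do those of `X N + Y N`
        ((∀ n : ℕ, Tendsto (fun N => normTrace (Y N ^ n)) atTop
            (𝓝 ((∫ t, t ^ n ∂ν : ℝ) : ℂ))) →
          ∀ n : ℕ, Tendsto
            (fun N => expNormTrace (P N) ((X N + constMatrix (Ω N) (Y N)) ^ n))
            atTop (𝓝 ((∫ t, t ^ n ∂σ : ℝ) : ℂ)))) := by
  refine ⟨fun A _ _ τ h1 y Y hY => ?_, fun Y hY ν _ hν hconv =>
    exists_freeConvolution_limit hX hY hν hconv⟩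
  have hm : τ (y ^ 0) = 1 := by rw [pow_zero, h1]
  have hφ := isSchwingerDyson_limitFunctional hX Y hY hm
  have hsum := hφ.map_prod_eq_sum τ y (limitFunctional_Y_pow hX Y hY)
  refine ⟨fun n q => ?_, asymptoticallyFree hX hY hm, fun x hx hxy => ?_⟩
  · have h := tendsto_limitFunctional hX Y hY
      (List.ofFn fun k => FreeAlgebra.ι ℂ false * FreeAlgebra.ι ℂ true ^ q k).prod
    simp only [randomLift, lift_pair_prod, hsum] at h
    exact h
  · have key := hxy.lift_eq hφ.freelyIndependent h1 hφ.map_one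
      (fun n => (HasDistribution.map_pow_semicircle hx n).trans (hφ.map_X_pow n).symm)
      (fun n => (limitFunctional_Y_pow hX Y hY n).symm)
    simp only [lift_pair_ι] at key
    refine ⟨fun n q => ?_, fun n p q => ?_⟩
    · have h := key
        (List.ofFn fun k => FreeAlgebra.ι ℂ false * FreeAlgebra.ι ℂ true ^ q k).prod
      simp only [lift_pair_prod, hsum] at h
      exact h
    · rw [← lift_pair_prod_pow, key]
      have h := tendsto_limitFunctional hX Y hY
        (List.ofFn fun k => FreeAlgebra.ι ℂ false ^ p k * FreeAlgebra.ι ℂ true ^ q k).prod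
      simp only [randomLift, lift_pair_prod_pow] at h
      exact h
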